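/- A set $C$ of vertices of a finite simple graph $G$ is an \emph{identifying code} of $G$ if every closed ball $B(u)=N(u)\cup\{u\}$ meets $C$ and the sets $B(u)\cap C$, for $u\in V(G)$, are pairwise distinct; $G$ is \emph{identifiable} if it has an identifying code. Let $G$ range over the connected identifiable triangle-free graphs with maximum degree $\Delta=\Delta(G)\ge 3$, and let $n=|V(G)|$. Then an identifying code of $G$ of cardinality at most $$n-\frac{n}{\Delta+\frac{3\Delta}{\ln\Delta-1}}$$ can be computed by a deterministic algorithm in time $O(n^2\ln n)$. Precisely: there are a fixed program for a unit-cost word RAM (with words of $k\lceil\log_2 n\rceil$ bits) and absolute constants $k$ and $K$ such that, for every such $G$, given as its adjacency matrix on the vertex set $\{0,\dots,n-1\}$, the program halts after at most $K\,n^2\ln n$ steps and outputs the characteristic vector of such a code. -/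

import Mathlib

/-! ### Identifying codes -/

namespace IdCode

/-- `x` dominates `u` when `u` lies in the closed ball `B(x) = N(x) ∪ {x}`. -/
def Dominates {V : Type*} (G : SimpleGraph V) (x u : V) : Prop :=
  u = x ∨ G.Adj x u

/-- `x` separates `u` and `v` when it dominates exactly one of them. -/
def Separates {V : Type*} (G : SimpleGraph V) (x u v : V) : Prop :=
  Xor (Dominates G x u) (Dominates G x v)

/-- `C` is an identifying code of `G`: it is a dominating set, and any two distinct vertices are
separated by a vertex of `C`. -/
def IsIdentifyingCode {V : Type*} (G : SimpleGraph V) (C : Set V) : Prop :=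
  (∀ u, ∃ x ∈ C, Dominates G x u) ∧ ∀ u v, u ≠ v → ∃ x ∈ C, Separates G x u v

/-- A graph is identifiable if it admits an identifying code. -/
def Identifiable {V : Type*} (G : SimpleGraph V) : Prop :=
  ∃ C : Set V, IsIdentifyingCode G C

/-! ### The machine model: a word RAM with unit-cost instructions

A program is a finite text over registers (each holding one word, addressed by fixed numbers that
are written in the program) and a random-access memory (each cell holding one word, addressed by
the contents of a register). -/

/-- Configuration of the machine: contents of the registers and of the memory. -/
structure State where
  reg : ℕ → ℕ
  mem : ℕ → ℕ

/-- Overwrite register `d` by `x`. -/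
def State.setReg (s : State) (d x : ℕ) : State :=
  { s with reg := Function.update s.reg d x }

/-- Overwrite memory cell `a` by `x`. -/
def State.setMem (s : State) (a x : ℕ) : State :=
  { s with mem := Function.update s.mem a x }

/-- Programs. The arguments `d a b` are numbers of registers; `r a` below is the content of
register `a`. -/
inductive Prog where
  /-- do nothing -/
  | skip
  /-- `r d := c` for a literal `c` -/
  | const (d c : ℕ)
  /-- `r d := r a + r b` -/
  | add (d a b : ℕ)
  /-- `r d := max (r a - r b) 0` -/
  | sub (d a b : ℕ)
  /-- `r d := r a * r b` -/
  | mul (d a b : ℕ)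
  /-- `r d := ⌊r a / r b⌋` (and `0` if `r b = 0`) -/
  | div (d a b : ℕ)
  /-- `r d := memory[r a]` -/
  | load (d a : ℕ)
  /-- `memory[r a] := r b` -/
  | store (a b : ℕ)
  /-- first `p`, then `q` -/
  | seq (p q : Prog)
  /-- if `r a < r b` then `p` else `q` -/
  | ite (a b : ℕ) (p q : Prog)
  /-- while `r a < r b` do `p` -/
  | while (a b : ℕ) (p : Prog)

/-- `Exec w p s t s'`: on a machine with words of `w` bits, program `p` started in `s` halts in
`s'` after exactly `t` steps. Every elementary instruction and every evaluation of a test costs one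
step. An instruction whose result does not fit into a word cannot be executed: a program which
overflows does not halt properly. -/
inductive Exec (w : ℕ) : Prog → State → ℕ → State → Prop
  | skip (s : State) : Exec w .skip s 1 s
  | const (s : State) (d c : ℕ) (h : c < 2 ^ w) :
      Exec w (.const d c) s 1 (s.setReg d c)
  | add (s : State) (d a b : ℕ) (h : s.reg a + s.reg b < 2 ^ w) :
      Exec w (.add d a b) s 1 (s.setReg d (s.reg a + s.reg b))
  | sub (s : State) (d a b : ℕ) (h : s.reg a - s.reg b < 2 ^ w) :
      Exec w (.sub d a b) s 1 (s.setReg d (s.reg a - s.reg b))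
  | mul (s : State) (d a b : ℕ) (h : s.reg a * s.reg b < 2 ^ w) :
      Exec w (.mul d a b) s 1 (s.setReg d (s.reg a * s.reg b))
  | div (s : State) (d a b : ℕ) (h : s.reg a / s.reg b < 2 ^ w) :
      Exec w (.div d a b) s 1 (s.setReg d (s.reg a / s.reg b))
  | load (s : State) (d a : ℕ) (h : s.mem (s.reg a) < 2 ^ w) :
      Exec w (.load d a) s 1 (s.setReg d (s.mem (s.reg a)))
  | store (s : State) (a b : ℕ) (ha : s.reg a < 2 ^ w) (hb : s.reg b < 2 ^ w) :
      Exec w (.store a b) s 1 (s.setMem (s.reg a) (s.reg b))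
  | seq {p q : Prog} {s s₁ s₂ : State} {t₁ t₂ : ℕ}
      (hp : Exec w p s t₁ s₁) (hq : Exec w q s₁ t₂ s₂) :
      Exec w (.seq p q) s (t₁ + t₂) s₂
  | iteTrue {a b : ℕ} {p q : Prog} {s s₁ : State} {t : ℕ}
      (h : s.reg a < s.reg b) (hp : Exec w p s t s₁) :
      Exec w (.ite a b p q) s (1 + t) s₁
  | iteFalse {a b : ℕ} {p q : Prog} {s s₁ : State} {t : ℕ}
      (h : ¬ s.reg a < s.reg b) (hq : Exec w q s t s₁) :
      Exec w (.ite a b p q) s (1 + t) s₁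
  | whileDone {a b : ℕ} {p : Prog} {s : State} (h : ¬ s.reg a < s.reg b) :
      Exec w (.while a b p) s 1 s
  | whileStep {a b : ℕ} {p : Prog} {s s₁ s₂ : State} {t₁ t₂ : ℕ}
      (h : s.reg a < s.reg b) (hp : Exec w p s t₁ s₁)
      (hw : Exec w (.while a b p) s₁ t₂ s₂) :
      Exec w (.while a b p) s (1 + t₁ + t₂) s₂

/-- The machine is deterministic: the running time and the final configuration of a halting
execution are determined by the program and the starting configuration. -/
theorem Exec.det {w : ℕ} {p : Prog} {s s₁ s₂ : State} {t₁ t₂ : ℕ}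
    (h₁ : Exec w p s t₁ s₁) (h₂ : Exec w p s t₂ s₂) : t₁ = t₂ ∧ s₁ = s₂ := by
  induction h₁ generalizing t₂ s₂ with
  | seq _ _ ihp ihq =>
    cases h₂ with
    | seq hp hq =>
      obtain ⟨rfl, rfl⟩ := ihp hp
      obtain ⟨rfl, rfl⟩ := ihq hq
      exact ⟨rfl, rfl⟩
  | iteTrue h _ ih =>
    cases h₂ with
    | iteTrue _ hp => obtain ⟨rfl, rfl⟩ := ih hp; exact ⟨rfl, rfl⟩
    | iteFalse h' _ => exact absurd h h'
  | iteFalse h _ ih =>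
    cases h₂ with
    | iteTrue h' _ => exact absurd h' h
    | iteFalse _ hp => obtain ⟨rfl, rfl⟩ := ih hp; exact ⟨rfl, rfl⟩
  | whileDone h =>
    cases h₂ with
    | whileDone _ => exact ⟨rfl, rfl⟩
    | whileStep h' _ _ => exact absurd h' h
  | whileStep h _ _ ihp ihw =>
    cases h₂ with
    | whileDone h' => exact absurd h h'
    | whileStep _ hp hw =>
      obtain ⟨rfl, rfl⟩ := ihp hp
      obtain ⟨rfl, rfl⟩ := ihw hw
      exact ⟨rfl, rfl⟩
  | _ => cases h₂; exact ⟨rfl, rfl⟩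

/-- Starting configuration for a graph on `{0, …, n - 1}`: register `0` contains `n`, memory cells
`0, …, n² - 1` contain the adjacency matrix row by row, everything else is `0`. -/
def inputState {n : ℕ} (G : SimpleGraph (Fin n)) [DecidableRel G.Adj] : State where
  reg i := if i = 0 then n else 0
  mem i := if ∃ u v : Fin n, i = (u : ℕ) * n + (v : ℕ) ∧ G.Adj u v then 1 else 0

/-- The memory cells `0, …, n - 1` contain the characteristic vector of `C`. -/
def Outputs {n : ℕ} (s : State) (C : Finset (Fin n)) : Prop :=
  ∀ v : Fin n, s.mem (v : ℕ) = if v ∈ C then 1 else 0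

end IdCode

/-!
A code is described by its complement `X`, so a large `X` is wanted: at least `n / (Δ + 3 Δ / L)`
vertices, where `L = ln Δ - 1`. Two vertices are *twins* if they have the same neighbourhood.
Suppose that there are `s` classes of at least two twins and `b` vertices without twins. A class
has at most `Δ` vertices, so `n ≤ Δ s + b`.

* One vertex of each of the `s` classes is an admissible `X` (`isIdentifyingCode_of_twins`).
* Among the `b` vertices without twins there is an independent set of at least `b L / Δ` vertices.
  This is Shearer's theorem on triangle-free graphs: give a vertex of degree `d` the weight `f d`,
  where `f 0 = 1` and `(d² + 1) f d = 1 + (d² - d) f (d - 1)`. Averaging shows that some vertex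
  can be chosen, and deleted together with its neighbours, at the price of at most `1` of the
  total weight (`exists_greedy_vertex`, `weight_greedy_step`), and `d f d ≥ ln d - 1`
  (`le_mul_shF_log`). The weights are computed in fixed-point arithmetic with the unit
  `1 / n ^ 8`. Exchanging vertices for leaves makes the independent set contain all leaves without
  twins (`Base.of_swap`).

The complement of an independent set `I` without twins is an identifying code unless there is a
*bad* edge, all of whose neighbouring vertices lie in `I` (`Fit.isIdentifyingCode`). A bad edge
`ab` is repaired by deleting a neighbour of `b` from `I` and recording the vertex `b`. If this is
done in a suitable order, `I` is left with a subset `I'` without bad edges, and the set `E` of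
recorded vertices has `|I| - |I'|` members. The set `E` is again independent and contains
no two twins, and the same procedure replaces `E` by a subset `E'` without bad edges and a set `D` of
`|E| - |E'|` recorded vertices. The set `D` has no bad edge at all (`Ends.not_bad_record`). As
`|I| = |I'| + |E'| + |D|`, one of the three sets has at least `|I| / 3` vertices. The largest of
the four candidates for `X` reaches the bound: either `s` is large, or `b` and hence `|I|` is
(`size_bound`).

The algorithm is written in a small imperative language with arrays, whose compilation to the word
RAM is proved correct together with bounds for the running time (`Cmd.sound`). The running time is
at most a constant multiple of the largest product of iteration bounds over nested loops
(`Cmd.cost_le`). A round of the greedy algorithm visits each vertex and each list of at most `Δ`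
neighbours, and there are at most `3 n ln n / Δ` rounds (`rounds_le`), because the algorithm stops
as soon as it has chosen the number `b f Δ ≤ n (1 + ln Δ) / Δ` of vertices that it guarantees. The
numbers that occur are smaller than `n ^ 12`.
-/

namespace IdCode

/-! ### A small imperative language over the word RAM -/

/-- Abstract store: variables `v`, two square matrices `m 0`, `m 1`, and arrays `a 0, …, a 31`.
Only entries with indices below the number of vertices are represented in the machine memory. -/
structure St where
  v : ℕ → ℕ
  m : ℕ → ℕ → ℕ → ℕ
  a : ℕ → ℕ → ℕ

/-- Overwrite the variable `x`. -/
def St.setv (σ : St) (x y : ℕ) : St := { σ with v := Function.update σ.v x y }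

/-- Overwrite the entry `i` of the array `j`. -/
def St.seta (σ : St) (j i y : ℕ) : St :=
  { σ with a := Function.update σ.a j (Function.update (σ.a j) i y) }

/-- Overwrite the entry `(r, i)` of the matrix `k`. -/
def St.setm (σ : St) (k r i y : ℕ) : St :=
  ⟨σ.v, fun k' r' i' => if k' = k ∧ r' = r ∧ i' = i then y else σ.m k' r' i', σ.a⟩

@[simp] theorem St.setv_v (σ : St) (x y z : ℕ) :
    (σ.setv x y).v z = if z = x then y else σ.v z := by simp [setv, Function.update_apply]
@[simp] theorem St.setv_m (σ : St) (x y : ℕ) : (σ.setv x y).m = σ.m := rfl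
@[simp] theorem St.setv_a (σ : St) (x y : ℕ) : (σ.setv x y).a = σ.a := rfl
@[simp] theorem St.seta_v (σ : St) (j i y : ℕ) : (σ.seta j i y).v = σ.v := rfl
@[simp] theorem St.seta_m (σ : St) (j i y : ℕ) : (σ.seta j i y).m = σ.m := rfl
@[simp] theorem St.seta_a (σ : St) (j i y j' : ℕ) :
    (σ.seta j i y).a j' = if j' = j then Function.update (σ.a j) i y else σ.a j' := by
  by_cases h : j' = j
  · subst h; simp [seta]
  · simp [seta, h]
@[simp] theorem St.setm_v (σ : St) (k r i y : ℕ) : (σ.setm k r i y).v = σ.v := rfl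
@[simp] theorem St.setm_a (σ : St) (k r i y : ℕ) : (σ.setm k r i y).a = σ.a := rfl
@[simp] theorem St.setm_m (σ : St) (k r i y k' r' i' : ℕ) :
    (σ.setm k r i y).m k' r' i' = if k' = k ∧ r' = r ∧ i' = i then y else σ.m k' r' i' := rfl

/-- Arithmetic expressions; `len` is the number of vertices, subtraction is truncated. -/
inductive Ex where
  | lit (c : ℕ)
  | len
  | var (x : ℕ)
  | add (e f : Ex)
  | sub (e f : Ex)
  | mul (e f : Ex)
  | div (e f : Ex)
  | arr (j : ℕ) (e : Ex)
  | mat (k : ℕ) (e f : Ex)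

/-- Value of an expression. -/
def Ex.eval (n : ℕ) (σ : St) : Ex → ℕ
  | lit c => c
  | len => n
  | var x => σ.v x
  | add e f => e.eval n σ + f.eval n σ
  | sub e f => e.eval n σ - f.eval n σ
  | mul e f => e.eval n σ * f.eval n σ
  | div e f => e.eval n σ / f.eval n σ
  | arr j e => σ.a j (e.eval n σ)
  | mat k e f => σ.m k (e.eval n σ) (f.eval n σ)

/-- The evaluation neither overflows a word nor leaves the bounds of an array. -/
def Ex.ok (n B : ℕ) (σ : St) : Ex → Prop
  | lit c => c < 32
  | len => True
  | var _ => True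
  | add e f => e.ok n B σ ∧ f.ok n B σ ∧ e.eval n σ + f.eval n σ < B
  | sub e f => e.ok n B σ ∧ f.ok n B σ
  | mul e f => e.ok n B σ ∧ f.ok n B σ ∧ e.eval n σ * f.eval n σ < B
  | div e f => e.ok n B σ ∧ f.ok n B σ
  | arr j e => j < 32 ∧ e.ok n B σ ∧ e.eval n σ < n
  | mat k e f => k < 2 ∧ e.ok n B σ ∧ f.ok n B σ ∧ e.eval n σ < n ∧ f.eval n σ < n

open Prog in
/-- Machine code that leaves the value of an expression in the scratch register `2 d + 2` and
uses only scratch registers `2 d' + 2` with `d' ≥ d`. Register `0` holds the number of vertices,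
register `2 x + 1` the variable `x`. -/
def Ex.comp : Ex → ℕ → Prog
  | lit c, d => const (2 * d + 2) c
  | len, d => seq (const (2 * d + 2) 0) (Prog.add (2 * d + 2) (2 * d + 2) 0)
  | var x, d => seq (const (2 * d + 2) 0) (Prog.add (2 * d + 2) (2 * d + 2) (2 * x + 1))
  | .add e f, d => seq (e.comp d) (seq (f.comp (d + 1))
      (Prog.add (2 * d + 2) (2 * d + 2) (2 * (d + 1) + 2)))
  | .sub e f, d => seq (e.comp d) (seq (f.comp (d + 1))
      (Prog.sub (2 * d + 2) (2 * d + 2) (2 * (d + 1) + 2)))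
  | .mul e f, d => seq (e.comp d) (seq (f.comp (d + 1))
      (Prog.mul (2 * d + 2) (2 * d + 2) (2 * (d + 1) + 2)))
  | .div e f, d => seq (e.comp d) (seq (f.comp (d + 1))
      (Prog.div (2 * d + 2) (2 * d + 2) (2 * (d + 1) + 2)))
  | arr j e, d => seq (e.comp d) (seq (const (2 * (d + 1) + 2) j)
      (seq (Prog.add (2 * (d + 1) + 2) (2 * (d + 1) + 2) 0)
      (seq (Prog.add (2 * (d + 1) + 2) (2 * (d + 1) + 2) 0)
      (seq (Prog.mul (2 * (d + 1) + 2) (2 * (d + 1) + 2) 0)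
      (seq (Prog.add (2 * d + 2) (2 * (d + 1) + 2) (2 * d + 2))
        (load (2 * d + 2) (2 * d + 2)))))))
  | mat k e f, d => seq (e.comp d) (seq (f.comp (d + 1)) (seq (const (2 * (d + 2) + 2) k)
      (seq (Prog.mul (2 * (d + 2) + 2) (2 * (d + 2) + 2) 0)
      (seq (Prog.add (2 * d + 2) (2 * (d + 2) + 2) (2 * d + 2))
      (seq (Prog.mul (2 * d + 2) (2 * d + 2) 0)
      (seq (Prog.add (2 * d + 2) (2 * d + 2) (2 * (d + 1) + 2))
        (load (2 * d + 2) (2 * d + 2))))))))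

/-- Running time of the code for an expression. -/
def Ex.cost : Ex → ℕ
  | lit _ => 1
  | len => 2
  | var _ => 2
  | add e f => e.cost + (f.cost + 1)
  | sub e f => e.cost + (f.cost + 1)
  | mul e f => e.cost + (f.cost + 1)
  | div e f => e.cost + (f.cost + 1)
  | arr _ e => e.cost + 6
  | mat _ e f => e.cost + (f.cost + 6)

/-- The machine configuration `s` represents the abstract store `σ`. The last two fields hold in
every configuration reached without overflow, which is why loads need no bound on the value. -/
structure Rel (n w : ℕ) (σ : St) (s : State) : Prop where
  len : s.reg 0 = n
  var : ∀ x, s.reg (2 * x + 1) = σ.v x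
  mat : ∀ k < 2, ∀ r < n, ∀ i < n, s.mem ((k * n + r) * n + i) = σ.m k r i
  arr : ∀ j < 32, ∀ i < n, s.mem ((j + n + n) * n + i) = σ.a j i
  regB : ∀ x, s.reg x < 2 ^ w
  memB : ∀ x, s.mem x < 2 ^ w

theorem Rel.scr {n w : ℕ} {σ : St} {s : State} (h : Rel n w σ s) (d x : ℕ) (hx : x < 2 ^ w) :
    Rel n w σ (s.setReg (2 * d + 2) x) where
  len := by simp [State.setReg, h.len]
  var y := by
    have : 2 * y + 1 ≠ 2 * d + 2 := by omega
    simp only [State.setReg, Function.update_apply, this, h.var, if_false]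
  mat := h.mat
  arr := h.arr
  regB y := by
    simp only [State.setReg, Function.update_apply]; split
    · exact hx
    · exact h.regB y
  memB := h.memB

/-- `p` halts within `c` steps from `s`, in a configuration satisfying `Q`. -/
def Runs (w : ℕ) (p : Prog) (s : State) (c : ℕ) (Q : State → Prop) : Prop :=
  ∃ t s', Exec w p s t s' ∧ t ≤ c ∧ Q s'

namespace Runs

variable {w : ℕ} {s : State} {Q : State → Prop}

theorem seq {p q : Prog} {c₁ c₂ : ℕ} (h : Runs w p s c₁ fun s' => Runs w q s' c₂ Q) :
    Runs w (.seq p q) s (c₁ + c₂) Q := by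
  obtain ⟨t, s', h1, h2, t', s'', h3, h4, h5⟩ := h
  exact ⟨_, _, .seq h1 h3, by omega, h5⟩

theorem mono {p : Prog} {c c' : ℕ} {Q' : State → Prop} (h : Runs w p s c Q) (hc : c ≤ c')
    (hQ : ∀ s, Q s → Q' s) : Runs w p s c' Q' := by
  obtain ⟨t, s', h1, h2, h3⟩ := h
  exact ⟨t, s', h1, h2.trans hc, hQ _ h3⟩

theorem const {d c : ℕ} (h : c < 2 ^ w) (hQ : Q (s.setReg d c)) : Runs w (.const d c) s 1 Q :=
  ⟨_, _, .const _ _ _ h, le_rfl, hQ⟩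
theorem add {d a b : ℕ} (h : s.reg a + s.reg b < 2 ^ w)
    (hQ : Q (s.setReg d (s.reg a + s.reg b))) : Runs w (.add d a b) s 1 Q :=
  ⟨_, _, .add _ _ _ _ h, le_rfl, hQ⟩
theorem sub {d a b : ℕ} (h : s.reg a - s.reg b < 2 ^ w)
    (hQ : Q (s.setReg d (s.reg a - s.reg b))) : Runs w (.sub d a b) s 1 Q :=
  ⟨_, _, .sub _ _ _ _ h, le_rfl, hQ⟩
theorem mul {d a b : ℕ} (h : s.reg a * s.reg b < 2 ^ w)
    (hQ : Q (s.setReg d (s.reg a * s.reg b))) : Runs w (.mul d a b) s 1 Q :=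
  ⟨_, _, .mul _ _ _ _ h, le_rfl, hQ⟩
theorem div {d a b : ℕ} (h : s.reg a / s.reg b < 2 ^ w)
    (hQ : Q (s.setReg d (s.reg a / s.reg b))) : Runs w (.div d a b) s 1 Q :=
  ⟨_, _, .div _ _ _ _ h, le_rfl, hQ⟩
theorem load {d a : ℕ} (h : s.mem (s.reg a) < 2 ^ w)
    (hQ : Q (s.setReg d (s.mem (s.reg a)))) : Runs w (.load d a) s 1 Q :=
  ⟨_, _, .load _ _ _ h, le_rfl, hQ⟩
theorem store {a b : ℕ} (ha : s.reg a < 2 ^ w) (hb : s.reg b < 2 ^ w)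
    (hQ : Q (s.setMem (s.reg a) (s.reg b))) : Runs w (.store a b) s 1 Q :=
  ⟨_, _, .store _ _ _ ha hb, le_rfl, hQ⟩

end Runs

/-- Words are long enough for all addresses and small constants. -/
structure Wide (n w : ℕ) : Prop where
  four : 4 ≤ n
  pow : n ^ 12 ≤ 2 ^ w

theorem Wide.addr {n w : ℕ} (h : Wide n w) {r i : ℕ} (hr : r < n + n + 32) (hi : i < n) :
    r * n + i < 2 ^ w := by
  refine lt_of_lt_of_le ?_ h.pow
  have h4 := h.four
  have h2 : 4 * 4 ≤ n * n := Nat.mul_le_mul h4 h4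
  have h3 : 4 * (n * n) ≤ n * (n * n) := Nat.mul_le_mul_right _ h4
  have : (r + 1) * n ≤ (n * (n * n)) * n := Nat.mul_le_mul_right _ (by nlinarith)
  have e : n ^ 4 ≤ n ^ 12 := Nat.pow_le_pow_right (by omega) (by norm_num)
  have e' : n ^ 4 = n * (n * n) * n := by ring
  have e'' : (r + 1) * n = r * n + n := by ring
  omega

theorem Wide.small {n w : ℕ} (h : Wide n w) : n + n + 32 < 2 ^ w := by
  refine lt_of_lt_of_le ?_ h.pow
  have h4 := h.four
  have h2 : 4 * n ≤ n * n := Nat.mul_le_mul_right _ h4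
  have h3 : 4 * (n * n) ≤ n * (n * n) := Nat.mul_le_mul_right _ h4
  have e : n ^ 3 ≤ n ^ 12 := Nat.pow_le_pow_right (by omega) (by norm_num)
  have e' : n ^ 3 = n * (n * n) := by ring
  omega

section Soundness

variable {n w : ℕ}

theorem Rel.v_lt {σ : St} {s : State} (h : Rel n w σ s) (x : ℕ) : σ.v x < 2 ^ w := by
  rw [← h.var]; exact h.regB _

/-- Address computation for `mul` by the register that holds the number of vertices. -/
theorem Wide.row {n w : ℕ} (h : Wide n w) {r : ℕ} (hr : r < n + n + 32) : r * n < 2 ^ w := by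
  have := h.addr hr (i := 0) (by have := h.four; omega)
  omega

/-- The code of an expression is correct: it leaves the value in its scratch register and changes
neither the represented store nor the scratch registers of lower index, which may hold intermediate
values. -/
theorem Ex.comp_runs (hw : Wide n w) (e : Ex) : ∀ (d : ℕ) (σ : St) (s : State) (Q : State → Prop),
    Rel n w σ s → e.ok n (2 ^ w) σ →
    (∀ s', Rel n w σ s' → s'.reg (2 * d + 2) = e.eval n σ →
      (∀ d' < d, s'.reg (2 * d' + 2) = s.reg (2 * d' + 2)) → s'.mem = s.mem → Q s') →
    Runs w (e.comp d) s e.cost Q := by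
  have hsm := hw.small
  have bin : ∀ (e f : Ex)
    (ihe : ∀ (d : ℕ) (σ : St) (s : State) (Q : State → Prop),
    Rel n w σ s → e.ok n (2 ^ w) σ →
    (∀ s', Rel n w σ s' → s'.reg (2 * d + 2) = e.eval n σ →
      (∀ d' < d, s'.reg (2 * d' + 2) = s.reg (2 * d' + 2)) → s'.mem = s.mem → Q s') →
    Runs w (e.comp d) s e.cost Q)
    (ihf : ∀ (d : ℕ) (σ : St) (s : State) (Q : State → Prop),
    Rel n w σ s → f.ok n (2 ^ w) σ →
    (∀ s', Rel n w σ s' → s'.reg (2 * d + 2) = f.eval n σ →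
      (∀ d' < d, s'.reg (2 * d' + 2) = s.reg (2 * d' + 2)) → s'.mem = s.mem → Q s') →
    Runs w (f.comp d) s f.cost Q) (d : ℕ) (σ : St) (s : State) (Q : State → Prop)
    (_ : Rel n w σ s) (_ : e.ok n (2 ^ w) σ) (_ : f.ok n (2 ^ w) σ) (p : Prog) (c : ℕ),
    (∀ s', Rel n w σ s' → s'.reg (2 * d + 2) = e.eval n σ →
      s'.reg (2 * (d + 1) + 2) = f.eval n σ →
      (∀ d' < d, s'.reg (2 * d' + 2) = s.reg (2 * d' + 2)) → s'.mem = s.mem → Runs w p s' c Q) →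
    Runs w (.seq (e.comp d) (.seq (f.comp (d + 1)) p)) s (e.cost + (f.cost + c)) Q := by
    intro e f ihe ihf d σ s Q hR he hf p c hQ
    refine Runs.seq (ihe _ _ _ _ hR he fun s1 hR1 h1 h1' h1'' => ?_)
    refine Runs.seq (ihf _ _ _ _ hR1 hf fun s2 hR2 h2 h2' h2'' => ?_)
    refine hQ s2 hR2 ((h2' d (by omega)).trans h1) h2 (fun d' hd' => ?_) (h2''.trans h1'')
    rw [h2' d' (by omega), h1' d' hd']
  have fin : ∀ (d : ℕ) (σ : St) (s s1 : State) (x y : ℕ) (Q : State → Prop) (hx : x < 2 ^ w)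
    (_ : x = y)
    (_ : Rel n w σ s1) (_ : ∀ d' < d, s1.reg (2 * d' + 2) = s.reg (2 * d' + 2))
    (_ : s1.mem = s.mem),
    (∀ s', Rel n w σ s' → s'.reg (2 * d + 2) = y →
      (∀ d' < d, s'.reg (2 * d' + 2) = s.reg (2 * d' + 2)) → s'.mem = s.mem → Q s') →
      Q (s1.setReg (2 * d + 2) x) := by
    intro d σ s s1 x y Q hx hxy hR h1 h2 hQ
    refine hQ _ (hR.scr _ _ hx) ?_ ?_ h2
    · simp [State.setReg, hxy]
    · intro d' hd'
      have : 2 * d' + 2 ≠ 2 * d + 2 := by omega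
      rw [← h1 d' hd']
      simp only [State.setReg, Function.update_apply, this, if_false]
  induction e with
  | lit c =>
    intro d σ s Q hR ho hQ
    simp only [ok] at ho
    exact Runs.const (by omega) (fin _ _ _ _ _ _ _ (by omega) rfl hR (fun _ _ => rfl) rfl hQ)
  | len =>
    intro d σ s Q hR ho hQ
    refine Runs.mono (c := 1 + 1) (Q := Q) ?_ le_rfl (fun _ h => h)
    refine Runs.seq (Runs.const (by omega) ?_)
    have e : (s.setReg (2 * d + 2) 0).reg (2 * d + 2) + (s.setReg (2 * d + 2) 0).reg 0 = n := by
      simp [State.setReg, hR.len]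
    refine Runs.add (by rw [e]; omega) (fin d σ s _ _ _ Q (by rw [e]; omega) e
      (hR.scr _ _ (by omega)) (fun d' hd' => ?_) rfl hQ)
    have : 2 * d' + 2 ≠ 2 * d + 2 := by omega
    simp only [State.setReg, Function.update_apply, this, if_false]
  | var x =>
    intro d σ s Q hR ho hQ
    refine Runs.mono (c := 1 + 1) (Q := Q) ?_ le_rfl (fun _ h => h)
    refine Runs.seq (Runs.const (by omega) ?_)
    have e : (s.setReg (2 * d + 2) 0).reg (2 * d + 2)
        + (s.setReg (2 * d + 2) 0).reg (2 * x + 1) = σ.v x := by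
      have := (hR.scr d 0 (by omega)).var x
      rw [this]; simp [State.setReg]
    have := hR.v_lt x
    refine Runs.add (by rw [e]; omega) (fin d σ s _ _ _ Q (by rw [e]; omega) e
      (hR.scr _ _ (by omega)) (fun d' hd' => ?_) rfl hQ)
    have : 2 * d' + 2 ≠ 2 * d + 2 := by omega
    simp only [State.setReg, Function.update_apply, this, if_false]
  | add e f ihe ihf =>
    intro d σ s Q hR ho hQ
    refine bin e f ihe ihf d σ s Q hR ho.1 ho.2.1 _ _ fun s1 h1 h2 h3 h4 h5 => ?_
    have h6 : s1.reg (2 * d + 2) + s1.reg (2 * (d + 1) + 2) < 2 ^ w := by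
      rw [h2, h3]; exact ho.2.2
    exact Runs.add h6 (fin _ _ _ _ _ _ _ h6 (by rw [h2, h3]; rfl) h1 h4 h5 hQ)
  | sub e f ihe ihf =>
    intro d σ s Q hR ho hQ
    refine bin e f ihe ihf d σ s Q hR ho.1 ho.2 _ _ fun s1 h1 h2 h3 h4 h5 => ?_
    have h6 : s1.reg (2 * d + 2) - s1.reg (2 * (d + 1) + 2) < 2 ^ w :=
      lt_of_le_of_lt (Nat.sub_le _ _) (h1.regB _)
    exact Runs.sub h6 (fin _ _ _ _ _ _ _ h6 (by rw [h2, h3]; rfl) h1 h4 h5 hQ)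
  | mul e f ihe ihf =>
    intro d σ s Q hR ho hQ
    refine bin e f ihe ihf d σ s Q hR ho.1 ho.2.1 _ _ fun s1 h1 h2 h3 h4 h5 => ?_
    have h6 : s1.reg (2 * d + 2) * s1.reg (2 * (d + 1) + 2) < 2 ^ w := by
      rw [h2, h3]; exact ho.2.2
    exact Runs.mul h6 (fin _ _ _ _ _ _ _ h6 (by rw [h2, h3]; rfl) h1 h4 h5 hQ)
  | div e f ihe ihf =>
    intro d σ s Q hR ho hQ
    refine bin e f ihe ihf d σ s Q hR ho.1 ho.2 _ _ fun s1 h1 h2 h3 h4 h5 => ?_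
    have h6 : s1.reg (2 * d + 2) / s1.reg (2 * (d + 1) + 2) < 2 ^ w :=
      lt_of_le_of_lt (Nat.div_le_self _ _) (h1.regB _)
    exact Runs.div h6 (fin _ _ _ _ _ _ _ h6 (by rw [h2, h3]; rfl) h1 h4 h5 hQ)
  | arr j e ihe =>
    intro d σ s Q hR ho hQ
    obtain ⟨hj, he, hi⟩ := ho
    refine Runs.seq (ihe _ _ _ _ hR he fun s1 hR1 h1 h1' h1'' => ?_)
    have ha := hw.addr (r := j + n + n) (by omega) hi
    have hr := hw.row (r := j + n + n) (by omega)
    have hL := hR1.len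
    have hm := hR1.arr j hj _ hi
    refine Runs.mono (c := 1 + (1 + (1 + (1 + (1 + 1))))) (Q := Q) ?_ le_rfl (fun _ h => h)
    have q1 : (2 * d + 2 = 2 * (d + 1) + 2) = False := by simp
    refine Runs.seq (Runs.const (by omega) ?_)
    refine Runs.seq (Runs.add (by simp [State.setReg, hL]; omega) ?_)
    refine Runs.seq (Runs.add (by simp [State.setReg, hL]; omega) ?_)
    refine Runs.seq (Runs.mul (by simp [State.setReg, hL]; omega) ?_)
    refine Runs.seq (Runs.add (by simp [State.setReg, hL, h1]; omega) ?_)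
    simp only [State.setReg, Function.update_apply, hL, h1, if_true, q1, if_false]
    refine Runs.load (hR1.memB _) ?_
    simp only [State.setReg, Function.update_apply, if_true]
    have key : s1.mem ((j + n + n) * n + e.eval n σ) = (Ex.arr j e).eval n σ := by rw [hm]; rfl
    refine hQ _ ?_ ?_ ?_ ?_
    · have r1 := ((((((hR1.scr (d+1) j (by omega)).scr (d+1) (j+n) (by omega)).scr (d+1)
        (j+n+n) (by omega)).scr (d+1) _ hr).scr d _ ha).scr d _ (hR1.memB
          ((j + n + n) * n + e.eval n σ)))
      simpa [State.setReg] using r1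
    · simp; rw [hm]; rfl
    · intro d' hd'
      have e1 : 2 * d' + 2 ≠ 2 * d + 2 := by omega
      have e2 : 2 * d' + 2 ≠ 2 * (d+1) + 2 := by omega
      simp only [Function.update_apply, e1, e2, if_false, h1' d' hd']
    · exact h1''
  | mat k e f ihe ihf =>
    intro d σ s Q hR ho hQ
    obtain ⟨hk, he, hf, hi, hj⟩ := ho
    refine bin e f ihe ihf d σ s Q hR he hf _ _ fun s1 hR1 h1 h2 h3 h4 => ?_
    have hkn : k * n ≤ 1 * n := Nat.mul_le_mul_right _ (by omega)
    have hk' := hw.row (r := k) (by omega)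
    have ha := hw.addr (r := k * n + e.eval n σ) (by omega) hj
    have hr := hw.row (r := k * n + e.eval n σ) (by omega)
    have hL := hR1.len
    have hm := hR1.mat k hk _ hi _ hj
    refine Runs.mono (c := 1 + (1 + (1 + (1 + (1 + 1))))) (Q := Q) ?_ le_rfl (fun _ h => h)
    have q2 : (2 * (d + 1) + 2 = 2 * d + 2) = False := by simp
    have q3 : (2 * d + 2 = 2 * (d + 2) + 2) = False := by simp
    have q5 : (2 * (d + 1) + 2 = 2 * (d + 2) + 2) = False := by simp
    refine Runs.seq (Runs.const (by omega) ?_)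
    refine Runs.seq (Runs.mul (by simp [State.setReg, hL]; omega) ?_)
    refine Runs.seq (Runs.add (by simp [State.setReg, hL, h1]; omega) ?_)
    refine Runs.seq (Runs.mul (by simp [State.setReg, hL, h1]; omega) ?_)
    refine Runs.seq (Runs.add (by
      simp [State.setReg, hL, h1, h2]; omega) ?_)
    have r1 := (((((hR1.scr (d+2) k (by omega)).scr (d+2) (k*n) (by omega)).scr d
        (k*n+e.eval n σ) (by omega)).scr d _ hr).scr d _ ha).scr d _ (hR1.memB
          ((k*n+e.eval n σ) * n + f.eval n σ))
    simp only [State.setReg, Function.update_apply, hL, h1, h2, if_true, q2, q3, q5,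
      if_false]
    refine Runs.load (hR1.memB _) ?_
    simp only [State.setReg, Function.update_apply, if_true]
    have z : ((0:ℕ) = 2 * (d + 2) + 2) = False := by simp
    have z' : ((0:ℕ) = 2 * d + 2) = False := by simp
    simp only [z, z', if_false]
    refine hQ _ ?_ ?_ ?_ ?_
    · simpa [State.setReg] using r1
    · simp; rw [hm]; rfl
    · intro d' hd'
      have e1 : 2 * d' + 2 ≠ 2 * d + 2 := by omega
      have e2 : 2 * d' + 2 ≠ 2 * (d+2) + 2 := by omega
      simp only [Function.update_apply, e1, e2, if_false, h3 d' hd']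
    · exact h4

/-- Distinct cells of the row-by-row layout have distinct addresses. -/
theorem cell_inj {n r i r' i' : ℕ} (hi : i < n) (hi' : i' < n) (h : r * n + i = r' * n + i') :
    r = r' ∧ i = i' := by
  have h1 : (r * n + i) / n = r := by
    rw [mul_comm, Nat.mul_add_div (by omega), Nat.div_eq_of_lt hi, add_zero]
  have h2 : (r' * n + i') / n = r' := by
    rw [mul_comm, Nat.mul_add_div (by omega), Nat.div_eq_of_lt hi', add_zero]
  have : r = r' := by rw [← h1, ← h2, h]
  subst this
  exact ⟨rfl, by omega⟩

theorem Rel.setv {σ : St} {s : State} (h : Rel n w σ s) (x y : ℕ) (hy : y < 2 ^ w) :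
    Rel n w (σ.setv x y) (s.setReg (2 * x + 1) y) where
  len := by simp [State.setReg, h.len]
  var z := by
    have : (2 * z + 1 = 2 * x + 1) ↔ z = x := by omega
    simp only [State.setReg, Function.update_apply, this, h.var, St.setv_v]
  mat := h.mat
  arr := h.arr
  regB z := by
    simp only [State.setReg, Function.update_apply]; split
    · exact hy
    · exact h.regB z
  memB := h.memB

theorem Rel.seta {σ : St} {s : State} (h : Rel n w σ s) {j i : ℕ} (y : ℕ) (hj : j < 32)
    (hi : i < n) (hy : y < 2 ^ w) :
    Rel n w (σ.seta j i y) (s.setMem ((j + n + n) * n + i) y) where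
  len := h.len
  var := h.var
  mat k hk r hr i' hi' := by
    have hne : (k * n + r) * n + i' ≠ (j + n + n) * n + i := by
      intro e
      obtain ⟨e1, -⟩ := cell_inj hi' hi e
      have : k * n ≤ 1 * n := Nat.mul_le_mul_right _ (by omega)
      omega
    simp only [State.setMem, Function.update_apply, hne, if_false, St.seta_m]
    exact h.mat k hk r hr i' hi'
  arr j' hj' i' hi' := by
    have e : (j' + n + n) * n + i' = (j + n + n) * n + i ↔ j' = j ∧ i' = i := by
      constructor
      · intro e
        obtain ⟨e1, e2⟩ := cell_inj hi' hi e
        exact ⟨by omega, e2⟩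
      · rintro ⟨rfl, rfl⟩; rfl
    have := h.arr j' hj' i' hi'
    simp only [State.setMem, Function.update_apply, e, St.seta_a]
    by_cases h1 : j' = j
    · subst h1
      by_cases h2 : i' = i
      · simp [h2]
      · simp [h2, this]
    · simp [h1, this]
  regB := h.regB
  memB z := by
    simp only [State.setMem, Function.update_apply]; split
    · exact hy
    · exact h.memB z

theorem Rel.setm {σ : St} {s : State} (h : Rel n w σ s) {k r i : ℕ} (y : ℕ) (hk : k < 2)
    (hr : r < n) (hi : i < n) (hy : y < 2 ^ w) :
    Rel n w (σ.setm k r i y) (s.setMem ((k * n + r) * n + i) y) where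
  len := h.len
  var := h.var
  mat k' hk' r' hr' i' hi' := by
    have e : (k' * n + r') * n + i' = (k * n + r) * n + i ↔ k' = k ∧ r' = r ∧ i' = i := by
      constructor
      · intro e
        obtain ⟨e1, e2⟩ := cell_inj hi' hi e
        obtain ⟨e3, e4⟩ := cell_inj hr' hr e1
        exact ⟨e3, e4, e2⟩
      · rintro ⟨rfl, rfl, rfl⟩; rfl
    simp only [State.setMem, Function.update_apply, e, St.setm_m]
    split
    · rfl
    · exact h.mat k' hk' r' hr' i' hi'
  arr j hj i' hi' := by
    have hne : (j + n + n) * n + i' ≠ (k * n + r) * n + i := by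
      intro e
      obtain ⟨e1, -⟩ := cell_inj hi' hi e
      have : k * n ≤ 1 * n := Nat.mul_le_mul_right _ (by omega)
      omega
    simp only [State.setMem, Function.update_apply, hne, if_false, St.setm_a]
    exact h.arr j hj i' hi'
  regB := h.regB
  memB z := by
    simp only [State.setMem, Function.update_apply]; split
    · exact hy
    · exact h.memB z

end Soundness

/-- Commands. The number `b` in `loop b e f C` (while `e < f` do `C`) does not influence the
code: it names the entry of a table of bounds that limits the number of iterations. -/
inductive Cmd where
  | skip
  | asg (x : ℕ) (e : Ex)
  | put (j : ℕ) (e f : Ex)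
  | putm (k : ℕ) (e f g : Ex)
  | seq (C D : Cmd)
  | ite (e f : Ex) (C D : Cmd)
  | loop (b : ℕ) (e f : Ex) (C : Cmd)

/-- Machine code of a command. -/
def Cmd.comp : Cmd → Prog
  | skip => .skip
  | asg x e => .seq (e.comp 0) (.seq (.const 4 0) (.add (2 * x + 1) 2 4))
  | put j e f => .seq (e.comp 0) (.seq (f.comp 1) (.seq (.const 6 j) (.seq (.add 6 6 0)
      (.seq (.add 6 6 0) (.seq (.mul 6 6 0) (.seq (.add 2 6 2) (.store 2 4)))))))
  | putm k e f g => .seq (e.comp 0) (.seq (f.comp 1) (.seq (g.comp 2) (.seq (.const 8 k)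
      (.seq (.mul 8 8 0) (.seq (.add 2 8 2) (.seq (.mul 2 2 0) (.seq (.add 2 2 4)
      (.store 2 6))))))))
  | seq C D => .seq C.comp D.comp
  | ite e f C D => .seq (e.comp 0) (.seq (f.comp 1) (.ite 2 4 C.comp D.comp))
  | loop _ e f C => .seq (e.comp 0) (.seq (f.comp 1)
      (.while 2 4 (.seq C.comp (.seq (e.comp 0) (f.comp 1)))))

/-- Upper bound for the running time of a command, given the table `ρ` of iteration bounds. -/
def Cmd.cost (ρ : ℕ → ℕ) : Cmd → ℕ
  | skip => 1
  | asg _ e => e.cost + 2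
  | put _ e f => e.cost + (f.cost + 6)
  | putm _ e f g => e.cost + (f.cost + (g.cost + 6))
  | seq C D => C.cost ρ + D.cost ρ
  | ite e f C D => e.cost + (f.cost + (1 + max (C.cost ρ) (D.cost ρ)))
  | loop b e f C => e.cost + (f.cost + (ρ b * (1 + (C.cost ρ + (e.cost + f.cost))) + 1))

/-- Weakest precondition of a command for the postcondition `Q`: it halts within the bounds of
the table `ρ` and without overflow, in a store satisfying `Q`. -/
def Cmd.wp (n B : ℕ) (ρ : ℕ → ℕ) : Cmd → (St → Prop) → St → Prop
  | skip, Q, σ => Q σ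
  | asg x e, Q, σ => e.ok n B σ ∧ Q (σ.setv x (e.eval n σ))
  | put j e f, Q, σ => j < 32 ∧ e.ok n B σ ∧ f.ok n B σ ∧ e.eval n σ < n ∧
      Q (σ.seta j (e.eval n σ) (f.eval n σ))
  | putm k e f g, Q, σ => k < 2 ∧ e.ok n B σ ∧ f.ok n B σ ∧ g.ok n B σ ∧ e.eval n σ < n ∧
      f.eval n σ < n ∧ Q (σ.setm k (e.eval n σ) (f.eval n σ) (g.eval n σ))
  | seq C D, Q, σ => C.wp n B ρ (D.wp n B ρ Q) σ
  | ite e f C D, Q, σ => e.ok n B σ ∧ f.ok n B σ ∧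
      (e.eval n σ < f.eval n σ → C.wp n B ρ Q σ) ∧ (¬ e.eval n σ < f.eval n σ → D.wp n B ρ Q σ)
  | loop b e f C, Q, σ => ∃ Inv : ℕ → St → Prop, Inv 0 σ ∧ ∀ i τ, Inv i τ →
      e.ok n B τ ∧ f.ok n B τ ∧
      (e.eval n τ < f.eval n τ → i < ρ b ∧ C.wp n B ρ (Inv (i + 1)) τ) ∧
      (¬ e.eval n τ < f.eval n τ → Q τ)

/-- Weakest preconditions and costs of commands describe the machine code truly. -/
theorem Cmd.sound {n w : ℕ} {ρ : ℕ → ℕ} (hw : Wide n w) (C : Cmd) :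
    ∀ (σ : St) (s : State) (Q : St → Prop), Rel n w σ s → C.wp n (2 ^ w) ρ Q σ →
      Runs w C.comp s (C.cost ρ) fun s' => ∃ σ', Rel n w σ' s' ∧ Q σ' := by
  have hsm := hw.small
  have two : ∀ (e f : Ex) (σ : St) (s : State) (Q : State → Prop), Rel n w σ s →
      e.ok n (2 ^ w) σ → f.ok n (2 ^ w) σ → ∀ (p : Prog) (c : ℕ),
      (∀ s', Rel n w σ s' → s'.reg 2 = e.eval n σ → s'.reg 4 = f.eval n σ → Runs w p s' c Q) →
      Runs w (.seq (e.comp 0) (.seq (f.comp 1) p)) s (e.cost + (f.cost + c)) Q := by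
    intro e f σ s Q hR he hf p c hQ
    refine Runs.seq (Ex.comp_runs hw e _ _ _ _ hR he fun s1 hR1 h1 _ _ => ?_)
    refine Runs.seq (Ex.comp_runs hw f _ _ _ _ hR1 hf fun s2 hR2 h2 h2' _ => ?_)
    exact hQ s2 hR2 ((h2' 0 (by omega)).trans h1) h2
  have two' : ∀ (e f : Ex) (σ : St) (s : State) (Q : State → Prop), Rel n w σ s →
      e.ok n (2 ^ w) σ → f.ok n (2 ^ w) σ →
      (∀ s', Rel n w σ s' → s'.reg 2 = e.eval n σ → s'.reg 4 = f.eval n σ → Q s') →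
      Runs w (.seq (e.comp 0) (f.comp 1)) s (e.cost + f.cost) Q := by
    intro e f σ s Q hR he hf hQ
    refine Runs.seq (Ex.comp_runs hw e _ _ _ _ hR he fun s1 hR1 h1 _ _ => ?_)
    refine (Ex.comp_runs hw f _ _ _ _ hR1 hf fun s2 hR2 h2 h2' _ => ?_)
    exact hQ s2 hR2 ((h2' 0 (by omega)).trans h1) h2
  induction C with
  | skip => exact fun σ s Q hR h => ⟨_, _, .skip _, le_rfl, σ, hR, h⟩
  | asg x e =>
    intro σ s Q hR h
    refine Runs.seq (Ex.comp_runs hw e _ _ _ _ hR h.1 fun s1 hR1 h1 _ _ => ?_)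
    refine Runs.mono (c := 1 + 1) ?_ le_rfl (fun _ h => h)
    refine Runs.seq (Runs.const (by omega) ?_)
    have hR2 := hR1.scr 1 0 (by omega)
    have e1 : (s1.setReg 4 0).reg 2 + (s1.setReg 4 0).reg 4 = e.eval n σ := by
      simpa [State.setReg] using h1
    have hlt : e.eval n σ < 2 ^ w := by rw [← h1]; exact hR1.regB _
    refine Runs.add (by rw [e1]; exact hlt) ⟨_, ?_, h.2⟩
    rw [e1]
    exact hR2.setv _ _ hlt
  | put j e f =>
    intro σ s Q hR ⟨hj, he, hf, hi, hQ⟩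
    refine two e f σ s _ hR he hf _ _ fun s1 hR1 h1 h2 => ?_
    refine Runs.mono (c := 1 + (1 + (1 + (1 + (1 + 1))))) ?_ le_rfl (fun _ h => h)
    have ha := hw.addr (r := j + n + n) (by omega) hi
    have hr := hw.row (r := j + n + n) (by omega)
    have hL := hR1.len
    have hy : f.eval n σ < 2 ^ w := by rw [← h2]; exact hR1.regB _
    refine Runs.seq (Runs.const (by omega) ?_)
    refine Runs.seq (Runs.add (by simp [State.setReg, hL]; omega) ?_)
    refine Runs.seq (Runs.add (by simp [State.setReg, hL]; omega) ?_)
    refine Runs.seq (Runs.mul (by simp [State.setReg, hL]; omega) ?_)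
    refine Runs.seq (Runs.add (by simp [State.setReg, hL, h1]; omega) ?_)
    have r1 := ((((((hR1.scr 2 j (by omega)).scr 2 (j+n) (by omega)).scr 2
        (j+n+n) (by omega)).scr 2 _ hr).scr 0 _ ha).seta _ hj hi hy)
    refine Runs.store (by simp [State.setReg, hL, h1]; omega)
      (by simp [State.setReg, h2]; omega) ⟨_, ?_, hQ⟩
    simpa [State.setReg, State.setMem, hL, h1, h2] using r1
  | putm k e f g =>
    intro σ s Q hR ⟨hk, he, hf, hg, hi, hj, hQ⟩
    refine Runs.seq (Ex.comp_runs hw e _ _ _ _ hR he fun s1 hR1 h1 _ _ => ?_)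
    refine Runs.seq (Ex.comp_runs hw f _ _ _ _ hR1 hf fun s2 hR2 h2 h2' _ => ?_)
    refine Runs.seq (Ex.comp_runs hw g _ _ _ _ hR2 hg fun s3 hR3 h3 h3' _ => ?_)
    have g1 : s3.reg 2 = e.eval n σ := (h3' 0 (by omega)).trans ((h2' 0 (by omega)).trans h1)
    have g2 : s3.reg 4 = f.eval n σ := (h3' 1 (by omega)).trans h2
    have g3 : s3.reg 6 = g.eval n σ := h3
    refine Runs.mono (c := 1 + (1 + (1 + (1 + (1 + 1))))) ?_ le_rfl (fun _ h => h)
    have hkn : k * n ≤ 1 * n := Nat.mul_le_mul_right _ (by omega)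
    have hk' := hw.row (r := k) (by omega)
    have ha := hw.addr (r := k * n + e.eval n σ) (by omega) hj
    have hr := hw.row (r := k * n + e.eval n σ) (by omega)
    have hL := hR3.len
    have hy : g.eval n σ < 2 ^ w := by rw [← g3]; exact hR3.regB _
    refine Runs.seq (Runs.const (by omega) ?_)
    refine Runs.seq (Runs.mul (by simp [State.setReg, hL]; omega) ?_)
    refine Runs.seq (Runs.add (by simp [State.setReg, hL, g1]; omega) ?_)
    refine Runs.seq (Runs.mul (by simp [State.setReg, hL, g1]; omega) ?_)
    refine Runs.seq (Runs.add (by simp [State.setReg, hL, g1, g2]; omega) ?_)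
    have r1 := (((((hR3.scr 3 k (by omega)).scr 3 (k*n) (by omega)).scr 0
        (k*n+e.eval n σ) (by omega)).scr 0 _ hr).scr 0 _ ha).setm (k := k) _ hk hi hj hy
    refine Runs.store (by simp [State.setReg, hL, g1, g2]; omega)
      (by simp [State.setReg, g3]; omega) ⟨_, ?_, hQ⟩
    simpa [State.setReg, State.setMem, hL, g1, g2, g3] using r1
  | seq C D ihC ihD =>
    intro σ s Q hR h
    refine Runs.seq (Runs.mono (ihC _ _ _ hR h) le_rfl ?_)
    rintro s1 ⟨σ1, hR1, h1⟩
    exact ihD _ _ _ hR1 h1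
  | ite e f C D ihC ihD =>
    intro σ s Q hR ⟨he, hf, hC, hD⟩
    refine two e f σ s _ hR he hf _ _ fun s1 hR1 h1 h2 => ?_
    by_cases hlt : e.eval n σ < f.eval n σ
    · obtain ⟨t, s', h3, h4, h5⟩ := ihC _ _ _ hR1 (hC hlt)
      exact ⟨_, _, .iteTrue (by rw [h1, h2]; exact hlt) h3, by omega, h5⟩
    · obtain ⟨t, s', h3, h4, h5⟩ := ihD _ _ _ hR1 (hD hlt)
      exact ⟨_, _, .iteFalse (by rw [h1, h2]; exact hlt) h3, by omega, h5⟩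
  | loop b e f C ih =>
    intro σ s Q hR ⟨Inv, h0, hI⟩
    obtain ⟨he, hf, -, -⟩ := hI 0 σ h0
    refine two e f σ s _ hR he hf _ _ fun s1 hR1 h1 h2 => ?_
    suffices H : ∀ k i τ s, ρ b - i = k → Inv i τ → Rel n w τ s → s.reg 2 = e.eval n τ →
        s.reg 4 = f.eval n τ →
        Runs w (.while 2 4 (.seq C.comp (.seq (e.comp 0) (f.comp 1)))) s
          (k * (1 + (C.cost ρ + (e.cost + f.cost))) + 1) fun s' => ∃ σ', Rel n w σ' s' ∧ Q σ' from
      H (ρ b) 0 σ s1 (by omega) h0 hR1 h1 h2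
    intro k
    induction k with
    | zero =>
      intro i τ s hk hi hR h1 h2
      obtain ⟨-, -, h3, h4⟩ := hI i τ hi
      have hlt : ¬ e.eval n τ < f.eval n τ := fun h => by have := (h3 h).1; omega
      exact ⟨_, _, .whileDone (by rw [h1, h2]; exact hlt), by omega, τ, hR, h4 hlt⟩
    | succ k ihk =>
      intro i τ s hk hi hR h1 h2
      obtain ⟨-, -, h3, h4⟩ := hI i τ hi
      by_cases hlt : e.eval n τ < f.eval n τ
      · obtain ⟨t1, s1, e1, c1, τ1, hR1, hi1⟩ := ih _ _ _ hR (h3 hlt).2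
        obtain ⟨he, hf, -, -⟩ := hI (i + 1) τ1 hi1
        obtain ⟨t2, s2, e2, c2, hR2, g1, g2⟩ := two' e f τ1 s1
          (fun s => Rel n w τ1 s ∧ s.reg 2 = e.eval n τ1 ∧ s.reg 4 = f.eval n τ1) hR1 he hf
          (fun s a b c => ⟨a, b, c⟩)
        obtain ⟨t3, s3, e3, c3, h5⟩ := ihk (i + 1) τ1 s2 (by omega) hi1 hR2 g1 g2
        refine ⟨_, _, .whileStep (by rw [h1, h2]; exact hlt) (.seq e1 e2) e3, ?_, h5⟩
        have : (k + 1) * (1 + (C.cost ρ + (e.cost + f.cost)))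
          = k * (1 + (C.cost ρ + (e.cost + f.cost))) + (1 + (C.cost ρ + (e.cost + f.cost))) := by
          ring
        omega
      · exact ⟨_, _, .whileDone (by rw [h1, h2]; exact hlt), by omega, τ, hR, h4 hlt⟩

/-! ### Frames and loop rules -/

/-- Variables a command may change. -/
def Cmd.modV : Cmd → List ℕ
  | asg x _ => [x]
  | seq C D => C.modV ++ D.modV
  | ite _ _ C D => C.modV ++ D.modV
  | loop _ _ _ C => C.modV
  | _ => []

/-- Arrays a command may change. -/
def Cmd.modA : Cmd → List ℕ
  | put j _ _ => [j]
  | seq C D => C.modA ++ D.modA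
  | ite _ _ C D => C.modA ++ D.modA
  | loop _ _ _ C => C.modA
  | _ => []

/-- Matrices a command may change. -/
def Cmd.modM : Cmd → List ℕ
  | putm k _ _ _ => [k]
  | seq C D => C.modM ++ D.modM
  | ite _ _ C D => C.modM ++ D.modM
  | loop _ _ _ C => C.modM
  | _ => []

/-- `τ` agrees with `σ` except on the listed variables, arrays and matrices. -/
structure Fr (V A M : List ℕ) (σ τ : St) : Prop where
  v : ∀ x, x ∉ V → τ.v x = σ.v x
  a : ∀ j, j ∉ A → τ.a j = σ.a j
  m : ∀ k, k ∉ M → τ.m k = σ.m k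

theorem Fr.rfl' {V A M : List ℕ} {σ : St} : Fr V A M σ σ :=
  ⟨fun _ _ => rfl, fun _ _ => rfl, fun _ _ => rfl⟩

theorem Fr.trans {V A M : List ℕ} {σ τ υ : St} (h : Fr V A M σ τ) (h' : Fr V A M τ υ) :
    Fr V A M σ υ :=
  ⟨fun x hx => (h'.v x hx).trans (h.v x hx), fun x hx => (h'.a x hx).trans (h.a x hx),
    fun x hx => (h'.m x hx).trans (h.m x hx)⟩

theorem Fr.mono {V A M V' A' M' : List ℕ} {σ τ : St} (h : Fr V A M σ τ) (hV : V ⊆ V')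
    (hA : A ⊆ A') (hM : M ⊆ M') : Fr V' A' M' σ τ :=
  ⟨fun x hx => h.v x fun h' => hx (hV h'), fun x hx => h.a x fun h' => hx (hA h'),
    fun x hx => h.m x fun h' => hx (hM h')⟩

section

variable {n B : ℕ} {ρ : ℕ → ℕ}

theorem Cmd.wp_mono (C : Cmd) : ∀ {Q Q' : St → Prop} {σ : St}, C.wp n B ρ Q σ →
    (∀ τ, Q τ → Q' τ) → C.wp n B ρ Q' σ := by
  induction C with
  | skip => exact fun h hQ => hQ _ h
  | asg x e => exact fun h hQ => ⟨h.1, hQ _ h.2⟩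
  | put j e f => exact fun h hQ => ⟨h.1, h.2.1, h.2.2.1, h.2.2.2.1, hQ _ h.2.2.2.2⟩
  | putm k e f g =>
    exact fun h hQ => ⟨h.1, h.2.1, h.2.2.1, h.2.2.2.1, h.2.2.2.2.1, h.2.2.2.2.2.1,
      hQ _ h.2.2.2.2.2.2⟩
  | seq C D ihC ihD => exact fun h hQ => ihC h fun τ h' => ihD h' hQ
  | ite e f C D ihC ihD =>
    exact fun h hQ => ⟨h.1, h.2.1, fun l => ihC (h.2.2.1 l) hQ, fun l => ihD (h.2.2.2 l) hQ⟩
  | loop b e f C ih =>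
    rintro Q Q' σ ⟨Inv, h0, hI⟩ hQ
    exact ⟨Inv, h0, fun i τ h => ⟨(hI i τ h).1, (hI i τ h).2.1, (hI i τ h).2.2.1,
      fun l => hQ _ ((hI i τ h).2.2.2 l)⟩⟩

/-- Frame rule: the postcondition may be strengthened by the statement that everything which the
command does not mention is unchanged. -/
theorem Cmd.wp_fr (C : Cmd) : ∀ {Q : St → Prop} {σ : St}, C.wp n B ρ Q σ →
    C.wp n B ρ (fun τ => Fr C.modV C.modA C.modM σ τ ∧ Q τ) σ := by
  induction C with
  | skip => exact fun h => ⟨Fr.rfl', h⟩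
  | asg x e =>
    refine fun h => ⟨h.1, ⟨fun y hy => ?_, fun _ _ => rfl, fun _ _ => rfl⟩, h.2⟩
    have : y ≠ x := by simpa [modV] using hy
    simp [this]
  | put j e f =>
    refine fun h => ⟨h.1, h.2.1, h.2.2.1, h.2.2.2.1, ⟨fun _ _ => rfl, fun y hy => ?_,
      fun _ _ => rfl⟩, h.2.2.2.2⟩
    have : y ≠ j := by simpa [modA] using hy
    simp [this]
  | putm k e f g =>
    refine fun h => ⟨h.1, h.2.1, h.2.2.1, h.2.2.2.1, h.2.2.2.2.1, h.2.2.2.2.2.1,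
      ⟨fun _ _ => rfl, fun _ _ => rfl, fun y hy => ?_⟩, h.2.2.2.2.2.2⟩
    have : y ≠ k := by simpa [modM] using hy
    funext r i
    simp [this]
  | seq C D ihC ihD =>
    refine fun h => C.wp_mono (ihC h) fun τ h' => D.wp_mono (ihD h'.2) fun υ h'' => ⟨?_, h''.2⟩
    exact (h'.1.mono (by simp [modV]) (by simp [modA]) (by simp [modM])).trans
      (h''.1.mono (by simp [modV]) (by simp [modA]) (by simp [modM]))
  | ite e f C D ihC ihD =>
    refine fun h => ⟨h.1, h.2.1, fun l => C.wp_mono (ihC (h.2.2.1 l)) fun υ h'' => ⟨?_, h''.2⟩,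
      fun l => D.wp_mono (ihD (h.2.2.2 l)) fun υ h'' => ⟨?_, h''.2⟩⟩
    · exact h''.1.mono (by simp [modV]) (by simp [modA]) (by simp [modM])
    · exact h''.1.mono (by simp [modV]) (by simp [modA]) (by simp [modM])
  | loop b e f C ih =>
    rintro Q σ ⟨Inv, h0, hI⟩
    refine ⟨fun i τ => Inv i τ ∧ Fr C.modV C.modA C.modM σ τ, ⟨h0, Fr.rfl'⟩, ?_⟩
    rintro i τ ⟨h1, h2⟩
    obtain ⟨a, b, c, d⟩ := hI i τ h1
    refine ⟨a, b, fun l => ⟨(c l).1, C.wp_mono (ih (c l).2) fun υ h => ⟨h.2, ?_⟩⟩,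
      fun l => ⟨h2, d l⟩⟩
    exact h2.trans h.1

/-- To establish `Q` after `C`, find a postcondition that implies `Q` on all stores that agree
with the initial one on everything which `C` does not touch. -/
theorem Cmd.wp_of {C : Cmd} {P Q : St → Prop} {σ : St} (h : C.wp n B ρ P σ)
    (hQ : ∀ τ, Fr C.modV C.modA C.modM σ τ → P τ → Q τ) : C.wp n B ρ Q σ :=
  C.wp_mono (C.wp_fr h) fun τ h' => hQ τ h'.1 h'.2

theorem wp_seq {C D : Cmd} {P Q : St → Prop} {σ : St} (h : C.wp n B ρ P σ)
    (hQ : ∀ τ, Fr C.modV C.modA C.modM σ τ → P τ → D.wp n B ρ Q τ) :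
    (Cmd.seq C D).wp n B ρ Q σ :=
  show C.wp n B ρ (D.wp n B ρ Q) σ from Cmd.wp_of h hQ

/-- The standing assumptions on the number of vertices, the words and the table of iteration
bounds: `ρ 0` bounds loops over the vertices, `ρ 3` loops of length `2 n`. -/
structure Env (n B : ℕ) (ρ : ℕ → ℕ) : Prop where
  four : 4 ≤ n
  pow : n ^ 12 ≤ B
  b0 : n ≤ ρ 0
  b3 : n + n ≤ ρ 3

theorem Env.pow_lt (h : Env n B ρ) {k : ℕ} (hk : k < 12) : n ^ k < B :=
  lt_of_lt_of_le (Nat.pow_lt_pow_right (by have := h.four; omega) hk) h.pow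

theorem Env.lt (h : Env n B ρ) : 16 * n < B := by
  refine lt_of_le_of_lt ?_ (h.pow_lt (k := 3) (by norm_num))
  have h4 := h.four
  calc 16 * n = 4 * 4 * n := by ring
    _ ≤ n * n * n := by gcongr
    _ = n ^ 3 := by ring

open Ex Cmd

/-- `for x = 0, …, e - 1 do C`, for an expression `e` that `C` does not change. -/
def Cmd.forTo (b x : ℕ) (e : Ex) (C : Cmd) : Cmd :=
  seq (asg x (lit 0)) (loop b (var x) e (seq C (asg x (.add (var x) (lit 1)))))

/-- `for x = 0, …, n - 1 do C` -/
def Cmd.forn (x : ℕ) (C : Cmd) : Cmd := forTo 0 x len C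

/-- Loop rule with an invariant `Inv i` for the stores before the pass with counter `i`; frame
conditions are supplied automatically. -/
theorem wp_forTo {b x : ℕ} {e : Ex} {C : Cmd} {Q : St → Prop} {σ : St} (m : ℕ)
    (hb : m ≤ ρ b) (hB : m < B) (hx : x ∉ C.modV)
    (he : ∀ τ, Fr (forTo b x e C).modV (forTo b x e C).modA (forTo b x e C).modM σ τ →
      e.ok n B τ ∧ e.eval n τ = m)
    (Inv : ℕ → St → Prop) (h0 : Inv 0 (σ.setv x 0))
    (hs : ∀ i < m, ∀ τ, τ.v x = i →
      Fr (forTo b x e C).modV (forTo b x e C).modA (forTo b x e C).modM σ τ → Inv i τ →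
      C.wp n B ρ (fun τ' => Inv (i + 1) (τ'.setv x (i + 1))) τ)
    (hQ : ∀ τ, Fr (forTo b x e C).modV (forTo b x e C).modA (forTo b x e C).modM σ τ →
      τ.v x = m → Inv m τ → Q τ) : (forTo b x e C).wp n B ρ Q σ := by
  set F := Fr (forTo b x e C).modV (forTo b x e C).modA (forTo b x e C).modM with hF
  have hxF : ∀ σ y, F σ (σ.setv x y) := fun σ y =>
    ⟨fun z hz => by
      have : z ≠ x := by rintro rfl; exact hz (by simp [forTo, modV])
      simp [this], fun _ _ => rfl, fun _ _ => rfl⟩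
  refine ⟨by simp [Ex.ok], fun i τ => i ≤ m ∧ τ.v x = i ∧ F σ τ ∧ Inv i τ,
    ⟨by omega, by simp [Ex.eval], hxF σ 0, h0⟩, ?_⟩
  rintro i τ ⟨hi, hxi, hFr, hI⟩
  obtain ⟨ho, hm⟩ := he τ hFr
  refine ⟨trivial, ho, fun hlt => ?_, fun hlt => ?_⟩
  · simp only [Ex.eval, hm, hxi] at hlt
    refine ⟨by omega, C.wp_mono (C.wp_fr (hs i hlt τ hxi hFr hI)) ?_⟩
    rintro υ ⟨hυ, hI'⟩
    have hυx : υ.v x = i := by rw [hυ.v x hx, hxi]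
    refine ⟨⟨trivial, by simp [Ex.ok], by simp only [Ex.eval, hυx]; omega⟩, ?_⟩
    simp only [Ex.eval, hυx]
    refine ⟨by omega, by simp, hFr.trans (Fr.trans ?_ (hxF υ _)), hI'⟩
    exact hυ.mono (by simp [forTo, modV]) (by simp [forTo, modA]) (by simp [forTo, modM])
  · simp only [Ex.eval, hm, hxi] at hlt
    obtain rfl : i = m := by omega
    exact hQ τ hFr hxi hI

theorem wp_forn {x : ℕ} {C : Cmd} {Q : St → Prop} {σ : St} (hE : Env n B ρ) (hx : x ∉ C.modV)
    (Inv : ℕ → St → Prop) (h0 : Inv 0 (σ.setv x 0))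
    (hs : ∀ i < n, ∀ τ, τ.v x = i →
      Fr (forn x C).modV (forn x C).modA (forn x C).modM σ τ → Inv i τ →
      C.wp n B ρ (fun τ' => Inv (i + 1) (τ'.setv x (i + 1))) τ)
    (hQ : ∀ τ, Fr (forn x C).modV (forn x C).modA (forn x C).modM σ τ →
      τ.v x = n → Inv n τ → Q τ) : (forn x C).wp n B ρ Q σ :=
  wp_forTo n hE.b0 (by have := hE.lt; omega) hx (fun _ _ => ⟨trivial, rfl⟩) Inv h0 hs hQ

/-- `a_j[x] := e` for all `x`. -/
def Cmd.map (x j : ℕ) (e : Ex) : Cmd := forn x (put j (var x) e)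

/-- The expression may refer to the entry of the array that is being overwritten, as this entry
still has its old value. -/
theorem wp_map {x j : ℕ} {e : Ex} {Q : St → Prop} {σ : St} (hE : Env n B ρ) (hj : j < 32)
    (val : ℕ → ℕ)
    (he : ∀ i < n, ∀ τ, Fr [x] [j] [] σ τ → τ.v x = i → τ.a j i = σ.a j i →
      e.ok n B τ ∧ e.eval n τ = val i)
    (hQ : ∀ τ, Fr [x] [j] [] σ τ → (∀ i < n, τ.a j i = val i) → Q τ) :
    (Cmd.map x j e).wp n B ρ Q σ := by
  have hmono : ∀ {τ}, Fr (Cmd.map x j e).modV (Cmd.map x j e).modA (Cmd.map x j e).modM σ τ →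
      Fr [x] [j] [] σ τ := fun h => h.mono (by simp [Cmd.map, forn, forTo, modV])
        (by simp [Cmd.map, forn, forTo, modA]) (by simp [Cmd.map, forn, forTo, modM])
  refine wp_forn hE (by simp [modV])
    (fun i τ => (∀ k < i, τ.a j k = val k) ∧ ∀ k, i ≤ k → τ.a j k = σ.a j k) ?_ ?_ ?_
  · exact ⟨fun k hk => by omega, fun k hk => rfl⟩
  · rintro i hi τ hxi hF ⟨h1, h2⟩
    obtain ⟨ho, hv⟩ := he i hi τ (hmono hF) hxi (h2 i le_rfl)
    refine ⟨hj, trivial, ho, by simp only [Ex.eval, hxi]; exact hi, ?_, ?_⟩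
    · intro k hk
      simp only [Ex.eval, hxi, hv, St.setv_a, St.seta_a, if_true, Function.update_apply]
      split
      · next h => rw [h]
      · exact h1 k (by omega)
    · intro k hk
      have : k ≠ i := by omega
      simp only [Ex.eval, hxi, hv, St.setv_a, St.seta_a, if_true, Function.update_apply, this,
        if_false]
      exact h2 k (by omega)
  · rintro τ hF - ⟨h1, -⟩
    exact hQ τ (hmono hF) h1

/-- `y := ∑ x, e` -/
def Cmd.sum (x y : ℕ) (e : Ex) : Cmd :=
  seq (asg y (lit 0)) (forn x (asg y (.add (var y) e)))

theorem wp_sum {x y : ℕ} {e : Ex} {Q : St → Prop} {σ : St} (hE : Env n B ρ) (hxy : x ≠ y)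
    (val : ℕ → ℕ)
    (he : ∀ i < n, ∀ τ, Fr [x, y] [] [] σ τ → τ.v x = i → e.ok n B τ ∧ e.eval n τ = val i)
    (hB : ∑ i ∈ Finset.range n, val i < B)
    (hQ : ∀ τ, Fr [x, y] [] [] σ τ → τ.v y = ∑ i ∈ Finset.range n, val i → Q τ) :
    (Cmd.sum x y e).wp n B ρ Q σ := by
  have hmono : ∀ {τ}, Fr (Cmd.sum x y e).modV (Cmd.sum x y e).modA (Cmd.sum x y e).modM σ τ →
      Fr [x, y] [] [] σ τ := fun h => h.mono (by simp [Cmd.sum, forn, forTo, modV])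
        (by simp [Cmd.sum, forn, forTo, modA]) (by simp [Cmd.sum, forn, forTo, modM])
  refine Cmd.wp_of (P := fun τ => τ.v y = ∑ i ∈ Finset.range n, val i) ?_
    fun τ hF hp => hQ τ (hmono hF) hp
  refine ⟨by simp [Ex.ok], ?_⟩
  refine wp_forn hE (by simpa [modV] using hxy)
    (fun i τ => τ.v y = ∑ k ∈ Finset.range i, val k) ?_ ?_ ?_
  · simp [hxy.symm, Ex.eval]
  · rintro i hi τ hxi hF h1
    have hF' : Fr [x, y] [] [] σ τ := by
      refine Fr.trans (τ := σ.setv y 0) ⟨fun z hz => ?_, fun _ _ => rfl, fun _ _ => rfl⟩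
        (hF.mono (by simp [forn, forTo, modV]) (by simp [forn, forTo, modA])
          (by simp [forn, forTo, modM]))
      have : z ≠ y := by rintro rfl; simp at hz
      simp [this]
    obtain ⟨ho, hv⟩ := he i hi τ hF' hxi
    have hle : ∑ k ∈ Finset.range (i + 1), val k ≤ ∑ k ∈ Finset.range n, val k :=
      Finset.sum_le_sum_of_subset (Finset.range_mono hi)
    rw [Finset.sum_range_succ] at hle
    refine ⟨⟨trivial, ho, ?_⟩, ?_⟩
    · simp only [Ex.eval, h1, hv]; omega
    · simp [Ex.eval, h1, hv, hxy.symm, Finset.sum_range_succ]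
  · rintro τ - - h; exact h

end

open Finset

/-! ### The weight function of the greedy algorithm -/

/-- Fixed-point version, in units of `1 / N`, of the sequence `f 0 = 1`,
`(d² + 1) f d = 1 + (d² - d) f (d - 1)`. In a triangle-free graph the sum of the values `f (deg v)`
is a lower bound for the independence number. -/
def shF (N : ℕ) : ℕ → ℕ
  | 0 => N
  | d + 1 => (N + (d + 1) * d * shF N d) / ((d + 1) * (d + 1) + 1)

/-- Backward differences of `shF`, with the value `0` at `0`. -/
def shG (N d : ℕ) : ℕ := shF N (d - 1) - shF N d

theorem shF_succ_le (N d : ℕ) :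
    shF N (d + 1) * ((d + 1) * (d + 1) + 1) ≤ N + (d + 1) * d * shF N d := by
  rw [shF]; exact Nat.div_mul_le_self _ _

theorem lt_shF_succ (N d : ℕ) :
    N + (d + 1) * d * shF N d < (shF N (d + 1) + 1) * ((d + 1) * (d + 1) + 1) := by
  rw [shF, mul_comm (_ / _ + 1)]; exact Nat.lt_mul_div_succ _ (by positivity)

/-- The lower bound `1 / (d + 2)` for the real sequence survives the rounding as long as `(d + 2)²
≤ N`. -/
theorem le_mul_shF {N : ℕ} : ∀ {d : ℕ}, (d + 2) ^ 2 ≤ N → N ≤ (d + 2) * shF N d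
  | 0, _ => by simp [shF]; omega
  | d + 1, h => by
    have ih : N ≤ (d + 2) * shF N d := le_mul_shF ((Nat.pow_le_pow_left (by omega) 2).trans h)
    have h1 := lt_shF_succ N d
    set q := shF N (d + 1)
    have h2 : N < (q + 1) * (d + 2) := by
      have : N * ((d + 1) * (d + 1) + 1) < (q + 1) * (d + 2) * ((d + 1) * (d + 1) + 1) := by
        have e1 : (d + 1) * d * N ≤ (d + 1) * d * ((d + 2) * shF N d) := Nat.mul_le_mul_left _ ih
        nlinarith
      exact lt_of_mul_lt_mul_right this (Nat.zero_le _)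
    have h3 : d + 1 ≤ q := by
      by_contra hq
      have : (q + 1) * (d + 2) ≤ (d + 1) * (d + 2) := Nat.mul_le_mul_right _ (by omega)
      nlinarith
    nlinarith

theorem shF_succ_le_self {N d : ℕ} (h : (d + 2) ^ 2 ≤ N) : shF N (d + 1) ≤ shF N d := by
  have h1 := le_mul_shF h
  have h2 := shF_succ_le N d
  have : shF N (d + 1) * ((d + 1) * (d + 1) + 1) ≤ shF N d * ((d + 1) * (d + 1) + 1) := by
    nlinarith
  exact le_of_mul_le_mul_right this (by positivity)

theorem shG_cast {N d : ℕ} (h : (d + 2) ^ 2 ≤ N) :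
    (shG N (d + 1) : ℤ) = shF N d - shF N (d + 1) := by
  rw [shG, Nat.add_sub_cancel, Nat.cast_sub (shF_succ_le_self h)]

/-- The differential inequality behind the averaging step of the greedy algorithm. -/
theorem shF_balance {N d : ℕ} (h : (d + 2) ^ 2 ≤ N) :
    (1 + d : ℤ) * shF N d ≤ N + ((d : ℤ) ^ 2 - d) * shG N d := by
  cases d with
  | zero => simp [shF]
  | succ d =>
    rw [shG_cast ((Nat.pow_le_pow_left (by omega) 2).trans h)]
    have h2 := shF_succ_le N d
    zify at h2
    push_cast
    nlinarith

/-- A lower bound for `shF`, with a surplus of fourth order in `d`, which amounts to the convexity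
of the sequence at `d`: the recursion expresses both neighbouring values by `shF N d`. For large
`N` the surplus is negligible, and it absorbs the rounding errors. -/
theorem shF_convex_aux {N : ℕ} : ∀ {d : ℕ}, 2 ≤ d → 16 * (d + 2) ^ 4 ≤ N →
    (3 * d + 2 : ℤ) * N + (d + 1) ^ 2 * (d ^ 2 - d) ≤ (2 * d ^ 2 + 6 * d + 2) * shF N d := by
  intro d hd
  induction d, hd using Nat.le_induction with
  | base =>
    intro h
    have h1 := lt_shF_succ N 0
    have h2 := lt_shF_succ N 1
    norm_num at h1 h2 ⊢
    omega
  | succ d hd ih =>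
    intro h
    have h0 : 16 * (d + 2) ^ 4 ≤ N := le_trans (by gcongr; omega) h
    have ih := ih h0
    have h1 := lt_shF_succ N d
    zify at h1 h hd
    push_cast
    set q : ℤ := ((shF N (d + 1) : ℕ) : ℤ)
    set f : ℤ := ((shF N d : ℕ) : ℤ)
    set D : ℤ := (d : ℤ)
    set M : ℤ := (N : ℤ)
    set s : ℤ := D ^ 2 + 2 * D + 2
    set p : ℤ := 2 * D ^ 2 + 6 * D + 2
    set p' : ℤ := 2 * D ^ 2 + 10 * D + 10
    have hs : 0 < s := by positivity
    have hp : 0 < p := by positivity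
    have hp' : 0 < p' := by positivity
    have e1 : M + (D ^ 2 + D) * f ≤ (q + 1) * s := by
      simp only [s]; nlinarith
    have e2 : (3 * D + 2) * M ≤ p * f := by
      have : 0 ≤ (D + 1) ^ 2 * (D ^ 2 - D) := by
        have : 0 ≤ D ^ 2 - D := by nlinarith
        positivity
      linarith
    have e3 : ((3 * D + 5) * p + 4 * D * (D + 1)) * M * s ≤ p' * p * (q + 1) * s := by
      have a1 : (D ^ 2 + D) * ((3 * D + 2) * M) ≤ (D ^ 2 + D) * (p * f) :=
        mul_le_mul_of_nonneg_left e2 (by positivity)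
      have a2 : p' * (p * M + (D ^ 2 + D) * (p * f)) ≤ p' * (p * ((q + 1) * s)) := by
        apply mul_le_mul_of_nonneg_left _ hp'.le
        nlinarith
      have a3 : p' * (p * M + (D ^ 2 + D) * ((3 * D + 2) * M))
          ≤ p' * (p * M + (D ^ 2 + D) * (p * f)) :=
        mul_le_mul_of_nonneg_left (by linarith) hp'.le
      have a4 : p' * (p * M + (D ^ 2 + D) * ((3 * D + 2) * M))
          = ((3 * D + 5) * p + 4 * D * (D + 1)) * M * s := by
        simp only [p', p, s]; ring
      nlinarith
    have e4 : ((3 * D + 5) * p + 4 * D * (D + 1)) * M ≤ p' * p * (q + 1) :=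
      le_of_mul_le_mul_right e3 hs
    have e5 : p * (p' + (D + 2) ^ 2 * (D ^ 2 + D)) ≤ 4 * D * (D + 1) * M := by
      have b1 : p ≤ 4 * D * (D + 1) := by simp only [p]; nlinarith
      have b2 : p' + (D + 2) ^ 2 * (D ^ 2 + D) ≤ M := by
        refine le_trans ?_ h
        have : 0 ≤ D := by omega
        have c : p' + (D + 2) ^ 2 * (D ^ 2 + D) ≤ 16 * (D + 1 + 2) ^ 4 := by
          simp only [p']
          have : 0 ≤ D ^ 3 := by positivity
          have : 0 ≤ D ^ 4 := by positivity
          have : 0 ≤ D ^ 2 := by positivity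
          nlinarith
        simpa using c
      exact mul_le_mul b1 b2 (by positivity) (by positivity)
    have e6 : p * ((3 * D + 5) * M + (D + 2) ^ 2 * (D ^ 2 + D)) ≤ p * (p' * q) := by
      nlinarith
    have e7 := le_of_mul_le_mul_left e6 hp
    have g1 : (3 * (D + 1) + 2) * M + (D + 1 + 1) ^ 2 * ((D + 1) ^ 2 - (D + 1))
        = (3 * D + 5) * M + (D + 2) ^ 2 * (D ^ 2 + D) := by ring
    have g2 : (2 * (D + 1) ^ 2 + 6 * (D + 1) + 2) * q = p' * q := by simp only [p']; ring
    rw [g1, g2]; exact e7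

/-- Convexity of `shF`. -/
theorem shG_succ_le {N d : ℕ} (hd : 1 ≤ d) (h : 16 * (d + 2) ^ 4 ≤ N) :
    (shG N (d + 1) : ℤ) ≤ shG N d := by
  have hsq : (d + 2) ^ 2 ≤ N := by
    refine le_trans ?_ h
    calc (d + 2) ^ 2 ≤ (d + 2) ^ 4 := Nat.pow_le_pow_right (by omega) (by norm_num)
      _ ≤ 16 * (d + 2) ^ 4 := by omega
  obtain ⟨e, rfl⟩ : ∃ e, d = e + 1 := ⟨d - 1, by omega⟩
  rw [shG_cast hsq, shG_cast ((Nat.pow_le_pow_left (by omega) 2).trans hsq)]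
  rcases Nat.eq_zero_or_pos e with rfl | he
  · have h1 := lt_shF_succ N 0
    have h2 := lt_shF_succ N 1
    have h3 := shF_succ_le N 0
    have h0 : shF N 0 = N := rfl
    norm_num at h1 h2 h3 h ⊢
    omega
  · have h1 := shF_convex_aux (d := e + 1) (by omega) h
    have h2 := lt_shF_succ N (e + 1)
    have h3 := shF_succ_le N e
    zify at h2 h3 he
    push_cast at h1
    set a : ℤ := ((shF N e : ℕ) : ℤ)
    set b : ℤ := ((shF N (e + 1) : ℕ) : ℤ)
    set c : ℤ := ((shF N (e + 1 + 1) : ℕ) : ℤ)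
    set E : ℤ := (e : ℤ)
    set M : ℤ := (N : ℤ)
    have hP : 0 < (E + 1) * E * ((E + 1 + 1) * (E + 1 + 1) + 1) := by positivity
    have k1 : ((E + 1 + 1) * (E + 1 + 1) + 1) * (b * ((E + 1) * (E + 1) + 1) - M)
        ≤ ((E + 1 + 1) * (E + 1 + 1) + 1) * ((E + 1) * E * a) :=
      mul_le_mul_of_nonneg_left (by linarith) (by positivity)
    have k2 : (E + 1) * E * (M + (E + 1 + 1) * (E + 1) * b + 1)
        ≤ (E + 1) * E * ((c + 1) * ((E + 1 + 1) * (E + 1 + 1) + 1)) :=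
      mul_le_mul_of_nonneg_left (by linarith) (by positivity)
    have k3 : (E + 1) * E * ((E + 1 + 1) * (E + 1 + 1) + 1) * (2 * b)
        ≤ (E + 1) * E * ((E + 1 + 1) * (E + 1 + 1) + 1) * (a + c) := by nlinarith
    have := le_of_mul_le_mul_left k3 hP
    linarith

theorem shG_anti {N D : ℕ} (h : 16 * (D + 2) ^ 4 ≤ N) {a b : ℕ} (ha : 1 ≤ a) (hab : a ≤ b)
    (hb : b ≤ D + 1) : (shG N b : ℤ) ≤ shG N a := by
  induction b, hab using Nat.le_induction with
  | base => rfl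
  | succ b hab ih =>
    refine (shG_succ_le (by omega) (le_trans ?_ h)).trans (ih (by omega))
    gcongr; omega

theorem shF_anti {N D : ℕ} (h : (D + 2) ^ 2 ≤ N) {a b : ℕ} (hab : a ≤ b)
    (hb : b ≤ D + 1) : shF N b ≤ shF N a := by
  induction b, hab using Nat.le_induction with
  | base => rfl
  | succ b hab ih =>
    refine (shF_succ_le_self (le_trans ?_ h)).trans (ih (by omega))
    gcongr; omega

/-- By convexity, lowering a degree by `k` raises the weight by at least `k` times the last
difference. -/
theorem shF_sub_ge {N D : ℕ} (h : 16 * (D + 2) ^ 4 ≤ N) {d k : ℕ} (hk : k ≤ d)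
    (hd : d ≤ D + 1) : (shF N d : ℤ) + k * shG N d ≤ shF N (d - k) := by
  have hsq : ∀ e ≤ D, (e + 2) ^ 2 ≤ N := fun e he => by
    refine le_trans ?_ h
    calc (e + 2) ^ 2 ≤ (D + 2) ^ 2 := by gcongr
      _ ≤ (D + 2) ^ 4 := Nat.pow_le_pow_right (by omega) (by norm_num)
      _ ≤ 16 * (D + 2) ^ 4 := by omega
  induction k with
  | zero => simp
  | succ k ih =>
    have ih := ih (by omega)
    obtain ⟨e, he⟩ : ∃ e, d - k = e + 1 := ⟨d - k - 1, by omega⟩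
    have h1 := shG_anti h (a := d - k) (b := d) (by omega) (by omega) hd
    rw [he, shG_cast (hsq e (by omega))] at h1
    rw [he] at ih
    have : d - (k + 1) = e := by omega
    rw [this]; push_cast; nlinarith

/-- Upper bound, used to bound the number of rounds of the greedy algorithm. -/
theorem mul_shF_le (N : ℕ) : ∀ d : ℕ, 1 ≤ d → (d : ℝ) * shF N d ≤ N * (1 + Real.log d) := by
  intro d hd
  induction d, hd using Nat.le_induction with
  | base =>
    have := shF_succ_le N 0
    have : shF N 1 ≤ N := by norm_num at this; omega
    simpa using this
  | succ d hd ih =>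
    have h := shF_succ_le N d
    have h' : ((d : ℝ) + 1) * shF N (d + 1) * (d + 1) ≤ N + (d + 1) * (d * shF N d) := by
      have : ((shF N (d + 1) * ((d + 1) * (d + 1) + 1) : ℕ) : ℝ)
        ≤ ((N + (d + 1) * d * shF N d : ℕ) : ℝ) := by exact_mod_cast h
      push_cast at this
      have h0 : (0 : ℝ) ≤ shF N (d + 1) := by positivity
      nlinarith
    have hd0 : (0 : ℝ) < d := by exact_mod_cast hd
    have hlog : 1 / ((d : ℝ) + 1) ≤ Real.log (d + 1) - Real.log d := by
      rw [← Real.log_div (by positivity) (by positivity)]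
      have := Real.one_sub_inv_le_log_of_pos (x := ((d : ℝ) + 1) / d) (by positivity)
      refine le_trans (le_of_eq ?_) this
      field_simp; ring
    have h2 : ((d : ℝ) + 1) * shF N (d + 1) ≤ N / (d + 1) + d * shF N d := by
      rw [← mul_le_mul_iff_left₀ (show (0 : ℝ) < d + 1 by positivity), add_mul (_ / _),
        div_mul_cancel₀ _ (by positivity)]
      linarith
    have h3 : (N : ℝ) / (d + 1) ≤ N * (Real.log (d + 1) - Real.log d) := by
      rw [div_eq_mul_one_div]; gcongr
    push_cast
    nlinarith

/-- The trapezoidal rule overestimates the integral of the convex function `1 / x`; here this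
follows from `x ≤ sinh x` at `x = log ((d + 1) / d)`. -/
theorem log_succ_sub_log_le {d : ℝ} (hd : 0 < d) :
    Real.log (d + 1) - Real.log d ≤ (1 / d + 1 / (d + 1)) / 2 := by
  rw [← Real.log_div (by positivity) (by positivity)]
  have hy : 1 ≤ (d + 1) / d := by rw [le_div_iff₀ hd]; linarith
  have h0 : 0 ≤ Real.log ((d + 1) / d) := Real.log_nonneg hy
  have := Real.self_le_sinh_iff.2 h0
  rw [Real.sinh_eq, Real.exp_neg, Real.exp_log (by positivity)] at this
  refine this.trans (le_of_eq ?_)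
  field_simp; ring

/-- Lower bound with a surplus of second order, which absorbs the rounding errors. -/
theorem le_mul_shF_log {N : ℕ} : ∀ d : ℕ, 2 ≤ d → 16 * (d + 2) ^ 4 ≤ N →
    (N : ℝ) * (Real.log d - 1 + (Real.log d + 3 / 2) / d) ≤ d * shF N d := by
  intro d hd
  induction d, hd using Nat.le_induction with
  | base =>
    intro h
    have h1 := lt_shF_succ N 0
    have h2 := lt_shF_succ N 1
    norm_num at h1 h2 h
    have h3 : 2 * N ≤ 5 * shF N 2 + 5 := by omega
    have h3' : (2 : ℝ) * N ≤ 5 * shF N 2 + 5 := by exact_mod_cast h3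
    have h4 : (4096 : ℝ) ≤ N := by exact_mod_cast h
    have := Real.log_two_lt_d9
    norm_num
    nlinarith
  | succ d hd ih =>
    intro h
    have ih := ih (le_trans (by gcongr; omega) h)
    have h1 := lt_shF_succ N d
    have h1' : (N : ℝ) + (d + 1) * d * shF N d
        ≤ (shF N (d + 1) + 1) * ((d + 1) * (d + 1) + 1) := by exact_mod_cast h1.le
    have hN : (16 : ℝ) * (d + 1 + 2) ^ 4 ≤ N := by exact_mod_cast h
    have hd0 : (2 : ℝ) ≤ d := by exact_mod_cast hd
    have hN0 : (0 : ℝ) < N := lt_of_lt_of_le (by positivity) hN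
    have hlog := log_succ_sub_log_le (d := d) (by linarith)
    have hl0 : 0 ≤ Real.log d := Real.log_nonneg (by linarith)
    push_cast
    set e : ℝ := (d : ℝ)
    set l := Real.log e
    set l' := Real.log (e + 1)
    set q : ℝ := ((shF N (d + 1) : ℕ) : ℝ)
    set f : ℝ := ((shF N d : ℕ) : ℝ)
    set M : ℝ := (N : ℝ)
    have he : 0 < e := by linarith
    have hl' : l' ≤ l + (1 / e + 1 / (e + 1)) / 2 := by linarith
    -- the recursion, solved for the next value
    have k1 : M + (e + 1) * (M * (l - 1 + (l + 3 / 2) / e)) - ((e + 1) ^ 2 + 1)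
        ≤ q * ((e + 1) ^ 2 + 1) := by nlinarith
    have k2 : M * (l' - 1 + (l' + 3 / 2) / (e + 1)) * ((e + 1) ^ 2 + 1)
        ≤ (M + (e + 1) * (M * (l - 1 + (l + 3 / 2) / e)) - ((e + 1) ^ 2 + 1)) * (e + 1) := by
      have m1 : (l' - 1 + (l' + 3 / 2) / (e + 1)) * ((e + 1) ^ 2 + 1)
          ≤ (l + (1 / e + 1 / (e + 1)) / 2 - 1 + (l + (1 / e + 1 / (e + 1)) / 2 + 3 / 2) / (e + 1))
            * ((e + 1) ^ 2 + 1) := by gcongr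
      have m2 : (l + (1 / e + 1 / (e + 1)) / 2 - 1
            + (l + (1 / e + 1 / (e + 1)) / 2 + 3 / 2) / (e + 1)) * ((e + 1) ^ 2 + 1)
          + 1 / (16 * (e + 1 + 2) ^ 4) * (((e + 1) ^ 2 + 1) * (e + 1))
          ≤ (1 + (e + 1) * (l - 1 + (l + 3 / 2) / e)) * (e + 1) := by
        have t1 : 1 / (16 * (e + 1 + 2) ^ 4) * (((e + 1) ^ 2 + 1) * (e + 1)) ≤ 1 / (16 * e) := by
          rw [div_mul_eq_mul_div, one_mul, div_le_div_iff₀ (by positivity) (by positivity)]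
          have : (((e + 1) ^ 2 + 1) * (e + 1)) * e ≤ (e + 1 + 2) ^ 4 := by
            have : 0 ≤ e ^ 3 := by positivity
            have : 0 ≤ e ^ 2 := by positivity
            nlinarith
          nlinarith
        have t2 : (l + (1 / e + 1 / (e + 1)) / 2 - 1
            + (l + (1 / e + 1 / (e + 1)) / 2 + 3 / 2) / (e + 1)) * ((e + 1) ^ 2 + 1)
            + 1 / (16 * e) ≤ (1 + (e + 1) * (l - 1 + (l + 3 / 2) / e)) * (e + 1) := by
          have : 0 ≤ l / (e * (e + 1)) := by positivity
          have id : (1 + (e + 1) * (l - 1 + (l + 3 / 2) / e)) * (e + 1)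
            - ((l + (1 / e + 1 / (e + 1)) / 2 - 1
            + (l + (1 / e + 1 / (e + 1)) / 2 + 3 / 2) / (e + 1)) * ((e + 1) ^ 2 + 1)
            + 1 / (16 * e)) - l / (e * (e + 1))
            = (16 * e ^ 3 - e ^ 2 - 34 * e - 9) / (16 * e * (e + 1) ^ 2) := by
            field_simp; ring
          have : 0 ≤ (16 * e ^ 3 - e ^ 2 - 34 * e - 9) / (16 * e * (e + 1) ^ 2) := by
            apply div_nonneg _ (by positivity)
            nlinarith [mul_nonneg (mul_nonneg he.le he.le) (sub_nonneg.2 hd0)]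
          linarith
        linarith
      have m3 : (((e + 1) ^ 2 + 1) * (e + 1))
          ≤ M * (1 / (16 * (e + 1 + 2) ^ 4) * (((e + 1) ^ 2 + 1) * (e + 1))) := by
        rw [← mul_assoc, mul_one_div]
        exact le_mul_of_one_le_left (by positivity) ((one_le_div (by positivity)).2 hN)
      have m4 := mul_le_mul_of_nonneg_left (m1.trans (le_sub_iff_add_le.2 m2)) hN0.le
      nlinarith
    have k3 : M * (l' - 1 + (l' + 3 / 2) / (e + 1)) * ((e + 1) ^ 2 + 1)
        ≤ (e + 1) * q * ((e + 1) ^ 2 + 1) := by nlinarith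
    exact le_of_mul_le_mul_right k3 (by positivity)

/-! ### The greedy step for independent sets in triangle-free graphs -/

/-- `α` is the `0`-`1` adjacency matrix of a triangle-free graph on `{0, …, n - 1}`. -/
structure TriFree (n : ℕ) (α : ℕ → ℕ → ℕ) : Prop where
  le_one : ∀ u v, α u v ≤ 1
  symm : ∀ u v, α u v = α v u
  irrefl : ∀ u, α u u = 0
  tri : ∀ u v w, α u v = 1 → α v w = 1 → α u w = 0

/-- Degree of `v` into the set `W`. -/
def dg (α : ℕ → ℕ → ℕ) (W : Finset ℕ) (v : ℕ) : ℕ := ∑ w ∈ W, α v w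

section

variable {n : ℕ} {α : ℕ → ℕ → ℕ}

theorem dg_lt (h : TriFree n α) {W : Finset ℕ} (hW : W ⊆ range n) {v : ℕ} (hv : v ∈ W) :
    dg α W v < n := by
  have : dg α W v ≤ ∑ w ∈ W.erase v, 1 := by
    rw [dg, ← Finset.add_sum_erase _ _ hv, h.irrefl, zero_add]
    exact Finset.sum_le_sum fun w _ => h.le_one _ _
  rw [Finset.sum_const, smul_eq_mul, mul_one, Finset.card_erase_of_mem hv] at this
  have h1 := Finset.card_le_card hW
  have h2 := Finset.card_pos.2 ⟨v, hv⟩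
  rw [card_range] at h1
  omega

/-- By averaging, some vertex of a nonempty set `W` passes the test of the greedy algorithm. The
sum of the test over all vertices is controlled by Chebyshev's sum inequality: the differences
`shG` decrease in the degree. -/
theorem exists_greedy_vertex (h : TriFree n α) {N : ℕ} (hN : 16 * (n + 2) ^ 4 ≤ N)
    {W : Finset ℕ} (hW : W ⊆ range n) (hne : W.Nonempty) :
    ∃ v ∈ W, shF N (dg α W v) + dg α W v * shG N (dg α W v)
      + ∑ w ∈ W, α v w * shF N (dg α W w)
      ≤ N + ∑ w ∈ W, α v w * ∑ u ∈ W, α w u * shG N (dg α W u) := by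
  have hsq : ∀ e ≤ n, (e + 2) ^ 2 ≤ N := fun e he => by
    refine le_trans ?_ hN
    calc (e + 2) ^ 2 ≤ (n + 2) ^ 2 := by gcongr
      _ ≤ (n + 2) ^ 4 := Nat.pow_le_pow_right (by omega) (by norm_num)
      _ ≤ 16 * (n + 2) ^ 4 := by omega
  by_contra! hcon
  have hlt := Finset.sum_lt_sum_of_nonempty hne hcon
  rw [← not_le] at hlt
  apply hlt
  set d := dg α W with hd
  set f := fun v => (shF N (d v) : ℤ)
  set g := fun v => (shG N (d v) : ℤ)
  have hdd : ∀ v, ∑ w ∈ W, (α v w : ℤ) = d v := fun v => by simp [hd, dg]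
  have hdd' : ∀ v, ∑ w ∈ W, (α w v : ℤ) = d v := fun v => by
    rw [← hdd]; exact Finset.sum_congr rfl fun w _ => by rw [h.symm]
  zify
  change ∑ v ∈ W, (f v + d v * g v + ∑ w ∈ W, (α v w : ℤ) * f w)
    ≤ ∑ v ∈ W, ((N : ℤ) + ∑ w ∈ W, (α v w : ℤ) * ∑ u ∈ W, (α w u : ℤ) * g u)
  have e1 : ∑ v ∈ W, ∑ w ∈ W, (α v w : ℤ) * f w = ∑ v ∈ W, d v * f v := by
    rw [Finset.sum_comm]
    exact Finset.sum_congr rfl fun w _ => by rw [← Finset.sum_mul, hdd']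
  have e2 : ∑ v ∈ W, ∑ w ∈ W, (α v w : ℤ) * ∑ u ∈ W, (α w u : ℤ) * g u
      = ∑ w ∈ W, ∑ u ∈ W, (α w u : ℤ) * (d w * g u) := by
    rw [Finset.sum_comm]
    refine Finset.sum_congr rfl fun w _ => ?_
    rw [← Finset.sum_mul, hdd', Finset.mul_sum]
    exact Finset.sum_congr rfl fun u _ => by ring
  have e3 : ∑ w ∈ W, ∑ u ∈ W, (α w u : ℤ) * (d u * g u) = ∑ u ∈ W, (d u : ℤ) ^ 2 * g u := by
    rw [Finset.sum_comm]
    refine Finset.sum_congr rfl fun u _ => ?_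
    rw [← Finset.sum_mul, hdd']; ring
  have e4 : ∑ w ∈ W, ∑ u ∈ W, (α w u : ℤ) * (d u * g u)
      ≤ ∑ w ∈ W, ∑ u ∈ W, (α w u : ℤ) * (d w * g u) := by
    rw [← sub_nonneg, ← Finset.sum_sub_distrib]
    simp_rw [← Finset.sum_sub_distrib]
    set S := ∑ w ∈ W, ∑ u ∈ W, ((α w u : ℤ) * (d w * g u) - (α w u : ℤ) * (d u * g u)) with hS
    have hS' : S = ∑ w ∈ W, ∑ u ∈ W, ((α w u : ℤ) * (d u * g w) - (α w u : ℤ) * (d w * g w)) := by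
      rw [hS, Finset.sum_comm]
      refine Finset.sum_congr rfl fun w _ => Finset.sum_congr rfl fun u _ => ?_
      rw [h.symm u w]
    have : 0 ≤ S + S := by
      nth_rewrite 1 [hS]
      rw [hS', ← Finset.sum_add_distrib]
      simp_rw [← Finset.sum_add_distrib]
      refine Finset.sum_nonneg fun w hw => Finset.sum_nonneg fun u hu => ?_
      rcases Nat.le_one_iff_eq_zero_or_eq_one.1 (h.le_one w u) with h0 | h1
      · simp [h0]
      · have hdw : 1 ≤ d w := by
          rw [hd, dg, ← h1]; exact Finset.single_le_sum (f := α w) (fun _ _ => Nat.zero_le _) hu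
        have hdu : 1 ≤ d u := by
          rw [hd, dg, ← h1, h.symm]
          exact Finset.single_le_sum (f := α u) (fun _ _ => Nat.zero_le _) hw
        have b1 : d w < n := dg_lt h hW hw
        have b2 : d u < n := dg_lt h hW hu
        rw [h1]
        have : 0 ≤ ((d w : ℤ) - d u) * (g u - g w) := by
          rcases le_total (d w) (d u) with hle | hle
          · have := shG_anti hN hdw hle (by omega)
            have h2 : (d w : ℤ) ≤ d u := by exact_mod_cast hle
            exact mul_nonneg_of_nonpos_of_nonpos (by linarith) (by simp only [g]; linarith)
          · have := shG_anti hN hdu hle (by omega)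
            have h2 : (d u : ℤ) ≤ d w := by exact_mod_cast hle
            exact mul_nonneg (by linarith) (by simp only [g]; linarith)
        push_cast
        nlinarith
    linarith
  rw [Finset.sum_add_distrib, Finset.sum_add_distrib, Finset.sum_add_distrib, e1, e2]
  refine le_trans ?_ (add_le_add le_rfl e4)
  rw [e3, ← Finset.sum_add_distrib, ← Finset.sum_add_distrib, ← Finset.sum_add_distrib]
  refine Finset.sum_le_sum fun v hv => ?_
  have := shF_balance (hsq (d v) (dg_lt h hW hv).le)
  simp only [f, g]
  nlinarith

/-- Deleting the closed neighbourhood of a vertex that passes the test lowers the total weight by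
at most the weight `N` of one chosen vertex. -/
theorem weight_greedy_step (h : TriFree n α) {N : ℕ} (hN : 16 * (n + 2) ^ 4 ≤ N)
    {W : Finset ℕ} (hW : W ⊆ range n) {v : ℕ} (hv : v ∈ W)
    (hgood : shF N (dg α W v) + dg α W v * shG N (dg α W v)
      + ∑ w ∈ W, α v w * shF N (dg α W w)
      ≤ N + ∑ w ∈ W, α v w * ∑ u ∈ W, α w u * shG N (dg α W u)) :
    ∑ u ∈ W, shF N (dg α W u) ≤
      N + ∑ u ∈ W.filter (fun u => u ≠ v ∧ α v u = 0),
        shF N (dg α (W.filter fun u => u ≠ v ∧ α v u = 0) u) := by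
  set W' := W.filter (fun u => u ≠ v ∧ α v u = 0) with hW'
  set d := dg α W with hd
  set k := fun u => ∑ w ∈ W, α v w * α w u with hk
  have hvW' : ∀ u ∈ W', u ∈ W ∧ u ≠ v ∧ α v u = 0 := fun u hu => by simpa [hW'] using hu
  -- the loss of degree of a surviving vertex is the number of its paths of length two to `v`
  have hdeg : ∀ u ∈ W', dg α W' u + k u = d u := by
    intro u hu
    obtain ⟨h1, h2, h3⟩ := hvW' u hu
    have : k u = ∑ w ∈ W.filter (fun w => ¬ (w ≠ v ∧ α v w = 0)), α u w := by
      simp only [hk]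
      rw [← Finset.sum_filter_add_sum_filter_not W (fun w => w ≠ v ∧ α v w = 0)]
      rw [Finset.sum_eq_zero, zero_add]
      · refine Finset.sum_congr rfl fun w hw => ?_
        rw [h.symm w u]
        by_cases hwv : w = v
        · subst hwv; rw [h.symm u, h3, mul_zero]
        · have : α v w ≠ 0 := fun h0 => (Finset.mem_filter.1 hw).2 ⟨hwv, h0⟩
          have := h.le_one v w
          rw [show α v w = 1 by omega, one_mul]
      · intro w hw
        rw [(Finset.mem_filter.1 hw).2.2, zero_mul]
    rw [this, dg, hd, dg, hW', Finset.sum_filter_add_sum_filter_not]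
  have hsum : ∑ w ∈ W, α v w * ∑ u ∈ W, α w u * shG N (d u) = ∑ u ∈ W, k u * shG N (d u) := by
    simp_rw [hk, Finset.mul_sum, Finset.sum_mul]
    rw [Finset.sum_comm]
    exact Finset.sum_congr rfl fun u _ => Finset.sum_congr rfl fun w _ => by ring
  have hkv : k v = d v := by
    refine Finset.sum_congr rfl fun w _ => ?_
    rw [h.symm w v]
    rcases Nat.le_one_iff_eq_zero_or_eq_one.1 (h.le_one v w) with h0 | h0 <;> simp [h0]
  have hk0 : ∀ u, α v u = 1 → k u = 0 := by
    intro u hu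
    refine Finset.sum_eq_zero fun w _ => ?_
    rcases Nat.le_one_iff_eq_zero_or_eq_one.1 (h.le_one v w) with h0 | h0
    · simp [h0]
    · rw [h.symm w u, h.tri u v w (by rw [h.symm]; exact hu) h0, mul_zero]
  -- split sums over `W` into `W'`, `v`, and the neighbours of `v`
  have hsplit : ∀ φ : ℕ → ℕ, ∑ u ∈ W, φ u = ∑ u ∈ W', φ u + φ v + ∑ u ∈ W, α v u * φ u := by
    intro φ
    have e1 : ∑ u ∈ W', φ u = ∑ u ∈ W, if u ≠ v ∧ α v u = 0 then φ u else 0 := by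
      rw [hW', Finset.sum_filter]
    have e2 : φ v = ∑ u ∈ W, if u = v then φ u else 0 := by
      rw [Finset.sum_ite_eq' W v φ, if_pos hv]
    rw [e1, e2, ← Finset.sum_add_distrib, ← Finset.sum_add_distrib]
    refine Finset.sum_congr rfl fun u _ => ?_
    by_cases huv : u = v
    · subst huv; simp [h.irrefl]
    · rcases Nat.le_one_iff_eq_zero_or_eq_one.1 (h.le_one v u) with h0 | h0 <;> simp [h0, huv]
  rw [hsum, hsplit (fun u => k u * shG N (d u)), hkv] at hgood
  have hz : ∑ u ∈ W, α v u * (k u * shG N (d u)) = 0 := by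
    refine Finset.sum_eq_zero fun u _ => ?_
    rcases Nat.le_one_iff_eq_zero_or_eq_one.1 (h.le_one v u) with h0 | h0
    · simp [h0]
    · simp [hk0 u h0]
  have hpt : ∑ u ∈ W', (shF N (d u) + k u * shG N (d u)) ≤ ∑ u ∈ W', shF N (dg α W' u) := by
    refine Finset.sum_le_sum fun u hu => ?_
    have h1 := hdeg u hu
    have h2 : d u < n := dg_lt h hW (hvW' u hu).1
    have h3 := shF_sub_ge hN (d := d u) (k := k u) (by omega) (by omega)
    rw [show dg α W' u = d u - k u by omega]
    exact_mod_cast h3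
  rw [Finset.sum_add_distrib] at hpt
  have hs := hsplit (fun u => shF N (d u))
  omega

end

/-! ### Sets whose complement is an identifying code -/

section Codes

variable {V : Type*} {G : SimpleGraph V}

/-- `u` and `v` have the same open neighbourhood. -/
def Twin (G : SimpleGraph V) (u v : V) : Prop := ∀ z, G.Adj u z ↔ G.Adj v z

/-- `ab` is an edge all of whose neighbouring vertices lie in `X`; such an edge is not separated
by the complement of `X`. -/
def Bad (G : SimpleGraph V) (X : Finset V) (a b : V) : Prop :=
  G.Adj a b ∧ (∀ z, G.Adj a z → z ≠ b → z ∈ X) ∧ ∀ z, G.Adj b z → z ≠ a → z ∈ X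

/-- What is used of a connected triangle-free graph of maximum degree at least `3`: there is no
triangle, and no nonempty set of vertices which is closed under adjacency induces a subgraph of
maximum degree at most `2`. -/
structure Host (G : SimpleGraph V) : Prop where
  tri : ∀ a b c, G.Adj a b → G.Adj b c → ¬ G.Adj a c
  small : ∀ S : Set V, S.Nonempty →
    ¬ ∀ v ∈ S, ∃ p ∈ S, ∃ q ∈ S, ∀ z, G.Adj v z → z = p ∨ z = q

theorem Host.exists_adj (h : Host G) (v : V) : ∃ u, G.Adj v u := by
  by_contra! hc
  exact h.small {v} ⟨v, rfl⟩ fun u hu => ⟨v, rfl, v, rfl, fun z hz => by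
    obtain rfl : u = v := hu
    exact absurd hz (hc z)⟩

/-- No edge forms a component. -/
theorem Host.edge (h : Host G) (a b : V) :
    ∃ z, (G.Adj a z ∧ z ≠ b) ∨ (G.Adj b z ∧ z ≠ a) := by
  by_contra! hc
  refine h.small {a, b} ⟨a, by simp⟩ fun u hu => ?_
  rcases hu with rfl | rfl
  · exact ⟨b, by simp, b, by simp, fun z hz => .inl (of_not_not fun hn => hn ((hc z).1 hz))⟩
  · exact ⟨a, by simp, a, by simp, fun z hz => .inl (of_not_not fun hn => hn ((hc z).2 hz))⟩

theorem Bad.symm {X : Finset V} {a b : V} (h : Bad G X a b) : Bad G X b a :=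
  ⟨h.1.symm, h.2.2, h.2.1⟩

theorem Bad.mono {X Y : Finset V} {a b : V} (h : Bad G X a b) (hXY : X ⊆ Y) : Bad G Y a b :=
  ⟨h.1, fun z h1 h2 => hXY (h.2.1 z h1 h2), fun z h1 h2 => hXY (h.2.2 z h1 h2)⟩

/-- `X` is independent and contains no two twins. -/
structure Fit (G : SimpleGraph V) (X : Finset V) : Prop where
  indep : ∀ a ∈ X, ∀ b ∈ X, ¬ G.Adj a b
  twin : ∀ a ∈ X, ∀ b ∈ X, Twin G a b → a = b

theorem Fit.mono {X Y : Finset V} (h : Fit G Y) (hXY : X ⊆ Y) : Fit G X :=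
  ⟨fun a ha b hb => h.indep a (hXY ha) b (hXY hb),
    fun a ha b hb => h.twin a (hXY ha) b (hXY hb)⟩

/-- The common part of the two constructions of codes. A vertex outside `X` separates itself from
every vertex that is not adjacent to it, and the ends of an edge that is not bad are separated by a
further neighbour of one of them, as there is no triangle. -/
theorem isIdentifyingCode_of_not_bad (h : Host G) {X : Finset V}
    (hdom : ∀ u ∈ X, ∃ z, z ∉ X ∧ G.Adj u z)
    (hsep : ∀ u ∈ X, ∀ v ∈ X, u ≠ v → ∃ z, z ∉ X ∧ ¬ (G.Adj u z ↔ G.Adj v z))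
    (hbad : ∀ a b, ¬ Bad G X a b) : IsIdentifyingCode G {v | v ∉ X} := by
  refine ⟨fun u => ?_, fun u v huv => ?_⟩
  · by_cases hu : u ∈ X
    · obtain ⟨z, hzX, hz⟩ := hdom u hu
      exact ⟨z, hzX, .inr hz.symm⟩
    · exact ⟨u, hu, .inl rfl⟩
  · by_cases hadj : G.Adj u v
    · have := hbad u v
      simp only [Bad, hadj, true_and, not_and_or, not_forall] at this
      rcases this with ⟨z, h1, h2, h3⟩ | ⟨z, h1, h2, h3⟩
      · refine ⟨z, h3, .inl ⟨.inr h1.symm, ?_⟩⟩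
        rintro (h4 | h4)
        · exact h2 h4.symm
        · exact h.tri u z v h1 h4 hadj
      · refine ⟨z, h3, .inr ⟨.inr h1.symm, ?_⟩⟩
        rintro (h4 | h4)
        · exact h2 h4.symm
        · exact h.tri v z u h1 h4 hadj.symm
    · by_cases hu : u ∈ X
      · by_cases hv : v ∈ X
        · obtain ⟨y, hyX, hy⟩ := hsep u hu v hv huv
          by_cases h1 : G.Adj u y
          · have h2 : ¬ G.Adj v y := fun h2 => hy ⟨fun _ => h2, fun _ => h1⟩
            refine ⟨y, hyX, .inl ⟨.inr h1.symm, ?_⟩⟩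
            rintro (rfl | h4)
            · exact hadj h1
            · exact h2 h4.symm
          · have h2 : G.Adj v y := by
              by_contra h2; exact hy ⟨fun h => absurd h h1, fun h => absurd h h2⟩
            refine ⟨y, hyX, .inr ⟨.inr h2.symm, ?_⟩⟩
            rintro (rfl | h4)
            · exact hadj h2.symm
            · exact h1 h4.symm
        · refine ⟨v, hv, .inr ⟨.inl rfl, ?_⟩⟩
          rintro (h1 | h1)
          · exact huv h1
          · exact hadj h1.symm
      · refine ⟨u, hu, .inl ⟨.inl rfl, ?_⟩⟩
        rintro (h1 | h1)
        · exact huv h1.symm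
        · exact hadj h1

/-- Neighbours of the vertices of an independent set lie outside the set, so that bad edges are the
only obstruction for a fit set. -/
theorem Fit.isIdentifyingCode (h : Host G) {X : Finset V} (hX : Fit G X)
    (hbad : ∀ a b, ¬ Bad G X a b) : IsIdentifyingCode G {v | v ∉ X} := by
  refine isIdentifyingCode_of_not_bad h (fun u hu => ?_) (fun u hu v hv huv => ?_) hbad
  · obtain ⟨z, hz⟩ := h.exists_adj u
    exact ⟨z, fun hzX => hX.indep u hu z hzX hz, hz⟩
  · have : ¬ Twin G u v := fun ht => huv (hX.twin u hu v hv ht)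
    simp only [Twin, not_forall] at this
    obtain ⟨z, hz⟩ := this
    refine ⟨z, fun hzX => hz ⟨fun h1 => ?_, fun h1 => ?_⟩, hz⟩
    · exact absurd h1 (hX.indep u hu z hzX)
    · exact absurd h1 (hX.indep v hv z hzX)

/-- Omitting one vertex of each nontrivial class of twins leaves an identifying code. -/
theorem isIdentifyingCode_of_twins (h : Host G) {X : Finset V}
    (hX : ∀ a ∈ X, ∃ b, b ∉ X ∧ Twin G a b) (hinj : ∀ a ∈ X, ∀ b ∈ X, Twin G a b → a = b) :
    IsIdentifyingCode G {v | v ∉ X} := by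
  -- all neighbours of `u` on a bad edge `uv` lie in the class of `v`, and `X` contains at most one
  -- vertex of that class
  have part : ∀ u v, Bad G X u v →
      ∃ p, Twin G p v ∧ ∀ z, G.Adj u z → z = v ∨ z = p := by
    intro u v hb
    have tw : ∀ z, G.Adj u z → z ≠ v → Twin G z v := by
      intro z hz hzv
      obtain ⟨z', h1, h2⟩ := hX z (hb.2.1 z hz hzv)
      have h3 : G.Adj u z' := ((h2 u).1 hz.symm).symm
      have : z' = v := of_not_not fun hn => h1 (hb.2.1 z' h3 hn)
      exact this ▸ h2
    by_cases hex : ∃ z, G.Adj u z ∧ z ≠ v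
    · obtain ⟨p, hp, hpv⟩ := hex
      refine ⟨p, tw p hp hpv, fun z hz => ?_⟩
      by_cases hzv : z = v
      · exact .inl hzv
      · refine .inr (hinj z (hb.2.1 z hz hzv) p (hb.2.1 p hp hpv) fun y => ?_)
        rw [tw z hz hzv y, tw p hp hpv y]
    · push Not at hex
      exact ⟨v, fun _ => Iff.rfl, fun z hz => .inl (hex z hz)⟩
  -- the edge and the twins of its ends would form a path or a cycle of length four
  have hbad : ∀ u v, ¬ Bad G X u v := by
    intro u v hb
    obtain ⟨p, hp, hp'⟩ := part u v hb
    obtain ⟨q, hq, hq'⟩ := part v u hb.symm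
    refine h.small {u, v, p, q} ⟨u, by simp⟩ fun w hw => ?_
    rcases hw with rfl | rfl | rfl | rfl
    · exact ⟨v, by simp, p, by simp, hp'⟩
    · exact ⟨u, by simp, q, by simp, hq'⟩
    · exact ⟨u, by simp, q, by simp, fun z hz => hq' z ((hp z).1 hz)⟩
    · exact ⟨v, by simp, p, by simp, fun z hz => hp' z ((hq z).1 hz)⟩
  refine isIdentifyingCode_of_not_bad h (fun u _ => ?_) (fun u hu v hv huv => ?_) hbad
  · obtain ⟨z, hz⟩ := h.exists_adj u
    by_cases hzX : z ∈ X
    · obtain ⟨z', h1, h2⟩ := hX z hzX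
      exact ⟨z', h1, ((h2 u).1 hz.symm).symm⟩
    · exact ⟨z, hzX, hz⟩
  · have : ¬ Twin G u v := fun ht => huv (hinj u hu v hv ht)
    simp only [Twin, not_forall] at this
    obtain ⟨z, hz⟩ := this
    -- a vertex of `X` that distinguishes `u` and `v` has a twin outside `X`
    by_cases hzX : z ∈ X
    · obtain ⟨z', h1, h2⟩ := hX z hzX
      refine ⟨z', h1, fun hi => hz ?_⟩
      rw [G.adj_comm u z, G.adj_comm v z, h2 u, h2 v, G.adj_comm z' u, G.adj_comm z' v]
      exact hi
    · exact ⟨z, hzX, hz⟩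

/-! ### Removing bad edges by exchange -/

/-- `v` is a leaf attached to `u`. -/
def LeafAt (G : SimpleGraph V) (v u : V) : Prop := ∀ z, G.Adj v z ↔ z = u

/-- An independent set of vertices without twins in the whole graph that contains all leaves
without twins. -/
structure Base (G : SimpleGraph V) (I : Finset V) : Prop where
  indep : ∀ a ∈ I, ∀ b ∈ I, ¬ G.Adj a b
  triv : ∀ a ∈ I, ∀ b, Twin G a b → a = b
  leaf : ∀ v u, LeafAt G v u → v ∉ I → ∃ v', v' ≠ v ∧ Twin G v v'

theorem Base.fit {I : Finset V} (h : Base G I) : Fit G I :=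
  ⟨h.indep, fun a ha b _ hab => h.triv a ha b hab⟩

/-- A leaf outside `I` is accompanied by a second one at the same support. This keeps leaves from
causing trouble at bad edges. -/
theorem Base.other_leaf {I : Finset V} (h : Base G I) {v u : V} (hv : LeafAt G v u) (hI : v ∉ I) :
    ∃ v', v' ≠ v ∧ LeafAt G v' u ∧ v' ∉ I := by
  obtain ⟨v', h1, h2⟩ := h.leaf v u hv hI
  exact ⟨v', h1, fun z => by rw [← h2 z, hv z], fun h3 => h1 (h.triv v' h3 v fun z => (h2 z).symm)⟩

/-- A processing order `wt` of the vertices in which leaves come first, and a rule `K` that breaks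
ties between the ends of an edge: on an edge with two ends of degree `2`, it compares the positions
in that order of the two further neighbours. -/
structure KeyFn (G : SimpleGraph V) (wt : V → ℕ) (K : V → V → ℕ) : Prop where
  inj : ∀ a b, wt a = wt b → a = b
  leaf : ∀ x q u, LeafAt G q u → wt x ≤ wt q → ∃ u', LeafAt G x u'
  ne : ∀ a b, a ≠ b → K a b ≠ K b a
  le : ∀ v q x x', (∀ z, G.Adj v z ↔ z = q ∨ z = x') → (∀ z, G.Adj q z ↔ z = v ∨ z = x) →
    x' ≠ q → x ≠ v → K v q < K q v → wt x' ≤ wt x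

/-- The bad edge `ab` is to be repaired by deleting a neighbour of `b` and recording `b`. -/
def Dir (I : Finset V) (K : V → V → ℕ) (a b : V) : Prop := b ∉ I ∧ (a ∈ I ∨ K a b < K b a)

/-- The bad edges of `X` form a matching, each edge has an admissible direction, and the end that
is recorded is not a leaf. -/
structure StageHyp (G : SimpleGraph V) (I : Finset V) (K : V → V → ℕ) (X : Finset V) : Prop where
  p1 : ∀ a b, Bad G X a b → Dir I K a b ∨ Dir I K b a
  p2 : ∀ a b, Bad G X a b → Dir I K a b → ∃ w, G.Adj b w ∧ w ≠ a
  p3 : ∀ a b b', Bad G X a b → Dir I K a b → Bad G X a b' → Dir I K a b' → b = b'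
  p4 : ∀ a a' b, Bad G X a b → Dir I K a b → Bad G X a' b → Dir I K a' b → a = a'

variable {I : Finset V} {wt : V → ℕ} {K : V → V → ℕ}

/-- State of the repair of the bad edges of `X` when the vertices `a` with `wt a < t` have been
processed: `Y` is what remains of `X`, and `Z` is the set of recorded vertices. By `ord`, the
deletion belonging to a vertex recorded earlier does not affect the bad edge of a vertex recorded
later. -/
structure StageInv (G : SimpleGraph V) (I : Finset V) (wt : V → ℕ) (K : V → V → ℕ) (X : Finset V)
    (t : ℕ) (Y Z : Finset V) : Prop where
  sub : Y ⊆ X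
  card : Y.card + Z.card = X.card
  done : ∀ a b, wt a < t → Dir I K a b → ¬ Bad G Y a b
  trace : ∀ z ∈ Z, ∃ a, wt a < t ∧ Bad G X a z ∧ Dir I K a z ∧ ∃ w, G.Adj z w ∧ w ≠ a ∧ w ∉ Y
  ord : ∀ z ∈ Z, ∀ z' ∈ Z, ∀ a a', Bad G X a z → Dir I K a z → Bad G X a' z' → Dir I K a' z' →
    wt a < wt a' →
    ∃ w, G.Adj z w ∧ w ≠ a ∧ ¬ (G.Adj z' w ∧ w ≠ a') ∧ ¬ (G.Adj a' w ∧ w ≠ z')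

theorem StageInv.init (X : Finset V) : StageInv G I wt K X 0 X ∅ where
  sub := Finset.Subset.refl _
  card := by simp
  done := fun _ _ h => by omega
  trace := by simp
  ord := by simp

/-- Nothing is done at a vertex where no bad edge with the right direction is left. -/
theorem StageInv.skip {X Y Z : Finset V} {t : ℕ} (h : StageInv G I wt K X t Y Z)
    (hno : ∀ a b, wt a = t → Dir I K a b → ¬ Bad G Y a b) : StageInv G I wt K X (t + 1) Y Z where
  sub := h.sub
  card := h.card
  done a b hab := by
    rcases Nat.lt_succ_iff_lt_or_eq.1 hab with h1 | h1
    · exact h.done a b h1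
    · exact hno a b h1
  trace z hz := by
    obtain ⟨a, h1, h2⟩ := h.trace z hz
    exact ⟨a, by omega, h2⟩
  ord := h.ord

/-- The bad edge `ab` is repaired by deleting the neighbour `w` of `b` and recording `b`. Earlier
deletions do not touch the neighbours of the edge, since it is still bad; this gives `ord`. -/
theorem StageInv.step [DecidableEq V] {X Y Z : Finset V} (hK : KeyFn G wt K)
    (hX : StageHyp G I K X) {a b w : V} (h : StageInv G I wt K X (wt a) Y Z)
    (hbad : Bad G Y a b) (hdir : Dir I K a b) (hw : G.Adj b w) (hwa : w ≠ a) :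
    StageInv G I wt K X (wt a + 1) (Y.erase w) (insert b Z) := by
  have hbX := hbad.mono h.sub
  have hwY : w ∈ Y := hbad.2.2 w hw hwa
  have hbZ : b ∉ Z := fun hb => by
    obtain ⟨a', h1, h2, h3, -⟩ := h.trace b hb
    rw [hX.p4 a' a b h2 h3 hbX hdir] at h1
    omega
  have hmem : ∀ z ∈ Z, ∀ a', Bad G X a' z → Dir I K a' z →
      wt a' < wt a ∧ ∃ w, G.Adj z w ∧ w ≠ a' ∧ w ∉ Y := by
    intro z hz a' h1 h2
    obtain ⟨a'', h3, h4, h5, h6⟩ := h.trace z hz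
    obtain rfl := hX.p4 _ _ z h1 h2 h4 h5
    exact ⟨h3, h6⟩
  refine ⟨(Finset.erase_subset _ _).trans h.sub, ?_, ?_, ?_, ?_⟩
  · rw [Finset.card_insert_of_notMem hbZ, Finset.card_erase_of_mem hwY]
    have := h.card
    have := Finset.card_pos.2 ⟨w, hwY⟩
    omega
  · intro a' b' hlt hd hb
    have hbY := hb.mono (Finset.erase_subset w Y)
    rcases Nat.lt_succ_iff_lt_or_eq.1 hlt with h1 | h1
    · exact h.done a' b' h1 hd hbY
    · obtain rfl := hK.inj _ _ h1
      obtain rfl := hX.p3 _ _ _ (hbY.mono h.sub) hd hbX hdir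
      exact absurd (hb.2.2 w hw hwa) (Finset.notMem_erase _ _)
  · intro z hz
    rcases Finset.mem_insert.1 hz with rfl | hz
    · exact ⟨a, by omega, hbX, hdir, w, hw, hwa, Finset.notMem_erase _ _⟩
    · obtain ⟨a', h1, h2, h3, w', h4, h5, h6⟩ := h.trace z hz
      exact ⟨a', by omega, h2, h3, w', h4, h5, fun hm => h6 (Finset.mem_of_mem_erase hm)⟩
  · intro z hz z' hz' a1 a2 h1 h2 h3 h4 hlt
    rcases Finset.mem_insert.1 hz with rfl | hzZ
    · obtain rfl := hX.p4 _ _ z h1 h2 hbX hdir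
      rcases Finset.mem_insert.1 hz' with rfl | hzZ'
      · rw [hX.p4 _ _ z' h3 h4 hbX hdir] at hlt; omega
      · have := (hmem z' hzZ' a2 h3 h4).1; omega
    · rcases Finset.mem_insert.1 hz' with rfl | hzZ'
      · obtain rfl := hX.p4 _ _ z' h3 h4 hbX hdir
        obtain ⟨-, w', h5, h6, h7⟩ := hmem z hzZ a1 h1 h2
        exact ⟨w', h5, h6, fun h8 => h7 (hbad.2.2 w' h8.1 h8.2),
          fun h8 => h7 (hbad.2.1 w' h8.1 h8.2)⟩
      · exact h.ord z hzZ z' hzZ' a1 a2 h1 h2 h3 h4 hlt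

/-- Deletions create no bad edges, so that none is left when all vertices have been processed. -/
theorem StageInv.not_bad {X Y Z : Finset V} {t : ℕ} (h : StageInv G I wt K X t Y Z)
    (hX : StageHyp G I K X) (ht : ∀ a, wt a < t) (a b : V) : ¬ Bad G Y a b := fun hb => by
  rcases hX.p1 a b (hb.mono h.sub) with h1 | h1
  · exact h.done a b (ht a) h1 hb
  · exact h.done b a (ht b) h1 hb.symm

/-- The repair applies to `I` itself. Two bad edges with a common end would have their other ends
in `I`, where these would be leaves at the same support and hence twins. -/
theorem Base.stageHyp (hI : Base G I) (hK : KeyFn G wt K) :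
    StageHyp G I K I where
  p1 a b hb := by
    by_cases hbI : b ∈ I
    · exact .inr ⟨fun ha => hI.indep a ha b hbI hb.1, .inl hbI⟩
    · by_cases haI : a ∈ I
      · exact .inl ⟨hbI, .inl haI⟩
      · rcases Nat.lt_or_gt_of_ne (hK.ne a b hb.1.ne) with h1 | h1
        · exact .inl ⟨hbI, .inr h1⟩
        · exact .inr ⟨haI, .inr h1⟩
  p2 a b hb hd := by
    by_contra! hc
    obtain ⟨b', h1, h2, h3⟩ := hI.other_leaf (v := b) (u := a)
      (fun z => ⟨hc z, fun h => h ▸ hb.1.symm⟩) hd.1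
    exact h3 (hb.2.1 b' ((h2 a).2 rfl).symm h1)
  p3 a b b' h1 h2 h3 h4 := of_not_not fun hn => h4.1 (h1.2.1 b' h3.1 (Ne.symm hn))
  p4 a a' b h1 _ h3 _ := by
    by_contra hn
    have ha' : a' ∈ I := h1.2.2 a' h3.1.symm (Ne.symm hn)
    have ha : a ∈ I := h3.2.2 a h1.1.symm hn
    refine hn (hI.triv a ha a' fun z => ?_)
    have e1 : ∀ z, G.Adj a z → z = b := fun z hz =>
      of_not_not fun hzb => hI.indep a ha z (h1.2.1 z hz hzb) hz
    have e2 : ∀ z, G.Adj a' z → z = b := fun z hz =>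
      of_not_not fun hzb => hI.indep a' ha' z (h3.2.1 z hz hzb) hz
    exact ⟨fun h => (e1 z h) ▸ h3.1, fun h => (e2 z h) ▸ h1.1⟩

/-- The vertices of `E` are recorded ends of bad edges of `I`. -/
def Ends (G : SimpleGraph V) (I : Finset V) (K : V → V → ℕ) (E : Finset V) : Prop :=
  ∀ e ∈ E, ∃ a, Bad G I a e ∧ Dir I K a e

namespace Ends

variable {E : Finset V}

theorem notMem (hE : Ends G I K E) {e : V} (he : e ∈ E) : e ∉ I := by
  obtain ⟨a, -, h⟩ := hE e he
  exact h.1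

/-- The only neighbour of `e` outside `I` is the other end of its bad edge. -/
theorem bad_of_adj (hE : Ends G I K E) {e z : V} (he : e ∈ E) (hz : G.Adj e z) (hzI : z ∉ I) :
    Bad G I z e ∧ K z e < K e z := by
  obtain ⟨a, h1, h2⟩ := hE e he
  obtain rfl : z = a := of_not_not fun hn => hzI (h1.2.2 z hz hn)
  exact ⟨h1, h2.2.resolve_left hzI⟩

theorem not_leafAt (hI : Base G I) (hK : KeyFn G wt K) (hE : Ends G I K E)
    {e u : V} (he : e ∈ E) : ¬ LeafAt G e u := fun hl => by
  obtain ⟨a, h1, h2⟩ := hE e he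
  obtain ⟨w, h3, h4⟩ := (hI.stageHyp hK).p2 a e h1 h2
  exact h4 (((hl w).1 h3).trans ((hl a).1 h1.1.symm).symm)

/-- Two adjacent recorded ends would be the two ends of one bad edge, recorded in both directions.
-/
theorem fit (hE : Ends G I K E) : Fit G E where
  indep a ha b hb hab := by
    have h1 := (hE.bad_of_adj ha hab (hE.notMem hb)).2
    have h2 := (hE.bad_of_adj hb hab.symm (hE.notMem ha)).2
    omega
  twin a ha b hb hab := by
    by_contra hn
    obtain ⟨c, h1, h2⟩ := hE a ha
    exact hE.notMem hb (h1.2.1 b ((hab c).1 h1.1.symm).symm (Ne.symm hn))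

/-- A bad edge of `E` has exactly one end in `I`. -/
theorem one_mem (h : Host G) (hI : Base G I) (hE : Ends G I K E) {x y : V} (hb : Bad G E x y) :
    (x ∈ I ∧ y ∉ I) ∨ (x ∉ I ∧ y ∈ I) := by
  have key : ∀ x y z, Bad G E x y → y ∉ I → x ∉ I → G.Adj x z → z ≠ y → False := by
    intro x y z hb hy hx hz hzy
    exact hy ((hE.bad_of_adj (hb.2.1 z hz hzy) hz.symm hx).1.2.1 y hb.1 (Ne.symm hzy))
  by_cases hx : x ∈ I
  · exact .inl ⟨hx, fun hy => hI.indep x hx y hy hb.1⟩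
  · by_cases hy : y ∈ I
    · exact .inr ⟨hx, hy⟩
    · exfalso
      obtain ⟨z, ⟨h1, h2⟩ | ⟨h1, h2⟩⟩ := h.edge x y
      · exact key x y z hb hy hx h1 h2
      · exact key y x z hb.symm hx hy h1 h2

/-- Shape of a bad edge of `E`: its end outside `I` has degree `2`, and its second neighbour is a
vertex of `E` whose bad edge it completes. -/
theorem shape (hI : Base G I) (hK : KeyFn G wt K) (hE : Ends G I K E) {x y : V}
    (hb : Bad G E x y) (hx : x ∈ I) :
    ∃ s ∈ E, s ≠ x ∧ (∀ z, G.Adj y z ↔ z = s ∨ z = x) ∧ Bad G I y s ∧ K y s < K s y := by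
  have hy : y ∉ I := fun hy => hI.indep x hx y hy hb.1
  obtain ⟨s, h1, h2⟩ : ∃ s, G.Adj y s ∧ s ≠ x := by
    by_contra! hc
    obtain ⟨y', h1, h2, h3⟩ := hI.other_leaf (v := y) (u := x)
      (fun z => ⟨hc z, fun h => h ▸ hb.1.symm⟩) hy
    exact hE.not_leafAt hI hK (hb.2.1 y' ((h2 x).2 rfl).symm h1) h2
  have hs := hb.2.2 s h1 h2
  obtain ⟨h3, h4⟩ := hE.bad_of_adj hs h1.symm hy
  refine ⟨s, hs, h2, fun z => ⟨fun hz => ?_, ?_⟩, h3, h4⟩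
  · by_contra! hn
    exact hE.notMem (hb.2.2 z hz hn.2) (h3.2.1 z hz hn.1)
  · rintro (rfl | rfl)
    · exact h1
    · exact hb.1.symm

/-- The repair applies to the set of recorded ends as well. -/
theorem stageHyp (h : Host G) (hI : Base G I) (hK : KeyFn G wt K)
    (hE : Ends G I K E) : StageHyp G I K E := by
  have mem : ∀ a b, Bad G E a b → Dir I K a b → a ∈ I := by
    intro a b hb hd
    rcases hE.one_mem h hI hb with h1 | h1
    · exact h1.1
    · exact absurd h1.2 hd.1
  refine ⟨fun a b hb => ?_, fun a b hb hd => ?_, fun a b b' h1 h2 h3 h4 => ?_,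
    fun a a' b h1 h2 h3 h4 => ?_⟩
  · rcases hE.one_mem h hI hb with h1 | h1
    · exact .inl ⟨h1.2, .inl h1.1⟩
    · exact .inr ⟨h1.1, .inl h1.2⟩
  · obtain ⟨s, -, h1, h2, -⟩ := hE.shape hI hK hb (mem a b hb hd)
    exact ⟨s, (h2 s).2 (.inl rfl), h1⟩
  · by_contra hn
    obtain ⟨s, hs, -, h6, -⟩ := hE.shape hI hK h1 (mem a b h1 h2)
    exact hE.fit.indep b (h3.2.1 b h1.1 hn) s hs ((h6 s).2 (.inl rfl))
  · obtain ⟨s, hs, -, h6, -⟩ := hE.shape hI hK h1 (mem a b h1 h2)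
    rcases (h6 a').1 h3.1.symm with h7 | h7
    · exact absurd (h7 ▸ mem a' b h3 h4) (hE.notMem hs)
    · exact h7.symm

/-- The vertices recorded while repairing `E` form a set without bad edges. A bad edge would join
the bad edges of two recorded vertices into a path along which the processing order increases,
against `StageInv.ord`, or it would lead to a component that is a path. -/
theorem not_bad_record (h : Host G) (hI : Base G I) (hK : KeyFn G wt K) (hE : Ends G I K E)
    {t : ℕ} {Y D : Finset V} (hD : StageInv G I wt K E t Y D) :
    Fit G D ∧ ∀ p q, ¬ Bad G D p q := by
  have hS := hE.stageHyp h hI hK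
  have data : ∀ y ∈ D, ∃ x s, x ∈ I ∧ y ∉ I ∧ y ∉ E ∧ s ∈ E ∧ s ≠ x ∧
      (∀ z, G.Adj y z ↔ z = s ∨ z = x) ∧ Bad G E x y ∧ Bad G I y s ∧ K y s < K s y ∧
      Dir I K x y := by
    intro y hy
    obtain ⟨x, -, h1, h2, -⟩ := hD.trace y hy
    have hx : x ∈ I := by
      rcases hE.one_mem h hI h1 with h3 | h3
      · exact h3.1
      · exact absurd h3.2 h2.1
    obtain ⟨s, h3, h4, h5, h6, h7⟩ := hE.shape hI hK h1 hx
    exact ⟨x, s, hx, h2.1, fun hyE => hE.fit.indep y hyE s h3 ((h5 s).2 (.inl rfl)), h3, h4, h5,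
      h1, h6, h7, h2⟩
  have hDI : ∀ y ∈ D, y ∉ I := fun y hy => by
    obtain ⟨x, s, -, h1, -⟩ := data y hy; exact h1
  have hDE : ∀ y ∈ D, y ∉ E := fun y hy => by
    obtain ⟨x, s, -, -, h1, -⟩ := data y hy; exact h1
  refine ⟨⟨fun a ha b hb hab => ?_, fun a ha b hb hab => ?_⟩, ?_⟩
  · obtain ⟨x, s, h1, -, -, h2, -, h3, -⟩ := data a ha
    rcases (h3 b).1 hab with rfl | rfl
    · exact hDE b hb h2
    · exact hDI b hb h1
  · by_contra hn
    obtain ⟨x, s, -, -, -, -, -, h3, h4, -⟩ := data a ha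
    have h5 : G.Adj x b := ((hab x).1 h4.1.symm).symm
    exact hDE b hb (h4.2.1 b h5 (Ne.symm hn))
  -- a bad edge at the vertex `p ∈ I` next to a recorded vertex `r`
  have case1 : ∀ p q r, Bad G D p q → r ∈ D → G.Adj p r → r ≠ q → p ∈ I → False := by
    intro p q r hb hr hpr hrq hpI
    obtain ⟨x, s, hx, -, -, hs, -, hN, hbE, -, -, hdr⟩ := data r hr
    obtain rfl : p = x := by
      rcases (hN p).1 hpr.symm with h1 | h1
      · exact absurd hpI (h1 ▸ hE.notMem hs)
      · exact h1
    have hqE : q ∈ E := hbE.2.1 q hb.1 (Ne.symm hrq)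
    have hNp : ∀ z, G.Adj p z → z = r ∨ z = q := fun z hz => by
      by_contra! hn
      exact hDE z (hb.2.1 z hz hn.2) (hbE.2.1 z hz hn.1)
    obtain ⟨a, ha, had⟩ := hE q hqE
    have hap : a ≠ p := by
      rintro rfl
      exact hDI r hr (ha.2.1 r hpr hrq)
    have haD : a ∈ D := hb.2.2 a ha.1.symm hap
    have haI := hDI a haD
    obtain ⟨x', s', hx', -, -, hs', hsx', hN', hbE', -, -, hda⟩ := data a haD
    obtain rfl : q = s' := by
      rcases (hN' q).1 ha.1 with h1 | h1
      · exact h1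
      · exact absurd (h1 ▸ hx') (hE.notMem hqE)
    have hNq : ∀ z, G.Adj q z ↔ z = a ∨ z = p := fun z => ⟨fun hz => by
      by_contra! hn
      exact hDI z (hb.2.2 z hz hn.2) (ha.2.2 z hz hn.1), by
      rintro (rfl | rfl)
      · exact ha.1.symm
      · exact hb.1.symm⟩
    have hle := hK.le a q p x' hN' hNq hsx'.symm hap.symm (had.2.resolve_left haI)
    have hne : x' ≠ p := by
      rintro rfl
      exact h.tri a q x' ha.1 hb.1.symm hbE'.1.symm
    have hlt : wt x' < wt p := lt_of_le_of_ne hle fun he => hne (hK.inj _ _ he)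
    obtain ⟨w, h1, h2, -, h3⟩ := hD.ord a haD r hr x' p hbE' hda hbE hdr hlt
    rcases (hN' w).1 h1 with rfl | rfl
    · exact h3 ⟨hb.1, Ne.symm hrq⟩
    · exact h2 rfl
  have case2 : ∀ p q r, Bad G D p q → r ∈ D → G.Adj p r → r ≠ q → False := by
    intro p q r hb hr hpr hrq
    obtain ⟨x, s, hx, -, -, hs, hsx, hN, hbE, hbI, hK', -⟩ := data r hr
    rcases (hN p).1 hpr.symm with rfl | rfl
    · have hqI : q ∈ I := hbI.2.2 q hb.1 (Ne.symm hrq)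
      have hNp : ∀ z, G.Adj p z ↔ z = r ∨ z = q := fun z => ⟨fun hz => by
        by_contra! hn
        exact hDI z (hb.2.1 z hz hn.2) (hbI.2.2 z hz hn.1), by
        rintro (rfl | rfl)
        · exact hpr
        · exact hb.1⟩
      by_cases hex : ∃ w, G.Adj q w ∧ w ≠ p
      · obtain ⟨w, h1, h2⟩ := hex
        exact case1 q p w hb.symm (hb.2.2 w h1 h2) h1 h2 hqI
      · push Not at hex
        have hle := hK.le r p q x hN hNp hsx.symm (Ne.symm hrq) hK'
        have hl : LeafAt G q p := fun z => ⟨hex z, fun hz => hz ▸ hb.1.symm⟩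
        obtain ⟨u', hu'⟩ := hK.leaf x q p hl hle
        obtain rfl := (hu' r).1 hbE.1
        refine h.small {q, p, r, x} ⟨q, by simp⟩ fun v hv => ?_
        rcases hv with rfl | rfl | rfl | rfl
        · exact ⟨p, by simp, p, by simp, fun z hz => .inl (hex z hz)⟩
        · exact ⟨r, by simp, q, by simp, fun z hz => (hNp z).1 hz⟩
        · exact ⟨p, by simp, x, by simp, fun z hz => (hN z).1 hz⟩
        · exact ⟨r, by simp, r, by simp, fun z hz => .inl ((hu' z).1 hz)⟩
    · exact case1 p q r hb hr hpr hrq hx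
  intro p q hb
  obtain ⟨z, ⟨h1, h2⟩ | ⟨h1, h2⟩⟩ := h.edge p q
  · exact case2 p q z hb (hb.2.1 z h1 h2) h1 h2
  · exact case2 q p z hb.symm (hb.2.2 z h1 h2) h1 h2

end Ends

/-- Exchanging, in an independent set of vertices without twins, the neighbours of leaves without
twins for these leaves. -/
theorem Base.of_swap (h : Host G) {I₀ I : Finset V} (hind : ∀ a ∈ I₀, ∀ b ∈ I₀, ¬ G.Adj a b)
    (htriv : ∀ a ∈ I₀, ∀ b, Twin G a b → a = b) (P : V → Prop)
    (hP : ∀ v, P v ↔ (∃ u, LeafAt G v u) ∧ ∀ b, Twin G v b → v = b)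
    (hI : ∀ v, v ∈ I ↔ P v ∨ (v ∈ I₀ ∧ ∀ i, P i → ¬ G.Adj i v)) :
    Base G I ∧ I₀.card ≤ I.card := by
  refine ⟨⟨fun a ha b hb hab => ?_, fun a ha => ?_, fun v u hv hvI => ?_⟩, ?_⟩
  · rcases (hI a).1 ha with ha | ha
    · rcases (hI b).1 hb with hb | hb
      · obtain ⟨⟨u, hu⟩, -⟩ := (hP a).1 ha
        obtain ⟨⟨u', hu'⟩, -⟩ := (hP b).1 hb
        obtain rfl := (hu b).1 hab
        obtain rfl := (hu' a).1 hab.symm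
        obtain ⟨z, ⟨h1, h2⟩ | ⟨h1, h2⟩⟩ := h.edge a b
        · exact h2 ((hu z).1 h1)
        · exact h2 ((hu' z).1 h1)
      · exact hb.2 a ha hab
    · rcases (hI b).1 hb with hb | hb
      · exact ha.2 b hb hab.symm
      · exact hind a ha.1 b hb.1 hab
  · rcases (hI a).1 ha with ha | ha
    · exact ((hP a).1 ha).2
    · exact htriv a ha.1
  · by_contra! hc
    refine hvI ((hI v).2 (.inl ((hP v).2 ⟨⟨u, hv⟩, fun b hb => ?_⟩)))
    exact of_not_not fun hn => hc b (Ne.symm hn) hb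
  · classical
    have hch : ∀ v, ∃ w, (∃ i, P i ∧ G.Adj i v) → P w ∧ G.Adj w v := fun v => by
      by_cases hex : ∃ i, P i ∧ G.Adj i v
      · obtain ⟨i, hi⟩ := hex; exact ⟨i, fun _ => hi⟩
      · exact ⟨v, fun hc => absurd hc hex⟩
    choose f hf using hch
    refine Finset.card_le_card_of_injOn
      (fun v => if ∃ i, P i ∧ G.Adj i v then f v else v) (fun v hv => ?_) ?_
    · by_cases hex : ∃ i, P i ∧ G.Adj i v
      · simp only [hex, if_true]
        exact Finset.mem_coe.2 ((hI _).2 (.inl (hf v hex).1))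
      · simp only [hex, if_false]
        refine Finset.mem_coe.2 ((hI _).2 (.inr ⟨hv, fun i hi hiv => hex ⟨i, hi, hiv⟩⟩))
    · intro v hv v' hv' he
      simp only at he
      by_cases hex : ∃ i, P i ∧ G.Adj i v <;> by_cases hex' : ∃ i, P i ∧ G.Adj i v'
      · simp only [hex, hex', if_true] at he
        obtain ⟨h1, h2⟩ := hf v hex
        obtain ⟨h3, h4⟩ := hf v' hex'
        obtain ⟨⟨u, hu⟩, -⟩ := (hP _).1 h1
        rw [← he] at h4
        rw [(hu v).1 h2, (hu v').1 h4]
      · simp only [hex, hex', if_true, if_false] at he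
        exact absurd (he ▸ (hf v hex).2) (hind v' hv' v hv)
      · simp only [hex, hex', if_true, if_false] at he
        exact absurd (he ▸ (hf v' hex').2) (hind v hv v' hv')
      · simpa only [hex, hex', if_false] using he

end Codes

open Ex Cmd

section

variable {n B : ℕ} {ρ : ℕ → ℕ} {α : ℕ → ℕ → ℕ}

/-! ### Adjacency lists -/

/-- Sum of `g` over the neighbours of `v`. -/
def nsum (n : ℕ) (α : ℕ → ℕ → ℕ) (v : ℕ) (g : ℕ → ℕ) : ℕ := ∑ u ∈ range n, α v u * g u

theorem nsum_le (h : TriFree n α) {v M : ℕ} {g : ℕ → ℕ} (hg : ∀ u < n, g u ≤ M) :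
    nsum n α v g ≤ n * M := by
  refine (Finset.sum_le_card_nsmul _ _ M fun u hu => ?_).trans (by simp)
  calc α v u * g u ≤ 1 * M := Nat.mul_le_mul (h.le_one v u) (hg u (by simpa using hu))
    _ = M := one_mul M

theorem nsum_congr {v : ℕ} {g g' : ℕ → ℕ} (hg : ∀ u < n, g u = g' u) :
    nsum n α v g = nsum n α v g' :=
  Finset.sum_congr rfl fun u hu => by rw [hg u (by simpa using hu)]

/-- Degree of `v`. -/
def deg (n : ℕ) (α : ℕ → ℕ → ℕ) (v : ℕ) : ℕ := ∑ u ∈ range n, α v u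

theorem deg_le (h : TriFree n α) (v : ℕ) : deg n α v ≤ n :=
  (Finset.sum_le_card_nsmul _ _ 1 fun u _ => h.le_one v u).trans (by simp)

/-- The first `c` entries of the list of `v` are the neighbours of `v` below `j`. -/
structure RowOk (n : ℕ) (α : ℕ → ℕ → ℕ) (σ : St) (v c j : ℕ) : Prop where
  len : c = ∑ u ∈ range j, α v u
  lt : ∀ k < c, σ.m 1 v k < n
  sum : ∀ g : ℕ → ℕ, ∑ k ∈ range c, g (σ.m 1 v k) = ∑ u ∈ range j, α v u * g u

theorem RowOk.congr {σ τ : St} {v c j : ℕ} (h : RowOk n α σ v c j)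
    (he : ∀ k, τ.m 1 v k = σ.m 1 v k) : RowOk n α τ v c j :=
  ⟨h.len, fun k hk => by rw [he]; exact h.lt k hk, fun g => by simp_rw [he]; exact h.sum g⟩

/-- Matrix `0` holds the adjacency matrix, matrix `1` the adjacency lists, array `0` the degrees. -/
structure Lists (n : ℕ) (α : ℕ → ℕ → ℕ) (σ : St) : Prop where
  adj : σ.m 0 = α
  row : ∀ v < n, RowOk n α σ v (σ.a 0 v) n

theorem Lists.deg {σ : St} (h : Lists n α σ) {v : ℕ} (hv : v < n) : σ.a 0 v = deg n α v :=
  (h.row v hv).len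

theorem Lists.congr {σ τ : St} (h : Lists n α σ) (hm : τ.m = σ.m) (ha : τ.a 0 = σ.a 0) :
    Lists n α τ := ⟨by rw [hm]; exact h.adj, fun v hv => by
      rw [ha]; exact (h.row v hv).congr fun k => by rw [hm]⟩

theorem Lists.fr {V A : List ℕ} {σ τ : St} (h : Lists n α σ) (hF : Fr V A [] σ τ)
    (h0 : 0 ∉ A) : Lists n α τ :=
  h.congr (funext fun k => hF.m k (by simp)) (hF.a 0 h0)

/-- Compute adjacency lists and degrees. -/
def progLists : Cmd :=
  forn 0 (seq (asg 2 (lit 0)) (seq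
    (forn 1 (ite (lit 0) (mat 0 (var 0) (var 1))
      (seq (putm 1 (var 0) (var 2) (var 1)) (asg 2 (.add (var 2) (lit 1)))) skip))
    (put 0 (var 0) (var 2))))

theorem progLists_spec (hE : Env n B ρ) (hα : TriFree n α) {σ : St} (h0 : σ.m 0 = α) :
    progLists.wp n B ρ (Lists n α) σ := by
  have hB := hE.lt
  refine wp_forn hE (by decide) (fun i τ => ∀ v < i, RowOk n α τ v (τ.a 0 v) n)
    (fun v hv => by omega) ?_ ?_
  · rintro i hi τ hτ hF hI
    refine ⟨by simp [Ex.ok], ?_⟩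
    refine wp_seq (P := fun υ => υ.v 0 = i ∧ (∀ v, v ≠ i → υ.m 1 v = τ.m 1 v) ∧
      RowOk n α υ i (υ.v 2) n) ?_ ?_
    · refine wp_forn hE (by decide) (fun j υ => (∀ v, v ≠ i → υ.m 1 v = τ.m 1 v) ∧
        RowOk n α υ i (υ.v 2) j) ?_ ?_ ?_
      · exact ⟨fun _ _ => rfl, by simp [Ex.eval], by simp [Ex.eval], by simp [Ex.eval]⟩
      · rintro j hj υ hυ hF' ⟨hI1, hI2⟩
        have e0 : υ.v 0 = i := by rw [hF'.v 0 (by decide)]; simpa using hτ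
        have em : υ.m 0 = α := by rw [hF'.m 0 (by decide), ← h0, ← hF.m 0 (by decide)]; rfl
        refine ⟨by simp [Ex.ok], by simp [Ex.ok, Ex.eval, e0, hυ, hi, hj], ?_, ?_⟩
        · intro hlt
          have h1 : α i j = 1 := by
            have := hα.le_one i j
            simp only [Ex.eval, e0, hυ, em] at hlt; omega
          have hc : υ.v 2 ≤ j := by
            rw [hI2.len]
            exact (Finset.sum_le_card_nsmul _ _ 1 fun u _ => hα.le_one i u).trans (by simp)
          refine ⟨by omega, trivial, trivial, trivial, by simpa [Ex.eval, e0] using hi,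
            by simp only [Ex.eval]; omega, ?_⟩
          refine ⟨⟨trivial, by simp [Ex.ok], by simp only [Ex.eval, St.setm_v]; omega⟩, ?_, ?_⟩
          · intro v hv
            funext k
            simp [Ex.eval, e0, hv, hI1 v hv]
          · refine ⟨?_, ?_, fun g => ?_⟩
            · simp [Ex.eval, hI2.len, Finset.sum_range_succ, h1]
            · intro k hk
              simp only [Ex.eval, St.setv_v, St.setm_v, St.setv_m, St.setm_m, e0, hυ,
                if_true] at hk ⊢
              split
              · omega
              · next hne => exact hI2.lt k (by simp at hk hne; omega)
            · have : ((((υ.setm 1 (eval n υ (var 0)) (eval n υ (var 2)) (eval n υ (var 1))).setv 2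
                  (eval n (υ.setm 1 (eval n υ (var 0)) (eval n υ (var 2)) (eval n υ (var 1)))
                    ((var 2).add (lit 1)))).setv 1 (j + 1)).v 2) = υ.v 2 + 1 := by simp [Ex.eval]
              rw [this, Finset.sum_range_succ, Finset.sum_range_succ, ← hI2.sum g, h1]
              congr 1
              · refine Finset.sum_congr rfl fun k hk => ?_
                have : k ≠ υ.v 2 := by have := Finset.mem_range.1 hk; omega
                simp [Ex.eval, this]
              · simp [Ex.eval, e0, hυ]
        · intro hlt
          have h1 : α i j = 0 := by
            simp only [Ex.eval, e0, hυ, em] at hlt; omega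
          refine ⟨hI1, ?_, hI2.lt, fun g => ?_⟩
          · simp [hI2.len, Finset.sum_range_succ, h1]
          · rw [Finset.sum_range_succ, h1, zero_mul, add_zero]
            exact hI2.sum g
      · rintro υ hF' - ⟨h1, h2⟩
        exact ⟨by rw [hF'.v 0 (by decide)]; simpa using hτ, h1, h2⟩
    · rintro υ hF' ⟨e0, h1, h2⟩
      refine ⟨by omega, trivial, trivial, by simpa [Ex.eval, e0] using hi, fun v hv => ?_⟩
      by_cases hvi : v = i
      · subst hvi
        simpa [Ex.eval, e0] using
          h2.congr (τ := ((υ.seta 0 v (υ.v 2)).setv 0 (v + 1))) (fun k => rfl)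
      · have ha : υ.a 0 = τ.a 0 := by rw [hF'.a 0 (by decide)]; rfl
        have : RowOk n α τ v (τ.a 0 v) n := hI v (by omega)
        simpa [Ex.eval, e0, Function.update_apply, hvi, ha] using
          this.congr (τ := ((υ.seta 0 i (υ.v 2)).setv 0 (i + 1))) (fun k => by simp [h1 v hvi])
  · rintro τ hF - hI
    exact ⟨by rw [hF.m 0 (by decide), h0], hI⟩

/-- `a_o[v] := ∑ a_i[u]` over the neighbours `u` of `v`, for all `v`. -/
def nbrSum (i o : ℕ) : Cmd :=
  forn 0 (seq (asg 2 (lit 0)) (seq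
    (forTo 1 1 (arr 0 (var 0)) (asg 2 (.add (var 2) (arr i (mat 1 (var 0) (var 1))))))
    (put o (var 0) (var 2))))

theorem nbrSum_spec (hE : Env n B ρ) (hα : TriFree n α) {σ : St} (hL : Lists n α σ)
    (hρ : ∀ v < n, deg n α v ≤ ρ 1) {i o : ℕ} (hio : i ≠ o) (ho : o ≠ 0) (hi : i < 32)
    (ho' : o < 32) (hM : ∀ v < n, nsum n α v (σ.a i) < B) {Q : St → Prop}
    (hQ : ∀ τ, Fr [0, 1, 2] [o] [] σ τ → (∀ v < n, τ.a o v = nsum n α v (σ.a i)) → Q τ) :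
    (nbrSum i o).wp n B ρ Q σ := by
  have hB := hE.lt
  have hmono : ∀ {τ}, Fr (nbrSum i o).modV (nbrSum i o).modA (nbrSum i o).modM σ τ →
      Fr [0, 1, 2] [o] [] σ τ := fun h => h.mono (by simp [nbrSum, forn, forTo, modV])
        (by simp [nbrSum, forn, forTo, modA]) (by simp [nbrSum, forn, forTo, modM])
  refine wp_forn hE (by simp [forTo, modV])
    (fun k τ => ∀ v < k, τ.a o v = nsum n α v (σ.a i)) (fun v hv => by omega) ?_ ?_
  · rintro v hv τ hτ hF hI
    have hF := hmono hF
    have hLτ := hL.fr hF (by simpa using ho.symm)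
    have hai : τ.a i = σ.a i := hF.a i (by simpa using hio)
    have hd := hLτ.deg hv
    refine ⟨by simp [Ex.ok], ?_⟩
    refine wp_seq (P := fun υ => υ.v 2 = nsum n α v (σ.a i)) ?_ ?_
    · have hmono' : ∀ {υ : St} {σ' : St}, Fr (forTo 1 1 (arr 0 (var 0)) (asg 2 (.add (var 2)
          (arr i (mat 1 (var 0) (var 1)))))).modV (forTo 1 1 (arr 0 (var 0)) (asg 2 (.add (var 2)
          (arr i (mat 1 (var 0) (var 1)))))).modA (forTo 1 1 (arr 0 (var 0)) (asg 2 (.add (var 2)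
          (arr i (mat 1 (var 0) (var 1)))))).modM σ' υ → Fr [1, 2] [] [] σ' υ :=
        fun h => h.mono (by simp [forTo, modV]) (by simp [forTo, modA]) (by simp [forTo, modM])
      have hs := (hLτ.row v hv).sum (σ.a i)
      refine wp_forTo (τ.a 0 v) (by rw [hd]; exact hρ v hv)
        (by have := deg_le hα v; omega) (by simp [modV]) ?_
        (fun k υ => υ.v 2 = ∑ l ∈ range k, σ.a i (τ.m 1 v l)) ?_ ?_ ?_
      · intro υ hF'
        have hF' := hmono' hF'
        have e0 : υ.v 0 = v := by rw [hF'.v 0 (by decide)]; simpa using hτ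
        have ea : υ.a = τ.a := by funext j; rw [hF'.a j (by simp)]; rfl
        exact ⟨⟨by omega, trivial, by simpa [Ex.eval, e0] using hv⟩, by simp [Ex.eval, e0, ea]⟩
      · simp [Ex.eval]
      · intro k hk υ hυ hF' hI'
        have hF' := hmono' hF'
        have e0 : υ.v 0 = v := by rw [hF'.v 0 (by decide)]; simpa using hτ
        have ea : υ.a = τ.a := by funext j; rw [hF'.a j (by simp)]; rfl
        have em : υ.m = τ.m := by funext j; rw [hF'.m j (by simp)]; rfl
        have hlt := (hLτ.row v hv).lt k hk
        have hkn : k < n := by have := deg_le hα v; omega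
        have hle : ∑ l ∈ range (k + 1), σ.a i (τ.m 1 v l)
            ≤ ∑ l ∈ range (τ.a 0 v), σ.a i (τ.m 1 v l) :=
          Finset.sum_le_sum_of_subset (Finset.range_mono hk)
        have := hM v hv
        rw [nsum] at this
        rw [hs, Finset.sum_range_succ] at hle
        refine ⟨⟨trivial, ⟨hi, ⟨by omega, trivial, trivial, by simpa [Ex.eval, e0] using hv,
          by simpa [Ex.eval, hυ] using hkn⟩, by simpa [Ex.eval, e0, em, hυ] using hlt⟩, ?_⟩, ?_⟩
        · simp only [Ex.eval, e0, em, ea, hυ, hI', hai]; omega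
        · simp [Ex.eval, e0, em, ea, hυ, hI', hai, Finset.sum_range_succ]
      · rintro υ - - h; rw [h, hs]; rfl
    · rintro υ hF' h2
      have e0 : υ.v 0 = v := by
        rw [hF'.v 0 (by simp [forTo, modV])]; simpa using hτ
      refine ⟨ho', trivial, trivial, by simpa [Ex.eval, e0] using hv, fun u hu => ?_⟩
      by_cases huv : u = v
      · subst huv; simp [Ex.eval, e0, h2]
      · have ha : υ.a o = τ.a o := by rw [hF'.a o (by simp [forTo, modA])]; rfl
        simp [Ex.eval, e0, huv, ha, hI u (by omega)]
  · rintro τ hF - hI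
    exact hQ τ (hmono hF) hI

/-- Variable `10` becomes the maximum degree. -/
def progMax : Cmd :=
  seq (asg 10 (lit 0)) (forn 0 (ite (var 10) (arr 0 (var 0)) (asg 10 (arr 0 (var 0))) skip))

theorem progMax_spec (hE : Env n B ρ) {σ : St} (hL : Lists n α σ) :
    progMax.wp n B ρ (fun τ => (∀ v < n, deg n α v ≤ τ.v 10) ∧
      ∀ m, (∀ v < n, deg n α v ≤ m) → τ.v 10 ≤ m) σ := by
  refine ⟨by simp [Ex.ok], wp_forn hE (by decide) (fun i τ => (∀ v < i, deg n α v ≤ τ.v 10) ∧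
      ∀ m, (∀ v < n, deg n α v ≤ m) → τ.v 10 ≤ m) ?_ ?_ fun τ _ _ h => h⟩
  · exact ⟨fun v hv => by omega, fun m _ => by simp [Ex.eval]⟩
  · rintro i hi τ hτ hF ⟨h1, h2⟩
    have ea : τ.a 0 = σ.a 0 := hF.a 0 (by decide)
    have hd := hL.deg hi
    refine ⟨trivial, ⟨by omega, trivial, by simpa [Ex.eval, hτ] using hi⟩, fun hlt => ?_,
      fun hlt => ?_⟩
    · simp only [Ex.eval, hτ, ea, hd] at hlt
      refine ⟨⟨by omega, trivial, by simpa [Ex.eval, hτ] using hi⟩, fun v hv => ?_, fun m hm => ?_⟩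
      · simp only [Ex.eval, hτ, ea, hd, St.setv_v, if_true]
        rcases Nat.lt_succ_iff_lt_or_eq.1 hv with h3 | rfl
        · simpa using (h1 v h3).trans hlt.le
        · simp
      · simpa [Ex.eval, hτ, ea, hd] using hm i hi
    · simp only [Ex.eval, hτ, ea, hd] at hlt
      refine ⟨fun v hv => ?_, fun m hm => by simpa using h2 m hm⟩
      rcases Nat.lt_succ_iff_lt_or_eq.1 hv with h3 | rfl
      · simpa using h1 v h3
      · simp; omega

/-- Arrays `5` and `6` become tables of `shF` and `shG`, with the scale `n ^ 8` in variable `11`. -/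
def progTable : Cmd :=
  seq (asg 11 (.mul len len)) (seq (asg 11 (.mul (var 11) (var 11)))
    (seq (asg 11 (.mul (var 11) (var 11))) (forn 0 (seq
      (put 5 (var 0) (.div (.add (var 11)
        (.mul (.sub (.mul (var 0) (var 0)) (var 0)) (arr 5 (.sub (var 0) (lit 1)))))
        (.add (.mul (var 0) (var 0)) (lit 1))))
      (put 6 (var 0) (.sub (arr 5 (.sub (var 0) (lit 1))) (arr 5 (var 0))))))))

/-- The scale `n ^ 8` is fine enough for the weights of all degrees that occur. -/
theorem scale_ge (hn : 4 ≤ n) : 16 * (n + 2) ^ 4 ≤ n ^ 8 := by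
  have h1 : (2 * (n + 2)) ^ 4 ≤ (3 * n) ^ 4 := Nat.pow_le_pow_left (by omega) 4
  have h2 : 4 ^ 4 * n ^ 4 ≤ n ^ 4 * n ^ 4 := Nat.mul_le_mul_right _ (Nat.pow_le_pow_left hn 4)
  have e1 : (2 * (n + 2)) ^ 4 = 16 * (n + 2) ^ 4 := by ring
  have e2 : (3 * n) ^ 4 = 81 * n ^ 4 := by ring
  have e3 : n ^ 8 = n ^ 4 * n ^ 4 := by ring
  omega

theorem scale_ge_sq (hn : 4 ≤ n) : (n + 2) ^ 2 ≤ n ^ 8 := by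
  refine le_trans ?_ (scale_ge hn)
  have : (n + 2) ^ 2 ≤ (n + 2) ^ 4 := Nat.pow_le_pow_right (by omega) (by norm_num)
  omega

theorem shF_le_scale (hn : 4 ≤ n) {d : ℕ} (hd : d ≤ n) : shF (n ^ 8) d ≤ n ^ 8 := by
  have := shF_anti (N := n ^ 8) (D := n) (scale_ge_sq hn) (Nat.zero_le d) (by omega)
  simpa [shF] using this

theorem progTable_spec (hE : Env n B ρ) {σ : St} :
    progTable.wp n B ρ (fun τ => τ.v 11 = n ^ 8 ∧ ∀ d < n, τ.a 5 d = shF (n ^ 8) d ∧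
      τ.a 6 d = shG (n ^ 8) d) σ := by
  have hB := hE.lt
  have p2 := hE.pow_lt (k := 2) (by norm_num)
  have p4 := hE.pow_lt (k := 4) (by norm_num)
  have p8 := hE.pow_lt (k := 8) (by norm_num)
  have e2 : n * n = n ^ 2 := by ring
  have e4 : n ^ 2 * n ^ 2 = n ^ 4 := by ring
  have e8 : n ^ 4 * n ^ 4 = n ^ 8 := by ring
  refine ⟨by simpa [Ex.ok, Ex.eval, e2] using p2, ⟨trivial, trivial, ?_⟩,
    ⟨trivial, trivial, ?_⟩, ?_⟩
  · simpa [Ex.eval, e2, e4] using p4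
  · simpa [Ex.eval, e2, e4, e8] using p8
  refine wp_forn hE (by decide) (fun i τ => τ.v 11 = n ^ 8 ∧ ∀ d < i, τ.a 5 d = shF (n ^ 8) d ∧
      τ.a 6 d = shG (n ^ 8) d) ?_ ?_ fun τ _ _ h => h
  · exact ⟨by simp [Ex.eval, e2, e4, e8], fun d hd => by omega⟩
  · rintro i hi τ hτ hF ⟨h11, hI⟩
    have hsq : i * i ≤ n * n := Nat.mul_le_mul hi.le hi.le
    have p3 : n ^ 2 * n < B := lt_of_eq_of_lt (by ring) (hE.pow_lt (k := 3) (by norm_num))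
    have p5 : 4 * n ^ 10 < B := by
      refine lt_of_le_of_lt ?_ (hE.pow_lt (k := 11) (by norm_num))
      rw [show n ^ 11 = n * n ^ 10 by ring]; exact Nat.mul_le_mul_right _ hE.four
    have hprod : (i * i - i) * τ.a 5 (i - 1) ≤ n ^ 10 := by
      rcases Nat.eq_zero_or_pos i with rfl | h
      · simp
      · rw [(hI (i - 1) (by omega)).1, show n ^ 10 = n ^ 2 * n ^ 8 by ring]
        exact Nat.mul_le_mul (by omega) (shF_le_scale hE.four (by omega))
    have hval : (n ^ 8 + (i * i - i) * τ.a 5 (i - 1)) / (i * i + 1) = shF (n ^ 8) i := by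
      cases i with
      | zero => simp [shF]
      | succ i =>
        rw [Nat.add_sub_cancel, (hI i (by omega)).1, shF]
        congr 3
        rw [Nat.mul_succ, Nat.add_sub_cancel]
    have hn10 : n ^ 8 ≤ n ^ 10 := Nat.pow_le_pow_right (by omega) (by norm_num)
    have p2' : n ^ 2 + 1 < B := by nlinarith [hE.four]
    refine ⟨by omega, trivial, ?_, by simpa [Ex.eval, hτ] using hi, ?_⟩
    · simp only [Ex.ok, Ex.eval, hτ, h11, true_and]
      refine ⟨⟨⟨⟨?_, ?_⟩, ?_⟩, ?_⟩, ?_, ?_⟩ <;> first | omega | skip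
      all_goals simp
    · have e0 : (τ.seta 5 (eval n τ (var 0)) (eval n τ (.div (.add (var 11)
        (.mul (.sub (.mul (var 0) (var 0)) (var 0)) (arr 5 (.sub (var 0) (lit 1)))))
        (.add (.mul (var 0) (var 0)) (lit 1))))) = τ.seta 5 i (shF (n ^ 8) i) := by
        simp only [Ex.eval, hτ, h11, hval]
      rw [e0]
      refine ⟨by omega, trivial, ?_, by simpa [Ex.eval, hτ] using hi, ?_⟩
      · simp only [Ex.ok, Ex.eval, St.seta_v, hτ, true_and]
        omega
      · refine ⟨by simpa using h11, fun d hd => ?_⟩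
        rcases Nat.lt_succ_iff_lt_or_eq.1 hd with h3 | rfl
        · have : d ≠ i := by omega
          simpa [Ex.eval, hτ, Function.update_apply, this] using hI d h3
        · refine ⟨by simp, ?_⟩
          rcases Nat.eq_zero_or_pos d with rfl | h
          · simp [Ex.eval, hτ, shG]
          · have : d - 1 ≠ d := by omega
            simp [Ex.eval, hτ, shG, this, (hI (d - 1) (by omega)).1]

/-! ### Classes of twins by partition refinement -/

/-- Array `1` is refined by the columns of the adjacency matrix, until two vertices have the same
label if and only if they are twins; array `2` holds the new labels of the classes split by the
current column. -/
def progRefine : Cmd :=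
  seq (Cmd.map 1 1 (lit 0)) (forn 0 (seq (Cmd.map 1 2 len)
    (forn 1 (seq (asg 2 (arr 1 (var 1)))
      (ite (mat 0 (var 0) (var 1)) (mat 0 (var 0) (var 2))
        (seq (ite (arr 2 (var 2)) len skip (put 2 (var 2) (var 1)))
          (put 1 (var 1) (arr 2 (var 2))))
        (ite (mat 0 (var 0) (var 2)) (mat 0 (var 0) (var 1))
          (seq (ite (arr 2 (var 2)) len skip (put 2 (var 2) (var 1)))
            (put 1 (var 1) (arr 2 (var 2))))
          skip))))))

/-- `R` labels the vertices by representatives of their classes modulo agreement in the columns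
below `i`. -/
structure Labels (n : ℕ) (α : ℕ → ℕ → ℕ) (i : ℕ) (R : ℕ → ℕ) : Prop where
  lt : ∀ v < n, R v < n
  agree : ∀ v < n, ∀ w < i, α w (R v) = α w v
  eq : ∀ u < n, ∀ v < n, (∀ w < i, α w u = α w v) → R u = R v

/-- State of the refinement of `R` by column `i` when the vertices below `j` have been treated. -/
structure Refine (n : ℕ) (α : ℕ → ℕ → ℕ) (i : ℕ) (R : ℕ → ℕ) (j : ℕ) (τ : St) : Prop where
  old : ∀ v, j ≤ v → τ.a 1 v = R v
  new : ∀ v < j, τ.a 1 v = if α i v = α i (R v) then R v else τ.a 2 (R v)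
  set : ∀ v < j, α i v ≠ α i (R v) → τ.a 2 (R v) < n
  split : ∀ c < n, τ.a 2 c = n ∨ (τ.a 2 c < j ∧ R (τ.a 2 c) = c ∧ α i (τ.a 2 c) ≠ α i c)

/-- A class that is split by column `i` keeps its label for the vertices which agree with its
representative, and gets the first of the other vertices as a new label. -/
theorem Refine.labels (hα : TriFree n α) {i : ℕ} {R : ℕ → ℕ} {τ : St} (hR : Labels n α i R)
    (h : Refine n α i R n τ) : Labels n α (i + 1) (τ.a 1) := by
  have hs : ∀ v < n, α i v ≠ α i (R v) → τ.a 2 (R v) < n ∧ R (τ.a 2 (R v)) = R v ∧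
      α i (τ.a 2 (R v)) = α i v := by
    intro v hv hne
    have h1 := h.set v hv hne
    rcases h.split (R v) (hR.lt v hv) with h2 | ⟨-, h3, h4⟩
    · omega
    · refine ⟨h1, h3, ?_⟩
      have := hα.le_one i (τ.a 2 (R v))
      have := hα.le_one i v
      have := hα.le_one i (R v)
      omega
  refine ⟨fun v hv => ?_, fun v hv w hw => ?_, fun u hu v hv huv => ?_⟩
  · rw [h.new v hv]; split
    · exact hR.lt v hv
    · next hne => exact (hs v hv hne).1
  · rw [h.new v hv]; split
    · next he =>
      rcases Nat.lt_succ_iff_lt_or_eq.1 hw with h1 | rfl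
      · exact hR.agree v hv w h1
      · exact he.symm
    · next hne =>
      obtain ⟨h1, h2, h3⟩ := hs v hv hne
      rcases Nat.lt_succ_iff_lt_or_eq.1 hw with h4 | rfl
      · rw [← hR.agree _ h1 w h4, h2, hR.agree v hv w h4]
      · exact h3
  · have e1 : R u = R v := hR.eq u hu v hv fun w hw => huv w (by omega)
    rw [h.new u hu, h.new v hv, e1, huv i (by omega)]

theorem progRefine_spec (hE : Env n B ρ) (hα : TriFree n α) {σ : St} (h0 : σ.m 0 = α) :
    progRefine.wp n B ρ (fun τ => Labels n α n (τ.a 1)) σ := by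
  have hB := hE.lt
  have hn := hE.four
  refine wp_seq (P := fun τ => ∀ v < n, τ.a 1 v = 0)
    (wp_map hE (by norm_num) (fun _ => 0) (fun _ _ _ _ _ _ => ⟨by simp [Ex.ok], rfl⟩)
      fun τ _ h => h) ?_
  intro σ1 hF1 h1
  refine wp_forn hE (by decide) (fun i τ => Labels n α i (τ.a 1)) ?_ ?_ fun τ _ _ h => h
  · refine ⟨fun v hv => ?_, fun _ _ w hw => by omega, fun u hu v hv _ => ?_⟩
    · simp [h1 v hv]; omega
    · simp [h1 v hv, h1 u hu]
  · intro i hi τ hτ hF hR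
    refine wp_seq (P := fun υ => ∀ c < n, υ.a 2 c = n) (wp_map hE (by norm_num) (fun _ => n)
      (fun _ _ _ _ _ _ => ⟨trivial, rfl⟩) fun τ _ h => h) ?_
    intro τ1 hF2 h2
    have em1 : τ1.m 0 = α := by
      rw [hF2.m 0 (by decide), hF.m 0 (by decide), hF1.m 0 (by decide), h0]
    have e01 : τ1.v 0 = i := by rw [hF2.v 0 (by decide), hτ]
    have eR : τ1.a 1 = τ.a 1 := hF2.a 1 (by decide)
    refine wp_forn hE (by decide) (fun j υ => Refine n α i (τ.a 1) j υ) ?_ ?_ ?_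
    · exact ⟨fun v _ => by simp [eR], fun v hv => by omega, fun v hv => by omega,
        fun c hc => .inl (by simpa using h2 c hc)⟩
    · intro j hj υ hυ hF3 hI
      have e0 : υ.v 0 = i := by rw [hF3.v 0 (by decide), e01]
      have em : υ.m 0 = α := by rw [hF3.m 0 (by decide), em1]
      have hRj := hR.lt j hj
      have hj1 : υ.a 1 j = τ.a 1 j := hI.old j le_rfl
      refine ⟨⟨by omega, trivial, by simpa [Ex.eval, hυ] using hj⟩, ?_⟩
      set υ1 := υ.setv 2 (eval n υ (arr 1 (var 1))) with hυ1
      have f0 : υ1.v 0 = i := by simp [υ1, e0]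
      have f1 : υ1.v 1 = j := by simp [υ1, hυ]
      have f2 : υ1.v 2 = τ.a 1 j := by simp [υ1, Ex.eval, hυ, hj1]
      have fm : υ1.m 0 = α := by simp [υ1, em]
      have fa : υ1.a = υ.a := by simp [υ1]
      have hbody : α i j ≠ α i (τ.a 1 j) →
          (seq (ite (arr 2 (var 2)) len skip (put 2 (var 2) (var 1)))
          (put 1 (var 1) (arr 2 (var 2)))).wp n B ρ
            (fun τ' => Refine n α i (τ.a 1) (j + 1) (τ'.setv 1 (j + 1))) υ1 := by
        intro hne
        refine ⟨⟨by omega, trivial, by simpa [Ex.eval, f2] using hRj⟩, trivial, fun hlt => ?_,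
          fun hlt => ?_⟩
        · simp only [Ex.eval, f2, fa] at hlt
          refine ⟨by omega, trivial, ⟨by omega, trivial, by simpa [Ex.eval, f2] using hRj⟩,
            by simpa [Ex.eval, f1] using hj, ?_⟩
          refine ⟨fun v hv => ?_, fun v hv => ?_, fun v hv hvne => ?_, fun c hc => ?_⟩
          · have : v ≠ j := by omega
            simpa [Ex.eval, f1, f2, fa, Function.update_apply, this] using hI.old v (by omega)
          · rcases Nat.lt_succ_iff_lt_or_eq.1 hv with h3 | rfl
            · have : v ≠ j := by omega
              simpa [Ex.eval, f1, f2, fa, Function.update_apply, this] using hI.new v h3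
            · simp [Ex.eval, f1, f2, fa, hne]
          · rcases Nat.lt_succ_iff_lt_or_eq.1 hv with h3 | rfl
            · simpa [fa] using hI.set v h3 hvne
            · simpa [fa] using hlt
          · rcases hI.split c hc with h3 | ⟨h3, h4⟩
            · exact .inl (by simpa [fa] using h3)
            · exact .inr ⟨by simp [fa]; omega, by simpa [fa] using h4⟩
        · simp only [Ex.eval, f2, fa] at hlt
          have hsp : υ.a 2 (τ.a 1 j) = n := by
            rcases hI.split _ hRj with h3 | ⟨h3, -⟩
            · exact h3
            · omega
          refine ⟨by omega, trivial, trivial, by simpa [Ex.eval, f2] using hRj, ?_⟩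
          refine ⟨by omega, trivial, ⟨by omega, trivial, by simpa [Ex.eval, f2] using hRj⟩,
            by simpa [Ex.eval, f1] using hj, ?_⟩
          refine ⟨fun v hv => ?_, fun v hv => ?_, fun v hv hvne => ?_, fun c hc => ?_⟩
          · have : v ≠ j := by omega
            simpa [Ex.eval, f1, f2, fa, Function.update_apply, this] using hI.old v (by omega)
          · rcases Nat.lt_succ_iff_lt_or_eq.1 hv with h3 | rfl
            · have hvj : v ≠ j := by omega
              have hnew := hI.new v h3
              by_cases hc : τ.a 1 v = τ.a 1 j
              · by_cases he : α i v = α i (τ.a 1 v)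
                · simpa [Ex.eval, f1, f2, fa, Function.update_apply, hvj, he] using hnew
                · have := hI.set v h3 he
                  rw [hc] at this; omega
              · simpa [Ex.eval, f1, f2, fa, Function.update_apply, hvj, hc] using hnew
            · simp [Ex.eval, f1, f2, fa, hne]
          · by_cases hc : τ.a 1 v = τ.a 1 j
            · simp [Ex.eval, f1, f2, fa, hc]; omega
            · rcases Nat.lt_succ_iff_lt_or_eq.1 hv with h3 | rfl
              · simpa [Ex.eval, f1, f2, fa, hc] using hI.set v h3 hvne
              · exact absurd rfl hc
          · by_cases hcj : c = τ.a 1 j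
            · subst hcj
              exact .inr ⟨by simp [Ex.eval, f1, f2, fa], by simp [Ex.eval, f1, f2, fa],
                by simpa [Ex.eval, f1, f2, fa] using hne⟩
            · rcases hI.split c hc with h3 | ⟨h3, h4⟩
              · exact .inl (by simpa [Ex.eval, f1, f2, fa, hcj] using h3)
              · exact .inr ⟨by simp [Ex.eval, f2, fa, hcj]; omega,
                  by simpa [Ex.eval, f2, fa, hcj] using h4⟩
      have hok1 : (mat 0 (var 0) (var 1)).ok n B υ1 :=
        ⟨by omega, trivial, trivial, by simpa [Ex.eval, f0] using hi,
          by simpa [Ex.eval, f1] using hj⟩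
      have hok2 : (mat 0 (var 0) (var 2)).ok n B υ1 :=
        ⟨by omega, trivial, trivial, by simpa [Ex.eval, f0] using hi,
          by simpa [Ex.eval, f2] using hRj⟩
      refine ⟨hok1, hok2, fun hlt => hbody ?_, fun hlt => ⟨hok2, hok1, fun hlt' => hbody ?_,
        fun hlt' => ?_⟩⟩
      · simp only [Ex.eval, f0, f1, f2, fm] at hlt; omega
      · simp only [Ex.eval, f0, f1, f2, fm] at hlt'; omega
      · simp only [Ex.eval, f0, f1, f2, fm] at hlt hlt'
        have he : α i j = α i (τ.a 1 j) := by omega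
        refine ⟨fun v hv => ?_, fun v hv => ?_, fun v hv hvne => ?_, fun c hc => ?_⟩
        · simpa [fa] using hI.old v (by omega)
        · rcases Nat.lt_succ_iff_lt_or_eq.1 hv with h3 | rfl
          · simpa [fa] using hI.new v h3
          · simpa [fa, he] using hj1
        · rcases Nat.lt_succ_iff_lt_or_eq.1 hv with h3 | rfl
          · simpa [fa] using hI.set v h3 hvne
          · exact absurd he hvne
        · rcases hI.split c hc with h3 | ⟨h3, h4⟩
          · exact .inl (by simpa [fa] using h3)
          · exact .inr ⟨by simp [fa]; omega, by simpa [fa] using h4⟩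
    · intro υ _ _ hI
      have := hI.labels hα hR
      simpa using this

/-- Sizes of the classes in array `3`, indicator of the vertices without twins in array `4`,
indicator of the representatives of the other classes in array `23`, and the number of vertices
without twins in variable `12`. -/
def progClasses : Cmd :=
  seq (Cmd.map 1 3 (lit 0)) (seq
    (forn 1 (put 3 (arr 1 (var 1)) (.add (arr 3 (arr 1 (var 1))) (lit 1)))) (seq
    (Cmd.map 1 4 (.div (lit 1) (arr 3 (var 1)))) (seq
    (Cmd.map 1 23 (.sub (lit 1) (.div (lit 2) (.add (arr 3 (var 1)) (lit 1)))))
    (Cmd.sum 1 12 (arr 4 (var 1))))))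

/-- Number of vertices with the label `c`. -/
def cls (n : ℕ) (R : ℕ → ℕ) (c : ℕ) : ℕ := ((range n).filter fun v => R v = c).card

theorem cls_le (R : ℕ → ℕ) (c : ℕ) : cls n R c ≤ n := by
  simpa [cls] using Finset.card_filter_le (range n) fun v => R v = c

theorem progClasses_spec (hE : Env n B ρ) {σ : St} (hR : Labels n α n (σ.a 1)) :
    progClasses.wp n B ρ (fun τ => (∀ v < n, τ.a 4 v = 1 / cls n (σ.a 1) v) ∧
      (∀ v < n, τ.a 23 v = 1 - 2 / (cls n (σ.a 1) v + 1)) ∧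
      τ.v 12 = ∑ v ∈ range n, 1 / cls n (σ.a 1) v) σ := by
  have hB := hE.lt
  have hn := hE.four
  refine wp_seq (P := fun τ => ∀ v < n, τ.a 3 v = 0)
    (wp_map hE (by norm_num) (fun _ => 0) (fun _ _ _ _ _ _ => ⟨by simp [Ex.ok], rfl⟩)
      fun τ _ h => h) ?_
  intro σ1 hF1 h1
  have e1 : σ1.a 1 = σ.a 1 := hF1.a 1 (by decide)
  refine wp_seq (P := fun τ => ∀ c < n, τ.a 3 c = cls n (σ.a 1) c) ?_ ?_
  · refine wp_forn hE (by decide) (fun i τ => ∀ c < n, τ.a 3 c = cls i (σ.a 1) c) ?_ ?_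
      fun τ _ _ h => h
    · intro c hc; simpa [cls] using h1 c hc
    · intro i hi τ hτ hF hI
      have e2 : τ.a 1 = σ.a 1 := by rw [hF.a 1 (by decide), e1]
      have hRi := hR.lt i hi
      have hcl := cls_le (n := i) (σ.a 1) (σ.a 1 i)
      have ho : (arr 1 (var 1)).ok n B τ := ⟨by omega, trivial, by simpa [Ex.eval, hτ] using hi⟩
      have hv : (arr 1 (var 1)).eval n τ = σ.a 1 i := by simp [Ex.eval, hτ, e2]
      refine ⟨by omega, ho, ⟨⟨by omega, ho, by rw [hv]; exact hRi⟩, by simp [Ex.ok], ?_⟩,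
        by rw [hv]; exact hRi, fun c hc => ?_⟩
      · have := hI _ hRi
        simp only [Ex.eval] at hv ⊢
        rw [hv, this]; omega
      · have hcs : cls (i + 1) (σ.a 1) c = cls i (σ.a 1) c + if σ.a 1 i = c then 1 else 0 := by
          rw [cls, Finset.range_add_one, Finset.filter_insert]
          split
          · rw [Finset.card_insert_of_notMem (by simp)]; rfl
          · rfl
        rw [hcs]
        simp only [Ex.eval] at hv
        by_cases h : σ.a 1 i = c
        · subst h; simp [Ex.eval, hv, hI _ hc]
        · have h' : c ≠ σ.a 1 i := fun e => h e.symm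
          simp [Ex.eval, hv, hI _ hc, h, h']
  intro σ2 hF2 h2
  have hcl := cls_le (n := n) (σ.a 1)
  refine wp_seq (P := fun τ => ∀ c < n, τ.a 4 c = 1 / cls n (σ.a 1) c)
    (wp_map hE (by norm_num) _ (fun i hi τ hF hτ _ => ?_) fun τ _ h => h) ?_
  · have e3 : τ.a 3 = σ2.a 3 := hF.a 3 (by decide)
    exact ⟨⟨by simp [Ex.ok], by omega, trivial, by simpa [Ex.eval, hτ] using hi⟩,
      by simp [Ex.eval, hτ, e3, h2 i hi]⟩
  intro σ3 hF3 h3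
  refine wp_seq (P := fun τ => ∀ v < n, τ.a 23 v = 1 - 2 / (cls n (σ.a 1) v + 1))
    (wp_map hE (by norm_num) _ (fun i hi τ hF hτ _ => ?_) fun τ _ h => h) ?_
  · have e3 : τ.a 3 = σ2.a 3 := by rw [hF.a 3 (by decide), hF3.a 3 (by decide)]
    have := hcl i
    exact ⟨⟨by simp [Ex.ok], by simp [Ex.ok], ⟨by omega, trivial, by simpa [Ex.eval, hτ] using hi⟩,
      by simp [Ex.ok], by simp [Ex.eval, hτ, e3, h2 i hi]; omega⟩,
      by simp [Ex.eval, hτ, e3, h2 i hi]⟩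
  intro σ4 hF4 h4
  have e4 : σ4.a 4 = σ3.a 4 := hF4.a 4 (by decide)
  refine wp_sum hE (by norm_num) (fun v => 1 / cls n (σ.a 1) v) (fun i hi τ hF hτ => ?_) ?_ ?_
  · exact ⟨⟨by omega, trivial, by simpa [Ex.eval, hτ] using hi⟩,
      by simp [Ex.eval, hτ, hF.a 4, e4, h3 i hi]⟩
  · refine lt_of_le_of_lt (Finset.sum_le_card_nsmul _ _ 1 fun v _ => Nat.div_le_self _ _) ?_
    simp; omega
  · intro τ hF hv
    exact ⟨fun v hv => by rw [hF.a 4 (by decide), e4, h3 v hv],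
      fun v hv => by rw [hF.a 23 (by decide), h4 v hv], hv⟩

/-! ### The greedy independent set -/

/-- Indicator function of a finite set. -/
def ind (W : Finset ℕ) (v : ℕ) : ℕ := if v ∈ W then 1 else 0

/-- Sums over neighbours in `W` of data which are masked by the indicator of `W`. -/
theorem nsum_ind {W : Finset ℕ} (hW : W ⊆ range n) (v : ℕ) {g φ : ℕ → ℕ}
    (hg : ∀ u < n, g u = ind W u * φ u) : nsum n α v g = ∑ u ∈ W, α v u * φ u := by
  rw [nsum_congr hg, nsum, ← Finset.inter_eq_right.2 hW, ← Finset.sum_ite_mem]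
  refine Finset.sum_congr rfl fun u _ => ?_
  rw [Finset.inter_eq_right.2 hW, ind]
  split <;> simp

/-- The quantities of the test of the greedy algorithm, computed from the indicator of the
remaining vertices in array `7`: degrees in array `8`, their weights in array `9`, the two sides
of the test from arrays `12` and `13`. -/
def progTest : Cmd :=
  seq (nbrSum 7 8) (seq
    (Cmd.map 0 9 (.mul (arr 7 (var 0)) (arr 5 (arr 8 (var 0))))) (seq
    (Cmd.map 0 10 (.mul (arr 7 (var 0)) (arr 6 (arr 8 (var 0))))) (seq
    (nbrSum 10 11) (seq
    (Cmd.map 0 11 (.mul (arr 7 (var 0)) (arr 11 (var 0)))) (seq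
    (nbrSum 11 12) (nbrSum 9 13))))))

/-- What the greedy rounds presuppose: adjacency lists, the scale, and the tables of weights. -/
structure Ready (n : ℕ) (α : ℕ → ℕ → ℕ) (σ : St) : Prop where
  lists : Lists n α σ
  scale : σ.v 11 = n ^ 8
  tabF : ∀ d < n, σ.a 5 d = shF (n ^ 8) d
  tabG : ∀ d < n, σ.a 6 d = shG (n ^ 8) d

theorem Ready.fr {V A : List ℕ} {σ τ : St} (h : Ready n α σ) (hF : Fr V A [] σ τ)
    (hV : 11 ∉ V) (hA : 0 ∉ A ∧ 5 ∉ A ∧ 6 ∉ A) : Ready n α τ :=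
  ⟨h.lists.fr hF hA.1, by rw [hF.v 11 hV, h.scale],
    fun d hd => by rw [hF.a 5 hA.2.1, h.tabF d hd], fun d hd => by rw [hF.a 6 hA.2.2, h.tabG d hd]⟩

theorem dg_lt' (h : TriFree n α) {W : Finset ℕ} (hW : W ⊆ range n) {v : ℕ} (hv : v < n) :
    dg α W v < n := by
  refine lt_of_le_of_lt ?_
    (dg_lt h (W := range n) (Finset.Subset.refl _) (v := v) (by simpa using hv))
  exact Finset.sum_le_sum_of_subset hW

theorem shG_le_scale (hn : 4 ≤ n) {d : ℕ} (hd : d ≤ n) : shG (n ^ 8) d ≤ n ^ 8 :=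
  (Nat.sub_le _ _).trans (shF_le_scale hn (by omega))

theorem ind_le (W : Finset ℕ) (v : ℕ) : ind W v ≤ 1 := by rw [ind]; split <;> omega

theorem progTest_spec (hE : Env n B ρ) (hα : TriFree n α) {σ : St} (hr : Ready n α σ)
    (hρ : ∀ v < n, deg n α v ≤ ρ 1) {W : Finset ℕ} (hW : W ⊆ range n)
    (h7 : ∀ v < n, σ.a 7 v = ind W v) :
    progTest.wp n B ρ (fun τ => ∀ v ∈ W, τ.a 8 v = dg α W v ∧
      τ.a 9 v = shF (n ^ 8) (dg α W v) ∧ τ.a 10 v = shG (n ^ 8) (dg α W v) ∧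
      τ.a 12 v = ∑ w ∈ W, α v w * ∑ u ∈ W, α w u * shG (n ^ 8) (dg α W u) ∧
      τ.a 13 v = ∑ w ∈ W, α v w * shF (n ^ 8) (dg α W w)) σ := by
  have hB := hE.lt
  have hn := hE.four
  have p8 := hE.pow_lt (k := 8) (by norm_num)
  have p9 := hE.pow_lt (k := 9) (by norm_num)
  have p10 := hE.pow_lt (k := 10) (by norm_num)
  have e9 : n * n ^ 8 = n ^ 9 := by ring
  have e10 : n * n ^ 9 = n ^ 10 := by ring
  have hd := fun v (hv : v < n) => dg_lt' hα hW hv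
  refine wp_seq (P := fun τ => ∀ v < n, τ.a 8 v = dg α W v) ?_ ?_
  · refine nbrSum_spec hE hα hr.lists hρ (by norm_num) (by norm_num) (by norm_num) (by norm_num)
      (fun v hv => ?_) fun τ hF h v hv => ?_
    · have := nsum_le hα (v := v) (g := σ.a 7) (M := 1) fun u hu => by
        rw [h7 u hu]; exact ind_le W u
      omega
    · rw [h v hv, nsum_ind hW v (φ := fun _ => 1) fun u hu => by rw [h7 u hu, mul_one]]
      simp [dg]
  intro σ1 hF1 h8
  have r1 : Ready n α σ1 := hr.fr hF1 (by decide) (by decide)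
  have h71 : ∀ v < n, σ1.a 7 v = ind W v := fun v hv => by rw [hF1.a 7 (by decide), h7 v hv]
  refine wp_seq (P := fun τ => ∀ v < n, τ.a 9 v = ind W v * shF (n ^ 8) (dg α W v))
    (wp_map hE (by norm_num) _ (fun i hi τ hF hτ _ => ?_) fun τ _ h => h) ?_
  · have hdi := hd i hi
    have hv : (Ex.mul (arr 7 (var 0)) (arr 5 (arr 8 (var 0)))).eval n τ
        = ind W i * shF (n ^ 8) (dg α W i) := by
      simp only [Ex.eval, hτ, hF.a 7 (by decide), hF.a 8 (by decide), hF.a 5 (by decide),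
        h71 i hi, h8 i hi, r1.tabF _ hdi]
    refine ⟨⟨⟨by omega, trivial, by simpa [Ex.eval, hτ] using hi⟩, ⟨by omega, ⟨by omega, trivial,
      by simpa [Ex.eval, hτ] using hi⟩, by simpa [Ex.eval, hτ, hF.a 8, h8 i hi] using hdi⟩, ?_⟩, hv⟩
    simp only [Ex.eval] at hv
    simp only [Ex.eval]
    rw [hv]
    refine lt_of_le_of_lt (Nat.mul_le_mul (ind_le W i) (shF_le_scale hn hdi.le)) ?_
    omega
  intro σ2 hF2 h9
  have r2 : Ready n α σ2 := r1.fr hF2 (by decide) (by decide)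
  have h72 : ∀ v < n, σ2.a 7 v = ind W v := fun v hv => by rw [hF2.a 7 (by decide), h71 v hv]
  have h82 : ∀ v < n, σ2.a 8 v = dg α W v := fun v hv => by rw [hF2.a 8 (by decide), h8 v hv]
  refine wp_seq (P := fun τ => ∀ v < n, τ.a 10 v = ind W v * shG (n ^ 8) (dg α W v))
    (wp_map hE (by norm_num) _ (fun i hi τ hF hτ _ => ?_) fun τ _ h => h) ?_
  · have hdi := hd i hi
    have hv : (Ex.mul (arr 7 (var 0)) (arr 6 (arr 8 (var 0)))).eval n τ
        = ind W i * shG (n ^ 8) (dg α W i) := by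
      simp only [Ex.eval, hτ, hF.a 7 (by decide), hF.a 8 (by decide), hF.a 6 (by decide),
        h72 i hi, h82 i hi, r2.tabG _ hdi]
    refine ⟨⟨⟨by omega, trivial, by simpa [Ex.eval, hτ] using hi⟩, ⟨by omega, ⟨by omega, trivial,
      by simpa [Ex.eval, hτ] using hi⟩, by simpa [Ex.eval, hτ, hF.a 8, h82 i hi] using hdi⟩, ?_⟩,
      hv⟩
    simp only [Ex.eval] at hv
    simp only [Ex.eval]
    rw [hv]
    refine lt_of_le_of_lt (Nat.mul_le_mul (ind_le W i) (shG_le_scale hn hdi.le)) ?_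
    omega
  intro σ3 hF3 h10
  have r3 : Ready n α σ3 := r2.fr hF3 (by decide) (by decide)
  have h73 : ∀ v < n, σ3.a 7 v = ind W v := fun v hv => by rw [hF3.a 7 (by decide), h72 v hv]
  have h83 : ∀ v < n, σ3.a 8 v = dg α W v := fun v hv => by rw [hF3.a 8 (by decide), h82 v hv]
  have h93 : ∀ v < n, σ3.a 9 v = ind W v * shF (n ^ 8) (dg α W v) := fun v hv => by
    rw [hF3.a 9 (by decide), h9 v hv]
  set A : ℕ → ℕ := fun v => ∑ u ∈ W, α v u * shG (n ^ 8) (dg α W u) with hA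
  have hns : ∀ v, nsum n α v (σ3.a 10) = A v := fun v => nsum_ind hW v h10
  have hAle : ∀ v < n, A v ≤ n ^ 9 := fun v hv => by
    rw [← hns, ← e9]
    refine nsum_le hα fun u hu => ?_
    rw [h10 u hu]
    have := Nat.mul_le_mul (ind_le W u) (shG_le_scale hn (hd u hu).le)
    omega
  refine wp_seq (P := fun τ => ∀ v < n, τ.a 11 v = A v) ?_ ?_
  · refine nbrSum_spec hE hα r3.lists hρ (by norm_num) (by norm_num) (by norm_num) (by norm_num)
      (fun v hv => ?_) fun τ hF h v hv => by rw [h v hv, hns]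
    rw [hns]; have := hAle v hv; omega
  intro σ4 hF4 h11
  have r4 : Ready n α σ4 := r3.fr hF4 (by decide) (by decide)
  have h74 : ∀ v < n, σ4.a 7 v = ind W v := fun v hv => by rw [hF4.a 7 (by decide), h73 v hv]
  refine wp_seq (P := fun τ => ∀ v < n, τ.a 11 v = ind W v * A v)
    (wp_map hE (by norm_num) _ (fun i hi τ hF hτ h => ?_) fun τ _ h => h) ?_
  · have hv : (Ex.mul (arr 7 (var 0)) (arr 11 (var 0))).eval n τ = ind W i * A i := by
      simp only [Ex.eval, hτ, hF.a 7 (by decide), h74 i hi, h, h11 i hi]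
    refine ⟨⟨⟨by omega, trivial, by simpa [Ex.eval, hτ] using hi⟩, ⟨by omega, trivial,
      by simpa [Ex.eval, hτ] using hi⟩, ?_⟩, hv⟩
    simp only [Ex.eval] at hv
    simp only [Ex.eval]
    rw [hv]
    refine lt_of_le_of_lt (Nat.mul_le_mul (ind_le W i) (hAle i hi)) ?_
    omega
  intro σ5 hF5 h11'
  have r5 : Ready n α σ5 := r4.fr hF5 (by decide) (by decide)
  have h95 : ∀ v < n, σ5.a 9 v = ind W v * shF (n ^ 8) (dg α W v) := fun v hv => by
    rw [hF5.a 9 (by decide), hF4.a 9 (by decide), h93 v hv]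
  refine wp_seq (P := fun τ => ∀ v < n, τ.a 12 v = ∑ w ∈ W, α v w * A w) ?_ ?_
  · refine nbrSum_spec hE hα r5.lists hρ (by norm_num) (by norm_num) (by norm_num) (by norm_num)
      (fun v hv => ?_) fun τ hF h v hv => by rw [h v hv, nsum_ind hW v h11']
    refine lt_of_le_of_lt (nsum_le hα (M := n ^ 9) fun u hu => ?_) (by omega)
    rw [h11' u hu]
    have := Nat.mul_le_mul (ind_le W u) (hAle u hu)
    omega
  intro σ6 hF6 h12
  have r6 : Ready n α σ6 := r5.fr hF6 (by decide) (by decide)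
  have h96 : ∀ v < n, σ6.a 9 v = ind W v * shF (n ^ 8) (dg α W v) := fun v hv => by
    rw [hF6.a 9 (by decide), h95 v hv]
  refine nbrSum_spec hE hα r6.lists hρ (by norm_num) (by norm_num) (by norm_num) (by norm_num)
      (fun v hv => ?_) fun τ hF h v hv => ?_
  · refine lt_of_le_of_lt (nsum_le hα (M := n ^ 8) fun u hu => ?_) (by omega)
    rw [h96 u hu]
    have := Nat.mul_le_mul (ind_le W u) (shF_le_scale hn (hd u hu).le)
    omega
  · have hvn : v < n := by simpa using hW hv
    have hiv : ind W v = 1 := by simp [ind, hv]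
    refine ⟨?_, ?_, ?_, ?_, ?_⟩
    · rw [hF.a 8 (by decide), hF6.a 8 (by decide), hF5.a 8 (by decide), hF4.a 8 (by decide),
        h83 v hvn]
    · rw [hF.a 9 (by decide), h96 v hvn, hiv, one_mul]
    · rw [hF.a 10 (by decide), hF6.a 10 (by decide), hF5.a 10 (by decide), hF4.a 10 (by decide),
        h10 v hvn, hiv, one_mul]
    · rw [hF.a 12 (by decide), h12 v hvn]
    · rw [h v hvn, nsum_ind hW v h96]

/-- One round: move a vertex that passes the test to the independent set in array `14`, and remove
its closed neighbourhood from the remaining vertices. -/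
def progRound : Cmd :=
  seq progTest (seq (asg 3 len) (seq
    (forn 0 (ite (lit 0) (arr 7 (var 0))
      (ite (.add (var 11) (arr 12 (var 0)))
        (.add (arr 9 (var 0)) (.add (.mul (arr 8 (var 0)) (arr 10 (var 0))) (arr 13 (var 0))))
        skip (asg 3 (var 0))) skip)) (seq
    (put 14 (var 3) (lit 1)) (seq
    (Cmd.map 0 7 (.sub (arr 7 (var 0)) (mat 0 (var 3) (var 0)))) (seq
    (put 7 (var 3) (lit 0)) (asg 13 (.add (var 13) (lit 1))))))))

/-- The search succeeds by `exists_greedy_vertex`. -/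
theorem progRound_spec (hE : Env n B ρ) (hα : TriFree n α) {σ : St} (hr : Ready n α σ)
    (hρ : ∀ v < n, deg n α v ≤ ρ 1) {W : Finset ℕ} (hW : W ⊆ range n) (hne : W.Nonempty)
    (h7 : ∀ v < n, σ.a 7 v = ind W v) (h13 : σ.v 13 < n) :
    progRound.wp n B ρ (fun τ => ∃ v ∈ W,
      shF (n ^ 8) (dg α W v) + dg α W v * shG (n ^ 8) (dg α W v)
        + ∑ w ∈ W, α v w * shF (n ^ 8) (dg α W w)
        ≤ n ^ 8 + ∑ w ∈ W, α v w * ∑ u ∈ W, α w u * shG (n ^ 8) (dg α W u) ∧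
      (∀ u < n, τ.a 7 u = ind (W.filter fun u => u ≠ v ∧ α v u = 0) u) ∧
      (∀ u, τ.a 14 u = if u = v then 1 else σ.a 14 u) ∧ τ.v 13 = σ.v 13 + 1) σ := by
  have hB := hE.lt
  have hn := hE.four
  have p11 := hE.pow_lt (k := 11) (by norm_num)
  have e11 : 4 * n ^ 10 ≤ n ^ 11 := by
    rw [show n ^ 11 = n * n ^ 10 by ring]; exact Nat.mul_le_mul_right _ hn
  have e8 : n ^ 8 ≤ n ^ 10 := Nat.pow_le_pow_right (by omega) (by norm_num)
  have e9 : n ^ 9 ≤ n ^ 10 := Nat.pow_le_pow_right (by omega) (by norm_num)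
  have hsum : ∀ v (φ : ℕ → ℕ) M, (∀ u ∈ W, φ u ≤ M) → ∑ u ∈ W, α v u * φ u ≤ n * M := by
    intro v φ M hφ
    rw [← nsum_ind hW v (g := fun u => ind W u * φ u) fun _ _ => rfl]
    refine nsum_le hα fun u _ => ?_
    by_cases hu : u ∈ W
    · simpa [ind, hu] using hφ u hu
    · simp [ind, hu]
  have hd := fun v (hv : v ∈ W) => dg_lt hα hW hv
  have hF8 := fun v (hv : v ∈ W) => shF_le_scale hn (hd v hv).le
  have hG8 := fun v (hv : v ∈ W) => shG_le_scale hn (hd v hv).le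
  have hW' : ∀ v ∈ W, v < n := fun v hv => by simpa using hW hv
  refine wp_seq (progTest_spec hE hα hr hρ hW h7) ?_
  intro σ1 hF1 h1
  have r1 : Ready n α σ1 := hr.fr hF1 (by decide) (by decide)
  have h71 : ∀ v < n, σ1.a 7 v = ind W v := fun v hv => by rw [hF1.a 7 (by decide), h7 v hv]
  set good : ℕ → Prop := fun v => shF (n ^ 8) (dg α W v) + dg α W v * shG (n ^ 8) (dg α W v)
        + ∑ w ∈ W, α v w * shF (n ^ 8) (dg α W w)
        ≤ n ^ 8 + ∑ w ∈ W, α v w * ∑ u ∈ W, α w u * shG (n ^ 8) (dg α W u) with hgood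
  refine ⟨trivial, ?_⟩
  refine wp_seq (P := fun τ => τ.v 3 ∈ W ∧ good (τ.v 3)) ?_ ?_
  · refine wp_forn hE (by decide) (fun i τ => (τ.v 3 ∈ W ∧ good (τ.v 3)) ∨
      (τ.v 3 = n ∧ ∀ v < i, v ∈ W → ¬ good v)) ?_ ?_ ?_
    · exact .inr ⟨by simp [Ex.eval], fun v hv => by omega⟩
    · intro i hi τ hτ hF hI
      have ea : τ.a = σ1.a := by funext j; rw [hF.a j (by simp [forn, forTo, modA])]; rfl
      have e11' : τ.v 11 = n ^ 8 := by rw [hF.v 11 (by decide)]; simpa using r1.scale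
      have hok : ∀ j < 32, (arr j (var 0)).ok n B τ := fun j hj =>
        ⟨hj, trivial, by simpa [Ex.eval, hτ] using hi⟩
      refine ⟨by simp [Ex.ok], hok 7 (by norm_num), fun hlt => ?_, fun hlt => ?_⟩
      · have hiW : i ∈ W := by
          simp only [Ex.eval, hτ, ea, h71 i hi, ind] at hlt
          by_contra h; simp [h] at hlt
        obtain ⟨q8, q9, q10, q12, q13⟩ := h1 i hiW
        have b12 : σ1.a 12 i ≤ n ^ 10 := by
          rw [q12, show n ^ 10 = n * (n * n ^ 8) by ring]
          exact hsum _ _ _ fun w _ => hsum _ _ _ fun u hu => hG8 u hu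
        have b13 : σ1.a 13 i ≤ n ^ 9 := by
          rw [q13, show n ^ 9 = n * n ^ 8 by ring]
          exact hsum _ _ _ fun u hu => hF8 u hu
        have b9 := hF8 i hiW
        have b810 : dg α W i * shG (n ^ 8) (dg α W i) ≤ n ^ 9 := by
          rw [show n ^ 9 = n * n ^ 8 by ring]
          exact Nat.mul_le_mul (hd i hiW).le (hG8 i hiW)
        refine ⟨⟨trivial, hok 12 (by norm_num), ?_⟩, ⟨hok 9 (by norm_num), ⟨⟨hok 8 (by norm_num),
          hok 10 (by norm_num), ?_⟩, hok 13 (by norm_num), ?_⟩, ?_⟩, fun hlt' => ?_, fun hlt' => ?_⟩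
        · simp only [Ex.eval, hτ, ea, e11']; omega
        · simp only [Ex.eval, hτ, ea, q8, q10]; omega
        · simp only [Ex.eval, hτ, ea, q8, q10]; omega
        · simp only [Ex.eval, hτ, ea, q8, q9, q10]; omega
        · have hng : ¬ good i := by
            simp only [Ex.eval, hτ, ea, e11', q8, q9, q10, q12, q13] at hlt'
            simp only [hgood]; omega
          rcases hI with h | ⟨h, h'⟩
          · exact .inl (by simpa using h)
          · refine .inr ⟨by simpa using h, fun v hv hvW => ?_⟩
            rcases Nat.lt_succ_iff_lt_or_eq.1 hv with h3 | rfl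
            · exact h' v h3 hvW
            · exact hng
        · have hg : good i := by
            simp only [Ex.eval, hτ, ea, e11', q8, q9, q10, q12, q13] at hlt'
            simp only [hgood]; omega
          exact ⟨trivial, .inl (by simpa [Ex.eval, hτ] using ⟨hiW, hg⟩)⟩
      · have hiW : i ∉ W := by
          simp only [Ex.eval, hτ, ea, h71 i hi, ind] at hlt
          intro h; simp [h] at hlt
        rcases hI with h | ⟨h, h'⟩
        · exact .inl (by simpa using h)
        · refine .inr ⟨by simpa using h, fun v hv hvW => ?_⟩
          rcases Nat.lt_succ_iff_lt_or_eq.1 hv with h3 | rfl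
          · exact h' v h3 hvW
          · exact absurd hvW hiW
    · rintro τ - - (h | ⟨-, h⟩)
      · exact h
      · obtain ⟨v, hv, hg⟩ := exists_greedy_vertex hα (scale_ge hn) hW hne
        exact absurd hg (h v (hW' v hv) hv)
  rintro σ2 hF2 ⟨h3W, h3g⟩
  have h3 := hW' _ h3W
  have em2 : σ2.m 0 = α := by
    rw [hF2.m 0 (by decide)]; simpa using r1.lists.adj
  have h72 : ∀ v < n, σ2.a 7 v = ind W v := fun v hv => by
    rw [hF2.a 7 (by decide)]; simpa using h71 v hv
  have h14 : σ2.a 14 = σ.a 14 := by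
    rw [hF2.a 14 (by decide)]; simpa using hF1.a 14 (by decide)
  have e13 : σ2.v 13 = σ.v 13 := by
    rw [hF2.v 13 (by decide)]; simpa using hF1.v 13 (by decide)
  refine ⟨by norm_num, trivial, by simp [Ex.ok], by simpa [Ex.eval] using h3, ?_⟩
  refine wp_map hE (by norm_num) (fun u => ind W u - α (σ2.v 3) u) (fun i hi τ hF hτ h => ?_) ?_
  · have e3 : τ.v 3 = σ2.v 3 := by rw [hF.v 3 (by decide)]; rfl
    have em : τ.m 0 = α := by rw [hF.m 0 (by decide)]; exact em2
    refine ⟨⟨⟨by omega, trivial, by simpa [Ex.eval, hτ] using hi⟩, by omega, trivial, trivial,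
      by simpa [Ex.eval, e3] using h3, by simpa [Ex.eval, hτ] using hi⟩, ?_⟩
    simp [Ex.eval, hτ, e3, em, h, h72 i hi]
  intro σ3 hF3 h73
  have e3 : σ3.v 3 = σ2.v 3 := by rw [hF3.v 3 (by decide)]; rfl
  have e13' : σ3.v 13 = σ.v 13 := by rw [hF3.v 13 (by decide), ← e13]; rfl
  refine ⟨by norm_num, trivial, by simp [Ex.ok], by simpa [Ex.eval, e3] using h3, ?_⟩
  refine ⟨⟨trivial, by simp [Ex.ok], by simp only [Ex.eval, St.seta_v, e13']; omega⟩, σ2.v 3,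
    h3W, h3g, fun u hu => ?_, fun u => ?_, by simp [Ex.eval, e13']⟩
  · by_cases huv : u = σ2.v 3
    · simp [Ex.eval, e3, huv, ind]
    · have := hα.le_one (σ2.v 3) u
      simp only [Ex.eval, e3, St.setv_a, St.seta_a, if_true, Function.update_apply, huv, if_false,
        h73 u hu, ind, Finset.mem_filter, ne_eq, not_false_eq_true, true_and]
      by_cases h0 : α (σ2.v 3) u = 0
      · simp [h0]
      · have h1 : α (σ2.v 3) u = 1 := by omega
        simp only [h1]; split <;> simp
  · have : σ3.a 14 u = if u = σ2.v 3 then 1 else σ.a 14 u := by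
      rw [hF3.a 14 (by decide)]
      simp [Ex.eval, Function.update_apply, h14]
    simpa [Ex.eval] using this

/-- The greedy algorithm, stopped as soon as the independent set has the guaranteed size. -/
def progGreedy : Cmd :=
  seq (Cmd.map 0 7 (arr 4 (var 0))) (seq (Cmd.map 0 14 (lit 0)) (seq (asg 13 (lit 0))
    (loop 2 (.mul (var 13) (var 11)) (.mul (var 12) (arr 5 (var 10))) progRound)))

/-- Each round costs at most the scale `n ^ 8` of the total weight by `weight_greedy_step`, so the
remaining set is nonempty as long as fewer vertices are chosen than the weight of `T` allows. All
degrees are at most the value of variable `10`, and the weights decrease in the degree. -/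
theorem progGreedy_spec (hE : Env n B ρ) (hα : TriFree n α) {σ : St} (hr : Ready n α σ)
    (hρ : ∀ v < n, deg n α v ≤ ρ 1) {T : Finset ℕ} (hT : T ⊆ range n)
    (h4 : ∀ v < n, σ.a 4 v = ind T v) (h12 : σ.v 12 = T.card)
    (h10 : ∀ v < n, deg n α v ≤ σ.v 10) (h10' : σ.v 10 < n)
    (hρ2 : ∀ i, i * n ^ 8 < n * shF (n ^ 8) (σ.v 10) → i < ρ 2) :
    progGreedy.wp n B ρ (fun τ => ∃ I ⊆ T, (∀ v < n, τ.a 14 v = ind I v) ∧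
      (∀ a ∈ I, ∀ b ∈ I, α a b = 0) ∧ T.card * shF (n ^ 8) (σ.v 10) ≤ I.card * n ^ 8) σ := by
  have hB := hE.lt
  have hn := hE.four
  have p9 := hE.pow_lt (k := 9) (by norm_num)
  have e9 : n * n ^ 8 = n ^ 9 := by ring
  have hTn : T.card ≤ n := by simpa using Finset.card_le_card hT
  refine wp_seq (P := fun τ => ∀ v < n, τ.a 7 v = ind T v)
    (wp_map hE (by norm_num) _ (fun i hi τ hF hτ _ => ⟨⟨by omega, trivial,
      by simpa [Ex.eval, hτ] using hi⟩, by simp [Ex.eval, hτ, hF.a 4, h4 i hi]⟩) fun τ _ h => h) ?_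
  intro σ1 hF1 h7
  refine wp_seq (P := fun τ => ∀ v < n, τ.a 14 v = 0)
    (wp_map hE (by norm_num) (fun _ => 0) (fun _ _ _ _ _ _ => ⟨by simp [Ex.ok], rfl⟩)
      fun τ _ h => h) ?_
  intro σ2 hF2 h14
  refine ⟨by simp [Ex.ok], ?_⟩
  set σ3 := σ2.setv 13 (eval n σ2 (lit 0)) with hσ3
  have hF3 : Fr [0, 13] [7, 14] [] σ σ3 := by
    refine ((hF1.mono (V' := [0, 13]) (A' := [7, 14]) (M' := []) (by decide) (by decide)
      (by decide)).trans (hF2.mono (by decide) (by decide) (by decide))).trans ?_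
    refine ⟨fun x hx => ?_, fun _ _ => rfl, fun _ _ => rfl⟩
    have : x ≠ 13 := by rintro rfl; exact hx (by decide)
    simp [hσ3, this]
  set V := [0, 13] ++ progRound.modV with hV
  set A := [7, 14] ++ progRound.modA with hA
  have hF3' : Fr V A [] σ σ3 := hF3.mono (by simp [hV]) (by simp [hA]) (by decide)
  refine ⟨fun i τ => Fr V A [] σ τ ∧ τ.v 13 = i ∧ ∃ W I : Finset ℕ, W ⊆ T ∧ I ⊆ T ∧
    (∀ v < n, τ.a 7 v = ind W v) ∧ (∀ v < n, τ.a 14 v = ind I v) ∧ I.card = i ∧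
    (∀ a ∈ I, ∀ b ∈ I, α a b = 0) ∧ (∀ a ∈ I, ∀ b ∈ W, α a b = 0 ∧ a ≠ b) ∧
    ∑ u ∈ T, shF (n ^ 8) (dg α T u) ≤ i * n ^ 8 + ∑ u ∈ W, shF (n ^ 8) (dg α W u), ?_, ?_⟩
  · refine ⟨hF3', by simp [hσ3, Ex.eval], T, ∅, Finset.Subset.refl _, by simp, fun v hv => ?_,
      fun v hv => ?_, by simp, by simp, by simp, by simp⟩
    · rw [hσ3, St.setv_a, hF2.a 7 (by decide), h7 v hv]
    · rw [hσ3, St.setv_a, h14 v hv]; simp [ind]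
  · rintro i τ ⟨hF, h13, W, I, hWT, hIT, h7, h14, hI, hII, hIW, hpot⟩
    have hrτ : Ready n α τ := hr.fr hF (by decide) (by decide)
    have e10 : τ.v 10 = σ.v 10 := hF.v 10 (by decide)
    have e12 : τ.v 12 = T.card := by rw [hF.v 12 (by decide), h12]
    have e5 := hrτ.tabF _ h10'
    have hF8 := shF_le_scale hn h10'.le
    have hin : i ≤ n := hI ▸ (Finset.card_le_card hIT).trans hTn
    have hle1 : i * n ^ 8 ≤ n * n ^ 8 := Nat.mul_le_mul_right _ hin
    have hle2 : T.card * shF (n ^ 8) (σ.v 10) ≤ n * n ^ 8 := Nat.mul_le_mul hTn hF8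
    refine ⟨⟨trivial, trivial, by simp only [Ex.eval, h13, hrτ.scale]; omega⟩, ⟨trivial,
      ⟨by norm_num, trivial, by simpa [Ex.eval, e10] using h10'⟩, ?_⟩, fun hlt => ?_, fun hlt => ?_⟩
    · simp only [Ex.eval, e12, e5, e10]; omega
    · simp only [Ex.eval, h13, hrτ.scale, e12, e5, e10] at hlt
      have hi2 : i < ρ 2 := hρ2 i (lt_of_lt_of_le hlt (Nat.mul_le_mul_right _ hTn))
      have hdT : ∀ u ∈ T, shF (n ^ 8) (σ.v 10) ≤ shF (n ^ 8) (dg α T u) := fun u hu => by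
        refine shF_anti (D := n) (scale_ge_sq hn) ?_ (by omega)
        exact (Finset.sum_le_sum_of_subset hT).trans (h10 u (by simpa using hT hu))
      have hne : W.Nonempty := by
        rw [Finset.nonempty_iff_ne_empty]
        rintro rfl
        have := Finset.card_nsmul_le_sum T _ _ hdT
        simp only [smul_eq_mul, Finset.sum_empty, add_zero] at this hpot
        omega
      have hin' : i < n := by
        have : i * n ^ 8 < n * n ^ 8 := by omega
        exact lt_of_mul_lt_mul_right this (Nat.zero_le _)
      refine ⟨hi2, Cmd.wp_of (progRound_spec hE hα hrτ hρ (hWT.trans hT) hne h7 (by omega)) ?_⟩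
      rintro υ hFυ ⟨v, hvW, hg, h7', h14', h13'⟩
      have hvI : v ∉ I := fun hv => (hIW v hv v hvW).2 rfl
      refine ⟨hF.trans (hFυ.mono (by simp [hV]) (by simp [hA]) (by decide)), by omega,
        W.filter (fun u => u ≠ v ∧ α v u = 0), insert v I, (Finset.filter_subset _ _).trans hWT,
        Finset.insert_subset (hWT hvW) hIT, h7', fun u hu => ?_, ?_, ?_, ?_, ?_⟩
      · rw [h14' u, h14 u hu]
        by_cases huv : u = v <;> simp [ind, huv]
      · rw [Finset.card_insert_of_notMem hvI, hI]
      · intro a ha b hb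
        rcases Finset.mem_insert.1 ha with rfl | ha' <;>
          rcases Finset.mem_insert.1 hb with rfl | hb'
        · exact hα.irrefl _
        · rw [hα.symm]; exact (hIW b hb' a hvW).1
        · exact (hIW a ha' b hvW).1
        · exact hII a ha' b hb'
      · intro a ha b hb
        obtain ⟨hbW, hbv, hb0⟩ := Finset.mem_filter.1 hb
        rcases Finset.mem_insert.1 ha with rfl | ha
        · exact ⟨hb0, Ne.symm hbv⟩
        · exact hIW a ha b hbW
      · have := weight_greedy_step hα (scale_ge hn) (hWT.trans hT) hvW hg
        rw [add_mul, one_mul]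
        omega
    · simp only [Ex.eval, h13, hrτ.scale, e12, e5, e10] at hlt
      exact ⟨I, hIT, h14, hII, by rw [hI]; omega⟩

end

variable {n B : ℕ} {ρ : ℕ → ℕ} {G : SimpleGraph (Fin n)}

/-! ### Graphs on `{0, …, n - 1}` and their representation -/

open Classical in
/-- Adjacency matrix of a graph on `{0, …, n - 1}`, extended by `0`. -/
noncomputable def adjMat (G : SimpleGraph (Fin n)) (i j : ℕ) : ℕ :=
  if ∃ u v : Fin n, (u : ℕ) = i ∧ (v : ℕ) = j ∧ G.Adj u v then 1 else 0

theorem adjMat_eq_one {u v : Fin n} (h : G.Adj u v) : adjMat G u v = 1 :=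
  if_pos ⟨u, v, rfl, rfl, h⟩

theorem adjMat_eq_zero {u v : Fin n} (h : ¬ G.Adj u v) : adjMat G u v = 0 := by
  refine if_neg ?_
  rintro ⟨u', v', h1, h2, h3⟩
  obtain rfl := Fin.ext h1
  obtain rfl := Fin.ext h2
  exact h h3

theorem adjMat_pos {u v : Fin n} : 0 < adjMat G u v ↔ G.Adj u v := by
  by_cases h : G.Adj u v
  · simp [h, adjMat_eq_one h]
  · simp [h, adjMat_eq_zero h]

theorem adjMat_triFree (h : ∀ a b c, G.Adj a b → G.Adj b c → ¬ G.Adj a c) :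
    TriFree n (adjMat G) where
  le_one i j := by unfold adjMat; split <;> simp
  symm i j := by
    unfold adjMat
    congr 1
    exact propext ⟨fun ⟨u, v, h1, h2, h3⟩ => ⟨v, u, h2, h1, h3.symm⟩,
      fun ⟨u, v, h1, h2, h3⟩ => ⟨v, u, h2, h1, h3.symm⟩⟩
  irrefl i := by
    refine if_neg ?_
    rintro ⟨u, v, h1, h2, h3⟩
    exact h3.ne (Fin.ext (h1.trans h2.symm))
  tri i j k h1 h2 := by
    have h1 : ∃ u v : Fin n, (u : ℕ) = i ∧ (v : ℕ) = j ∧ G.Adj u v := by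
      by_contra hc; rw [adjMat, if_neg hc] at h1; omega
    have h2 : ∃ u v : Fin n, (u : ℕ) = j ∧ (v : ℕ) = k ∧ G.Adj u v := by
      by_contra hc; rw [adjMat, if_neg hc] at h2; omega
    obtain ⟨u, v, rfl, rfl, h3⟩ := h1
    obtain ⟨v', w, h4, rfl, h5⟩ := h2
    obtain rfl := Fin.ext h4
    exact adjMat_eq_zero (h u _ w h3 h5)

/-- Array `j` holds the characteristic vector of `X`. -/
def Holds (σ : St) (j : ℕ) (X : Finset (Fin n)) : Prop :=
  ∀ v : Fin n, σ.a j v = if v ∈ X then 1 else 0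

theorem Holds.pos {σ : St} {j : ℕ} {X : Finset (Fin n)} (h : Holds σ j X) (v : Fin n) :
    0 < σ.a j v ↔ v ∈ X := by
  rw [h v]; split <;> simp [*]

theorem Holds.congr {σ τ : St} {j j' : ℕ} {X : Finset (Fin n)} (h : Holds σ j X)
    (he : ∀ v : Fin n, τ.a j' v = σ.a j v) : Holds τ j' X := fun v => by rw [he v, h v]

theorem Holds.le_one {σ : St} {j : ℕ} {X : Finset (Fin n)} (h : Holds σ j X) (v : Fin n) :
    σ.a j v ≤ 1 := by rw [h v]; split <;> simp

theorem nsum_fin (v : ℕ) (g : ℕ → ℕ) :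
    nsum n (adjMat G) v g = ∑ w : Fin n, adjMat G v w * g w := by
  rw [nsum, Finset.sum_range]

/-- `if e₁ < f₁ and e₂ < f₂ and … then C` -/
def Cmd.guard : List (Ex × Ex) → Cmd → Cmd
  | [], C => C
  | p :: l, C => ite p.1 p.2 (guard l C) skip

theorem wp_guard {l : List (Ex × Ex)} {C : Cmd} {Q : St → Prop} {σ : St}
    (hok : ∀ p ∈ l, p.1.ok n B σ ∧ p.2.ok n B σ)
    (hC : (∀ p ∈ l, p.1.eval n σ < p.2.eval n σ) → C.wp n B ρ Q σ)
    (hs : (¬ ∀ p ∈ l, p.1.eval n σ < p.2.eval n σ) → Q σ) : (Cmd.guard l C).wp n B ρ Q σ := by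
  induction l with
  | nil => exact hC (by simp)
  | cons p l ih =>
    have hp := hok p (by simp)
    refine ⟨hp.1, hp.2, fun hlt => ih (fun q hq => hok q (by simp [hq])) (fun h => hC ?_)
      (fun h => hs ?_), fun hlt => hs ?_⟩
    · simpa [hlt] using h
    · intro h'; exact h fun q hq => h' q (by simp [hq])
    · intro h'; exact hlt (h' p (by simp))

/-! ### Exchanging supports for leaves -/

/-- If exactly one entry of the list of `v` is used, it is the only neighbour of `v`. -/
theorem Lists.leafAt {σ : St} (hL : Lists n (adjMat G) σ) {v : Fin n}
    (hv : IdCode.deg n (adjMat G) v = 1) : ∃ u : Fin n, σ.m 1 v 0 = u ∧ LeafAt G v u := by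
  have hr := hL.row v v.2
  rw [hL.deg v.2, hv] at hr
  refine ⟨⟨_, hr.lt 0 (by omega)⟩, rfl, fun w => ?_⟩
  have hs := hr.sum fun i => if i = w then 1 else 0
  simp only [Finset.sum_range_one, mul_ite, mul_one, mul_zero, Finset.sum_ite_eq',
    Finset.mem_range, w.2, if_true] at hs
  rw [← adjMat_pos, ← hs, Fin.ext_iff]
  constructor
  · intro h; by_contra h'; rw [if_neg fun e => h' e.symm] at h; omega
  · intro h; rw [if_pos h.symm]; omega

theorem deg_pos (h : Host G) (v : Fin n) : 0 < deg n (adjMat G) v := by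
  obtain ⟨u, hu⟩ := h.exists_adj v
  rw [deg]
  have := Finset.single_le_sum (f := fun i => adjMat G v i) (fun _ _ => Nat.zero_le _)
    (Finset.mem_range.2 u.2)
  simp only [adjMat_eq_one hu] at this
  omega

theorem LeafAt.deg {v u : Fin n} (h : LeafAt G v u) : IdCode.deg n (adjMat G) v = 1 := by
  rw [IdCode.deg, Finset.sum_range, Finset.sum_eq_single u]
  · exact adjMat_eq_one ((h u).2 rfl)
  · exact fun w _ hw => adjMat_eq_zero fun hadj => hw ((h w).1 hadj)
  · simp

/-- In array `14`, exchange the neighbours of leaves without twins for these leaves. -/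
def progSwap : Cmd :=
  forn 0 (guard [(arr 0 (var 0), lit 2), (lit 0, arr 4 (var 0))]
    (seq (asg 1 (mat 1 (var 0) (lit 0))) (seq (put 14 (var 1) (lit 0)) (put 14 (var 0) (lit 1)))))

/-- The set obtained has the shape required by `Base.of_swap`. Two leaves without twins have
different supports and are not adjacent to each other, so the order of the exchanges does not
matter. -/
theorem progSwap_spec (hE : Env n B ρ) (h : Host G) {σ : St} (hL : Lists n (adjMat G) σ)
    {T I : Finset (Fin n)} (hT : Holds σ 4 T) (hI : Holds σ 14 I) :
    progSwap.wp n B ρ (fun τ => ∃ J : Finset (Fin n), Holds τ 14 J ∧ ∀ v, v ∈ J ↔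
      ((∃ u, LeafAt G v u) ∧ v ∈ T) ∨ (v ∈ I ∧ ∀ i, (∃ u, LeafAt G i u) ∧ i ∈ T → ¬ G.Adj i v))
      σ := by
  classical
  have hn := hE.four
  refine wp_forn hE (by decide) (fun i τ => ∃ J : Finset (Fin n), Holds τ 14 J ∧ ∀ v, v ∈ J ↔
      (((∃ u, LeafAt G v u) ∧ v ∈ T) ∧ (v : ℕ) < i) ∨
      (v ∈ I ∧ ∀ k : Fin n, (∃ u, LeafAt G k u) ∧ k ∈ T → (k : ℕ) < i → ¬ G.Adj k v)) ?_ ?_ ?_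
  · exact ⟨I, hI, by simp⟩
  · rintro i hi τ hτ hF ⟨J, hJ, hJ'⟩
    have hLτ := hL.fr (V := [0, 1]) (A := [14]) (τ := τ) (hF.mono (by decide) (by decide)
      (by decide)) (by decide)
    have e4 : τ.a 4 = σ.a 4 := hF.a 4 (by decide)
    set v : Fin n := ⟨i, hi⟩ with hv
    have hd := hLτ.deg v.2
    have hsucc : ∀ k : Fin n, (k : ℕ) < i + 1 ↔ (k : ℕ) < i ∨ k = v := fun k => by
      rw [Fin.ext_iff]; exact Nat.lt_succ_iff_lt_or_eq
    have hT' : 0 < τ.a 4 i ↔ v ∈ T := by rw [e4]; exact hT.pos v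
    have hpos := deg_pos h v
    refine wp_guard ?_ ?_ ?_
    · simp [Ex.ok, Ex.eval, hτ, hi]
    · intro hg
      simp only [List.mem_cons, List.not_mem_nil, or_false, forall_eq_or_imp, forall_eq, Ex.eval,
        hτ, hT'] at hg
      have hg1 : τ.a 0 i = deg n (adjMat G) v := hd
      obtain ⟨u, hu, hl⟩ := hLτ.leafAt (v := v) (by omega)
      have hu' : τ.m 1 i 0 = u := hu
      have huv : u ≠ v := fun e => ((hl u).2 rfl).ne e.symm
      have hul : ¬ ∃ u', LeafAt G u u' := by
        rintro ⟨u', hl'⟩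
        obtain rfl := (hl' v).1 ((hl u).2 rfl).symm
        obtain ⟨z, ⟨h1, h2⟩ | ⟨h1, h2⟩⟩ := h.edge v u
        · exact h2 ((hl z).1 h1)
        · exact h2 ((hl' z).1 h1)
      refine ⟨by simp [Ex.ok, Ex.eval, hτ, hi]; omega, ?_⟩
      refine ⟨by omega, trivial, by simp [Ex.ok], by simp [Ex.eval, hτ, hu'], ?_⟩
      refine ⟨by omega, trivial, by simp [Ex.ok], by simp [Ex.eval, hτ, hi], ?_⟩
      refine ⟨insert v (J.erase u), fun w => ?_, fun w => ?_⟩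
      · have e1 : ((w : ℕ) = i) = (w = v) := by rw [Fin.ext_iff]
        have e2 : ((w : ℕ) = u) = (w = u) := by rw [Fin.ext_iff]
        simp only [Ex.eval, hτ, hu', St.setv_a, St.seta_a, if_true, Function.update_apply,
          St.setv_v, St.seta_v, hJ w, e1, e2, Finset.mem_insert, Finset.mem_erase, Nat.zero_ne_one,
          if_false]
        by_cases h1 : w = v <;> by_cases h2 : w = u <;> simp [h1, h2]
      · rw [Finset.mem_insert, Finset.mem_erase, hJ']
        have hvL : (∃ u, LeafAt G v u) ∧ v ∈ T := ⟨⟨u, hl⟩, hg.2⟩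
        constructor
        · rintro (rfl | ⟨h1, h2 | h2⟩)
          · exact .inl ⟨hvL, by simp [hv]⟩
          · exact .inl ⟨h2.1, by omega⟩
          · refine .inr ⟨h2.1, fun k hk hki hkw => ?_⟩
            rcases (hsucc k).1 hki with h3 | rfl
            · exact h2.2 k hk h3 hkw
            · exact h1 ((hl w).1 hkw)
        · rintro (⟨h1, h2⟩ | ⟨h1, h2⟩)
          · rcases (hsucc w).1 h2 with h3 | rfl
            · exact .inr ⟨fun e => hul (e ▸ h1.1), .inl ⟨h1, h3⟩⟩
            · exact .inl rfl
          · refine .inr ⟨fun e => h2 v hvL (by simp [hv]) ((hl w).2 e), .inr ⟨h1, ?_⟩⟩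
            exact fun k hk hki => h2 k hk (by omega)
    · intro hg
      simp only [List.mem_cons, List.not_mem_nil, or_false, forall_eq_or_imp, forall_eq, Ex.eval,
        hτ, hT'] at hg
      have hng : ¬ ((∃ u, LeafAt G v u) ∧ v ∈ T) := by
        rintro ⟨⟨u, hl⟩, hvT⟩
        refine hg ⟨?_, hvT⟩
        have hg1 : τ.a 0 i = deg n (adjMat G) v := hd
        rw [hg1, hl.deg]; omega
      have hiff : ∀ k : Fin n, (∃ u, LeafAt G k u) ∧ k ∈ T → ((k : ℕ) < i + 1 ↔ (k : ℕ) < i) :=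
        fun k hk => by
          rw [hsucc]
          exact ⟨fun h => h.resolve_right fun e => hng (e ▸ hk), .inl⟩
      refine ⟨J, hJ, fun w => (hJ' w).trans ?_⟩
      refine or_congr (and_congr_right fun hw => (hiff w hw).symm) (and_congr_right fun _ => ?_)
      exact forall_congr' fun k => forall_congr' fun hk => by rw [hiff k hk]
  · rintro τ - - ⟨J, hJ, hJ'⟩
    exact ⟨J, hJ, fun v => by simpa using hJ' v⟩

/-! ### The processing order -/

/-- Position of `i` in the processing order: leaves come first. -/
noncomputable def pos (G : SimpleGraph (Fin n)) (i : ℕ) : ℕ :=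
  i + n * (1 - 2 / (deg n (adjMat G) i + 1))

/-- The key comparing the two directions of an edge `ij`: the sum of the positions of the
neighbours of `i` other than `j`, with ties broken by the number of `i`. -/
noncomputable def key (G : SimpleGraph (Fin n)) (i j : ℕ) : ℕ :=
  (nsum n (adjMat G) i (pos G) - pos G j) * n + i

theorem pos_of_leaf {i : ℕ} (h : deg n (adjMat G) i = 1) : pos G i = i := by simp [pos, h]

theorem pos_of_two_le {i : ℕ} (h : 2 ≤ deg n (adjMat G) i) : pos G i = i + n := by
  have : 2 / (deg n (adjMat G) i + 1) = 0 := Nat.div_eq_of_lt (by omega)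
  simp [pos, this]

theorem pos_lt {i : ℕ} (h : i < n) : pos G i < n + n := by
  have : n * (1 - 2 / (deg n (adjMat G) i + 1)) ≤ n * 1 := Nat.mul_le_mul_left _ (Nat.sub_le _ _)
  rw [pos]; omega

/-- The rule of the algorithm has the properties required for the repair: at a vertex with exactly
two neighbours, removing one of them from the sum of the positions leaves the position of the
other. -/
theorem keyFn (h : Host G) :
    KeyFn G (fun v : Fin n => pos G v) (fun a b : Fin n => key G a b) := by
  have two : ∀ v : Fin n, deg n (adjMat G) v = 1 ∨ 2 ≤ deg n (adjMat G) v := fun v => by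
    have := deg_pos h v; omega
  have hkey : ∀ v q x : Fin n, (∀ z, G.Adj v z ↔ z = q ∨ z = x) → x ≠ q →
      key G v q = pos G x * n + v := by
    intro v q x hN hne
    have : nsum n (adjMat G) v (pos G) = pos G q + pos G x := by
      rw [nsum_fin, ← Finset.sum_subset (Finset.subset_univ {q, x}), Finset.sum_pair hne.symm,
        adjMat_eq_one ((hN q).2 (.inl rfl)), adjMat_eq_one ((hN x).2 (.inr rfl)), one_mul, one_mul]
      intro z _ hz
      rw [adjMat_eq_zero fun hadj => hz (by simpa using (hN z).1 hadj), zero_mul]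
    rw [key, this, Nat.add_sub_cancel_left]
  refine ⟨fun a b hab => ?_, fun x q u hl hle => ?_, fun a b hab he => ?_,
    fun v q x x' hv hq h1 h2 hlt => ?_⟩
  · replace hab : pos G a = pos G b := hab
    apply Fin.ext
    have := a.2
    have := b.2
    rcases two a with h1 | h1 <;> rcases two b with h2 | h2
    · rwa [pos_of_leaf h1, pos_of_leaf h2] at hab
    · rw [pos_of_leaf h1, pos_of_two_le h2] at hab; omega
    · rw [pos_of_two_le h1, pos_of_leaf h2] at hab; omega
    · rw [pos_of_two_le h1, pos_of_two_le h2] at hab; omega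
  · simp only [pos_of_leaf hl.deg] at hle
    have := q.2
    have hx : deg n (adjMat G) x = 1 := by
      rcases two x with h1 | h1
      · exact h1
      · rw [pos_of_two_le h1] at hle; omega
    obtain ⟨y, hy⟩ := h.exists_adj x
    refine ⟨y, fun z => ⟨fun hz => ?_, fun e => e ▸ hy⟩⟩
    by_contra hne
    have : ∑ w ∈ ({y, z} : Finset (Fin n)), adjMat G x w ≤ ∑ w : Fin n, adjMat G x w :=
      Finset.sum_le_sum_of_subset (Finset.subset_univ _)
    rw [Finset.sum_pair (Ne.symm hne), adjMat_eq_one hy, adjMat_eq_one hz,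
      ← Finset.sum_range (n := n) (fun w => adjMat G x w)] at this
    rw [deg] at hx; omega
  · refine hab (Fin.ext ?_)
    have := congrArg (· % n) he
    simpa [key, Nat.add_mod, Nat.mod_eq_of_lt a.2, Nat.mod_eq_of_lt b.2] using this
  · rw [hkey v q x' hv h1, hkey q v x hq h2] at hlt
    by_contra! hc
    have h3 : (pos G x + 1) * n ≤ pos G x' * n := Nat.mul_le_mul_right _ hc
    have := q.2
    rw [add_mul, one_mul] at h3
    omega

/-- Array `20` becomes the processing order, array `21` its sums over neighbourhoods. -/
def progOrder : Cmd :=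
  seq (Cmd.map 0 20 (.add (var 0) (.mul len
    (.sub (lit 1) (.div (lit 2) (.add (arr 0 (var 0)) (lit 1))))))) (nbrSum 20 21)

theorem nsum_pos_le (hα : TriFree n (adjMat G)) (i : ℕ) :
    nsum n (adjMat G) i (pos G) ≤ n * (n + n) :=
  nsum_le hα fun _ hu => (pos_lt hu).le

theorem progOrder_spec (hE : Env n B ρ) (hα : TriFree n (adjMat G)) {σ : St}
    (hL : Lists n (adjMat G) σ) (hρ : ∀ v < n, deg n (adjMat G) v ≤ ρ 1) :
    progOrder.wp n B ρ (fun τ => ∀ v < n, τ.a 20 v = pos G v ∧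
      τ.a 21 v = nsum n (adjMat G) v (pos G)) σ := by
  have hB := hE.lt
  have hn := hE.four
  have p3 := hE.pow_lt (k := 3) (by norm_num)
  have e3 : n * (n + n) ≤ n ^ 3 := by
    rw [show n ^ 3 = n * (n * n) by ring]
    exact Nat.mul_le_mul_left _ (by nlinarith)
  refine wp_seq (P := fun τ => ∀ v < n, τ.a 20 v = pos G v)
    (wp_map hE (by norm_num) _ (fun i hi τ hF hτ _ => ?_) fun τ _ h => h) ?_
  · have hd : τ.a 0 i = deg n (adjMat G) i := by rw [hF.a 0 (by decide), hL.deg hi]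
    have hdn := deg_le hα i
    have hp := pos_lt (G := G) hi
    have hle : n * (1 - 2 / (deg n (adjMat G) i + 1)) ≤ n * 1 :=
      Nat.mul_le_mul_left _ (Nat.sub_le _ _)
    have hadd : i + n * (1 - 2 / (deg n (adjMat G) i + 1)) < n + n := hp
    refine ⟨?_, by simp [Ex.eval, hτ, hd, pos]⟩
    simp only [Ex.ok, Ex.eval, hτ, hd]
    refine ⟨trivial, ⟨trivial, ⟨by omega, by omega, ⟨by omega, trivial, hi⟩, by omega, by omega⟩,
      by omega⟩, by omega⟩
  intro σ1 hF1 h1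
  have hs : ∀ v, nsum n (adjMat G) v (σ1.a 20) = nsum n (adjMat G) v (pos G) :=
    fun v => nsum_congr h1
  refine nbrSum_spec hE hα (hL.fr (V := [0]) (A := [20])
    (hF1.mono (by decide) (by decide) (by decide)) (by decide)) hρ (by norm_num)
    (by norm_num) (by norm_num) (by norm_num) (fun v hv => ?_) fun τ hF h v hv => ⟨?_, ?_⟩
  · rw [hs]; have := nsum_pos_le hα v; omega
  · rw [hF.a 20 (by decide), h1 v hv]
  · rw [h v hv, hs]

/-! ### Repairing the bad edges -/

/-- Number of neighbours of `a` outside `X`. -/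
noncomputable def out (G : SimpleGraph (Fin n)) (X : Finset (Fin n)) (a : Fin n) : ℕ :=
  ∑ w : Fin n, adjMat G a w * if w ∈ X then 0 else 1

/-- The test for bad edges: `b` is the only neighbour of `a` that may lie outside `X`. -/
theorem out_lt_two_iff {X : Finset (Fin n)} {a b : Fin n} (h : G.Adj a b) :
    (out G X a + if b ∈ X then 1 else 0) < 2 ↔ ∀ z, G.Adj a z → z ≠ b → z ∈ X := by
  have h1 : ((adjMat G a b * if b ∈ X then 0 else 1) + if b ∈ X then 1 else 0) = 1 := by
    rw [adjMat_eq_one h]; split <;> rfl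
  rw [out, ← Finset.add_sum_erase _ _ (Finset.mem_univ b)]
  set s := ∑ w ∈ univ.erase b, adjMat G a w * if w ∈ X then 0 else 1 with hs
  have h2 : (((adjMat G a b * if b ∈ X then 0 else 1) + s) + if b ∈ X then 1 else 0) < 2 ↔
      s = 0 := by omega
  rw [h2, hs, Finset.sum_eq_zero_iff]
  refine forall_congr' fun z => ⟨fun hz h3 h4 => ?_, fun hz h3 => ?_⟩
  · have := hz (Finset.mem_erase.2 ⟨h4, Finset.mem_univ z⟩)
    rw [adjMat_eq_one h3] at this
    by_contra h5
    simp [h5] at this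
  · by_cases h4 : G.Adj a z
    · rw [if_pos (hz h4 (Finset.ne_of_mem_erase h3)), mul_zero]
    · rw [adjMat_eq_zero h4, zero_mul]

theorem out_le (hα : TriFree n (adjMat G)) (X : Finset (Fin n)) (a : Fin n) : out G X a ≤ n := by
  refine (Finset.sum_le_card_nsmul _ _ 1 fun w _ => ?_).trans (by simp)
  have := hα.le_one a w
  split <;> omega

theorem out_erase (hα : TriFree n (adjMat G)) {X : Finset (Fin n)} {w : Fin n} (hw : w ∈ X)
    (a : Fin n) : out G (X.erase w) a = out G X a + adjMat G w a := by
  rw [out, out, ← Finset.add_sum_erase _ _ (Finset.mem_univ w),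
    ← Finset.add_sum_erase univ (fun z : Fin n => adjMat G a z * if z ∈ X then 0 else 1)
      (Finset.mem_univ w), hα.symm w a]
  have : ∀ z ∈ univ.erase w, (adjMat G a z * if z ∈ X.erase w then 0 else 1)
      = adjMat G a z * if z ∈ X then 0 else 1 := fun z hz => by
    simp [Finset.mem_erase, Finset.ne_of_mem_erase hz]
  rw [Finset.sum_congr rfl this]
  simp [hw, add_comm]

/-- The data on which the repair of bad edges relies: adjacency lists, the independent set `I`,
and the processing order. -/
structure Setup (G : SimpleGraph (Fin n)) (I : Finset (Fin n)) (σ : St) : Prop where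
  lists : Lists n (adjMat G) σ
  set : Holds σ 14 I
  order : ∀ v < n, σ.a 20 v = pos G v ∧ σ.a 21 v = nsum n (adjMat G) v (pos G)

theorem Setup.fr {I : Finset (Fin n)} {V A : List ℕ} {σ τ : St} (h : Setup G I σ)
    (hF : Fr V A [] σ τ) (hA : 0 ∉ A ∧ 14 ∉ A ∧ 20 ∉ A ∧ 21 ∉ A) : Setup G I τ :=
  ⟨h.lists.fr hF hA.1, h.set.congr fun v => by rw [hF.a 14 hA.2.1], fun v hv => by
    rw [hF.a 20 hA.2.2.1, hF.a 21 hA.2.2.2]; exact h.order v hv⟩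

/-- The key of the pair of the vertices in the variables `x` and `y`. -/
def keyEx (x y : ℕ) : Ex := .add (.mul (.sub (arr 21 (var x)) (arr 20 (var y))) len) (var x)

theorem key_lt (hα : TriFree n (adjMat G)) (hn : 4 ≤ n) {i : ℕ} (hi : i < n) (j : ℕ) :
    key G i j < n ^ 4 := by
  have h1 : (nsum n (adjMat G) i (pos G) - pos G j) * n ≤ n * (n + n) * n :=
    Nat.mul_le_mul_right _ ((Nat.sub_le _ _).trans (nsum_pos_le hα i))
  have h2 : n * 1 ≤ n * (n * n) := Nat.mul_le_mul_left _ (by nlinarith)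
  have h3 : 4 * (n * (n * n)) ≤ n * (n * (n * n)) := Nat.mul_le_mul_right _ hn
  have e1 : n * (n + n) * n = 2 * (n * (n * n)) := by ring
  have e2 : n ^ 4 = n * (n * (n * n)) := by ring
  rw [key]
  omega

/-- Search for a vertex `b` such that `ab` is a bad edge to be repaired by deleting a neighbour of
`b`, where `a` is in variable `5`. The answer is in variable `6`, with `n` for failure. -/
def progFind : Cmd :=
  seq (asg 6 len) (forn 7 (guard
    [(lit 0, mat 0 (var 5) (var 7)), (arr 14 (var 7), lit 1),
      (.add (arr 19 (var 5)) (arr 15 (var 7)), lit 2),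
      (.add (arr 19 (var 7)) (arr 15 (var 5)), lit 2),
      (.mul (.sub (lit 1) (arr 14 (var 5))) (keyEx 5 7), .add (keyEx 7 5) (arr 14 (var 5)))]
    (asg 6 (var 7))))

theorem progFind_spec (hE : Env n B ρ) (hα : TriFree n (adjMat G)) {σ : St}
    {I X : Finset (Fin n)} (h : Setup G I σ) (hX : Holds σ 15 X)
    (hout : ∀ v : Fin n, σ.a 19 v = out G X v) {a : Fin n} (ha : σ.v 5 = a) :
    progFind.wp n B ρ (fun τ =>
      (τ.v 6 = n ∧ ∀ b, Dir I (fun a b : Fin n => key G a b) a b → ¬ Bad G X a b) ∨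
      ∃ b : Fin n, τ.v 6 = b ∧ Dir I (fun a b : Fin n => key G a b) a b ∧ Bad G X a b) σ := by
  have hB := hE.lt
  have hn := hE.four
  have p4 : 4 * n ^ 4 < B := by
    refine lt_of_le_of_lt ?_ (hE.pow_lt (k := 5) (by norm_num))
    rw [show n ^ 5 = n * n ^ 4 by ring]; exact Nat.mul_le_mul_right _ hn
  have n4 : n ≤ n ^ 4 := Nat.le_self_pow (by norm_num) n
  refine ⟨trivial, ?_⟩
  refine wp_forn hE (by decide) (fun i τ =>
      (τ.v 6 = n ∧ ∀ b : Fin n, (b : ℕ) < i →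
        Dir I (fun a b : Fin n => key G a b) a b → ¬ Bad G X a b) ∨
      ∃ b : Fin n, τ.v 6 = b ∧ Dir I (fun a b : Fin n => key G a b) a b ∧ Bad G X a b) ?_ ?_ ?_
  · exact .inl ⟨by simp [Ex.eval], fun b hb => by omega⟩
  · rintro i hi τ hτ hF hI
    have hF' : Fr [6, 7] [] [] σ τ := (Fr.trans (τ := σ.setv 6 (eval n σ len))
      ⟨fun z hz => by
        have : z ≠ 6 := by rintro rfl; simp at hz
        simp [this], fun _ _ => rfl, fun _ _ => rfl⟩
      (hF.mono (by decide) (by decide) (by decide)))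
    have ea : τ.a = σ.a := funext fun j => hF'.a j (by simp)
    have e5 : τ.v 5 = a := by rw [hF'.v 5 (by decide), ha]
    have em : τ.m 0 = adjMat G := by rw [hF'.m 0 (by decide), h.lists.adj]
    set b : Fin n := ⟨i, hi⟩ with hb
    have hib : i = (b : ℕ) := rfl
    rw [hib] at hτ
    have va := a.2
    have vb := b.2
    have o1 := hout a
    have o2 := hout b
    have o3 := out_le hα X a
    have o4 := out_le hα X b
    have x1 := hX a
    have x2 := hX b
    have x3 := hX.le_one a
    have x4 := hX.le_one b
    have i1 := h.set a
    have i3 := h.set.le_one a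
    have k1 := key_lt hα hn va (b : ℕ)
    have k2 := key_lt hα hn vb (a : ℕ)
    have kx : ∀ (x y : ℕ) (u v : Fin n), τ.v x = u → τ.v y = v →
        (keyEx x y).eval n τ = key G u v ∧ (keyEx x y).ok n B τ := by
      intro x y u v hx hy
      have k3 := key_lt hα hn u.2 (v : ℕ)
      have u2 := u.2
      have v2 := v.2
      have e1 := (h.order u u.2).2
      have e2 := (h.order v v.2).1
      rw [key] at k3
      refine ⟨by simp [keyEx, Ex.eval, hx, hy, ea, e1, e2, key], ?_⟩
      simp only [keyEx, Ex.ok, Ex.eval, hx, hy, ea, e1, e2]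
      refine ⟨⟨⟨⟨by omega, trivial, u2⟩, by omega, trivial, v2⟩, trivial, by omega⟩, trivial,
        by omega⟩
    obtain ⟨q1, q2⟩ := kx 5 7 a b e5 hτ
    obtain ⟨q3, q4⟩ := kx 7 5 b a hτ e5
    have hmul : (1 - σ.a 14 a) * key G a b ≤ 1 * key G a b :=
      Nat.mul_le_mul_right _ (Nat.sub_le _ _)
    have hiff : (∀ p ∈ [(lit 0, mat 0 (var 5) (var 7)), (arr 14 (var 7), lit 1),
        (Ex.add (arr 19 (var 5)) (arr 15 (var 7)), lit 2),
        (Ex.add (arr 19 (var 7)) (arr 15 (var 5)), lit 2),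
        (Ex.mul (.sub (lit 1) (arr 14 (var 5))) (keyEx 5 7),
          Ex.add (keyEx 7 5) (arr 14 (var 5)))], p.1.eval n τ < p.2.eval n τ) ↔
        Dir I (fun a b : Fin n => key G a b) a b ∧ Bad G X a b := by
      simp only [List.mem_cons, List.not_mem_nil, or_false, forall_eq_or_imp, forall_eq, Ex.eval,
        hτ, e5, ea, em, q1, q3, o1, o2, x1, x2, i1, h.set b, adjMat_pos]
      have d1 : (if b ∈ I then 1 else 0) < 1 ↔ b ∉ I := by by_cases hc : b ∈ I <;> simp [hc]
      have d2 : (1 - if a ∈ I then 1 else 0) * key G a b < key G b a + (if a ∈ I then 1 else 0) ↔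
          (a ∈ I ∨ key G a b < key G b a) := by by_cases hc : a ∈ I <;> simp [hc]
      rw [d1, d2]
      constructor
      · rintro ⟨h1, h2, h3, h4, h5⟩
        exact ⟨⟨h2, h5⟩, h1, (out_lt_two_iff h1).1 h3, (out_lt_two_iff h1.symm).1 h4⟩
      · rintro ⟨⟨h2, h5⟩, h1, h3, h4⟩
        exact ⟨h1, h2, (out_lt_two_iff h1).2 h3, (out_lt_two_iff h1.symm).2 h4, h5⟩
    refine wp_guard ?_ ?_ ?_
    · simp only [List.mem_cons, List.not_mem_nil, or_false, forall_eq_or_imp, forall_eq, Ex.ok,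
        Ex.eval, hτ, e5, ea, q1, q2, q3, q4, va, vb]
      refine ⟨?_, ?_, ?_, ?_, ?_⟩ <;> simp <;> omega
    · intro hg
      exact ⟨trivial, .inr ⟨b, by simp [Ex.eval, hτ], hiff.1 hg⟩⟩
    · intro hg
      rcases hI with ⟨h1, h2⟩ | h1
      · refine .inl ⟨by simpa using h1, fun c hc => ?_⟩
        rcases Nat.lt_succ_iff_lt_or_eq.1 hc with h3 | h3
        · exact h2 c h3
        · obtain rfl : c = b := Fin.ext h3
          exact fun h4 h5 => hg (hiff.2 ⟨h4, h5⟩)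
      · exact .inr (by simpa using h1)
  · rintro τ - - (⟨h1, h2⟩ | h1)
    · exact .inl ⟨h1, fun b => h2 b b.2⟩
    · exact .inr h1

/-- Repair the bad edge `ab` for the vertices `a` in variable `5` and `b` in variable `6`. -/
def progMove : Cmd :=
  seq (asg 8 (lit 0)) (seq
    (forn 9 (guard [(lit 0, mat 0 (var 6) (var 9)),
      (lit 0, .add (.sub (var 9) (var 5)) (.sub (var 5) (var 9)))] (asg 8 (var 9)))) (seq
    (put 15 (var 8) (lit 0)) (seq (put 16 (var 6) (lit 1))
    (Cmd.map 9 19 (.add (arr 19 (var 9)) (mat 0 (var 8) (var 9)))))))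

theorem progMove_spec (hE : Env n B ρ) (hα : TriFree n (adjMat G)) {σ : St}
    {I Y Z : Finset (Fin n)} (h : Setup G I σ) (hY : Holds σ 15 Y) (hZ : Holds σ 16 Z)
    (hout : ∀ v : Fin n, σ.a 19 v = out G Y v) {a b : Fin n} (ha : σ.v 5 = a) (hb : σ.v 6 = b)
    (hex : ∃ w, G.Adj b w ∧ w ≠ a) (hsub : ∀ w, G.Adj b w → w ≠ a → w ∈ Y) :
    progMove.wp n B ρ (fun τ => ∃ w, G.Adj b w ∧ w ≠ a ∧ Holds τ 15 (Y.erase w) ∧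
      Holds τ 16 (insert b Z) ∧ ∀ v : Fin n, τ.a 19 v = out G (Y.erase w) v) σ := by
  have hB := hE.lt
  have hn := hE.four
  have va := a.2
  have vb := b.2
  refine ⟨by simp [Ex.ok], ?_⟩
  refine wp_seq (P := fun τ => ∃ w : Fin n, τ.v 8 = w ∧ G.Adj b w ∧ w ≠ a) ?_ ?_
  · refine wp_forn hE (by decide) (fun i τ => (∃ w : Fin n, τ.v 8 = w ∧ G.Adj b w ∧ w ≠ a) ∨
      ∀ w : Fin n, (w : ℕ) < i → ¬ (G.Adj b w ∧ w ≠ a)) ?_ ?_ ?_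
    · exact .inr fun w hw => by omega
    · rintro i hi τ hτ hF hI
      have e5 : τ.v 5 = a := by rw [hF.v 5 (by decide)]; simpa using ha
      have e6 : τ.v 6 = b := by rw [hF.v 6 (by decide)]; simpa using hb
      have em : τ.m 0 = adjMat G := by rw [hF.m 0 (by decide), ← h.lists.adj]; rfl
      set w : Fin n := ⟨i, hi⟩ with hw
      have hiw : i = (w : ℕ) := rfl
      rw [hiw] at hτ
      have vw := w.2
      have hiff : (∀ p ∈ [(lit 0, mat 0 (var 6) (var 9)),
          (lit 0, Ex.add (.sub (var 9) (var 5)) (.sub (var 5) (var 9)))],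
          p.1.eval n τ < p.2.eval n τ) ↔ G.Adj b w ∧ w ≠ a := by
        simp only [List.mem_cons, List.not_mem_nil, or_false, forall_eq_or_imp, forall_eq, Ex.eval,
          hτ, e5, e6, em, adjMat_pos, ne_eq, Fin.ext_iff]
        refine and_congr_right fun _ => ?_
        omega
      refine wp_guard ?_ ?_ ?_
      · simp only [List.mem_cons, List.not_mem_nil, or_false, forall_eq_or_imp, forall_eq, Ex.ok,
          Ex.eval, hτ, e5, e6, vb, vw]
        simp
        omega
      · intro hg
        exact ⟨trivial, .inl ⟨w, by simp [Ex.eval, hτ], hiff.1 hg⟩⟩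
      · intro hg
        rcases hI with h1 | h1
        · exact .inl (by simpa using h1)
        · refine .inr fun c hc => ?_
          rcases Nat.lt_succ_iff_lt_or_eq.1 hc with h3 | h3
          · exact h1 c h3
          · obtain rfl : c = w := Fin.ext h3
            exact fun h4 => hg (hiff.2 h4)
    · rintro τ - - (h1 | h1)
      · exact h1
      · obtain ⟨w, hw⟩ := hex
        exact absurd hw (h1 w w.2)
  rintro σ1 hF1 ⟨w, e8, hbw, hwa⟩
  have vw := w.2
  have e6 : σ1.v 6 = b := by rw [hF1.v 6 (by decide)]; simpa using hb
  have em : σ1.m 0 = adjMat G := by rw [hF1.m 0 (by decide), ← h.lists.adj]; rfl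
  have ea : σ1.a = σ.a := funext fun j => by
    rw [hF1.a j (by simp [forn, forTo, Cmd.guard, modA])]; rfl
  have f1 : ∀ v : Fin n, ((v : ℕ) = w) = (v = w) := fun v => by rw [Fin.ext_iff]
  have f2 : ∀ v : Fin n, ((v : ℕ) = b) = (v = b) := fun v => by rw [Fin.ext_iff]
  refine ⟨by norm_num, trivial, by simp [Ex.ok], by simp [Ex.eval, e8], ?_⟩
  refine ⟨by norm_num, trivial, by simp [Ex.ok], by simp [Ex.eval, e6], ?_⟩
  refine wp_map hE (by norm_num) (fun i => σ.a 19 i + adjMat G w i) (fun i hi τ hF hτ h19 => ?_)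
    fun τ hF h19 => ⟨w, hbw, hwa, fun v => ?_, fun v => ?_, fun v => ?_⟩
  · have g8 : τ.v 8 = w := by rw [hF.v 8 (by decide)]; simpa using e8
    have gm : τ.m 0 = adjMat G := by rw [hF.m 0 (by decide)]; simpa using em
    have g19 : τ.a 19 i = σ.a 19 i := by rw [h19]; simp [ea]
    have := out_le hα Y ⟨i, hi⟩
    have ho := hout ⟨i, hi⟩
    have := hα.le_one w i
    simp only at ho
    refine ⟨⟨⟨by norm_num, trivial, by simpa [Ex.eval, hτ] using hi⟩, ⟨by norm_num, trivial,
      trivial, by simp [Ex.eval, g8], by simpa [Ex.eval, hτ] using hi⟩, ?_⟩,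
      by simp [Ex.eval, hτ, g8, gm, g19]⟩
    simp only [Ex.eval, hτ, g8, gm, g19]
    omega
  · rw [hF.a 15 (by decide)]
    by_cases h1 : v = w <;> simp [Ex.eval, e8, ea, f1, hY v, h1]
  · rw [hF.a 16 (by decide)]
    by_cases h1 : v = b <;> simp [Ex.eval, e6, ea, f2, hZ v, h1]
  · rw [h19 v v.2, hout, out_erase hα (hsub w hbw hwa)]

/-- Repair of the bad edges of the set in array `15`, which is replaced by what remains of it; the
recorded ends go to array `16`. -/
def progStage : Cmd :=
  seq (Cmd.map 0 16 (lit 0)) (seq (Cmd.map 0 24 (.sub (lit 1) (arr 15 (var 0)))) (seq (nbrSum 24 19)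
    (forTo 3 4 (.add len len) (seq
      (ite (var 4) len (asg 5 (var 4)) (asg 5 (.sub (var 4) len)))
      (guard [(.add (.sub (arr 20 (var 5)) (var 4)) (.sub (var 4) (arr 20 (var 5))), lit 1)]
        (seq progFind (guard [(var 6, len)] progMove)))))))

/-- The loop runs through the positions `t` of the processing order; the vertex at position `t` can
only be `t` or `t - n`. -/
theorem progStage_spec (hE : Env n B ρ) (h : Host G) {σ : St}
    (hρ : ∀ v < n, deg n (adjMat G) v ≤ ρ 1) {I X : Finset (Fin n)} (hs : Setup G I σ)
    (hX : Holds σ 15 X) (hH : StageHyp G I (fun a b : Fin n => key G a b) X) :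
    progStage.wp n B ρ (fun τ => ∃ Y Z, Holds τ 15 Y ∧ Holds τ 16 Z ∧
      StageInv G I (fun a : Fin n => pos G a) (fun a b : Fin n => key G a b) X (n + n) Y Z) σ := by
  have hα := adjMat_triFree h.tri
  have hB := hE.lt
  have hn := hE.four
  refine wp_seq (P := fun τ => ∀ v < n, τ.a 16 v = 0)
    (wp_map hE (by norm_num) (fun _ => 0) (fun _ _ _ _ _ _ => ⟨by simp [Ex.ok], rfl⟩)
      fun τ _ h => h) ?_
  intro σ1 hF1 h16
  refine wp_seq (P := fun τ => ∀ v < n, τ.a 24 v = 1 - σ.a 15 v)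
    (wp_map hE (by norm_num) _ (fun i hi τ hF hτ _ => ⟨⟨by simp [Ex.ok], by norm_num, trivial,
      by simpa [Ex.eval, hτ] using hi⟩,
      by simp [Ex.eval, hτ, hF.a 15, hF1.a 15 (by decide)]⟩) fun τ _ h => h) ?_
  intro σ2 hF2 h24
  have hF12 : Fr [0] [16, 24] [] σ σ2 := (hF1.mono (by decide) (by decide) (by decide)).trans
    (hF2.mono (by decide) (by decide) (by decide))
  have hsum : ∀ v : Fin n, nsum n (adjMat G) v (σ2.a 24) = out G X v := fun v => by
    rw [nsum_fin, out]
    refine Finset.sum_congr rfl fun w _ => ?_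
    rw [h24 w w.2, hX w]; split <;> simp
  refine wp_seq (P := fun τ => ∀ v : Fin n, τ.a 19 v = out G X v) ?_ ?_
  · refine nbrSum_spec hE hα (hs.lists.fr hF12 (by decide)) hρ (by norm_num)
      (by norm_num) (by norm_num) (by norm_num) (fun v hv => ?_) fun τ hF h v => ?_
    · have := nsum_le hα (v := v) (g := σ2.a 24) (M := 1) fun u hu => by
        rw [h24 u hu]; exact Nat.sub_le _ _
      omega
    · rw [h v v.2, hsum]
  intro σ3 hF3 h19
  have hF13 : Fr [0, 1, 2] [16, 24, 19] [] σ σ3 :=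
    (hF12.mono (by decide) (by decide) (by decide)).trans
      (hF3.mono (by decide) (by decide) (by decide))
  have s3 : Setup G I σ3 := hs.fr hF13 (by decide)
  refine wp_forTo (n + n) hE.b3 (by omega) (by decide)
    (fun τ _ => ⟨⟨trivial, trivial, by simp only [Ex.eval]; omega⟩, rfl⟩)
    (fun t τ => ∃ Y Z, Holds τ 15 Y ∧ Holds τ 16 Z ∧ (∀ v : Fin n, τ.a 19 v = out G Y v) ∧
      StageInv G I (fun a : Fin n => pos G a) (fun a b : Fin n => key G a b) X t Y Z) ?_ ?_ ?_
  · refine ⟨X, ∅, hX.congr fun v => ?_, fun v => ?_, h19, StageInv.init X⟩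
    · rw [St.setv_a, hF13.a 15 (by decide)]
    · rw [St.setv_a, hF3.a 16 (by decide), hF2.a 16 (by decide), h16 v v.2]; simp
  · rintro t ht τ hτ hF ⟨Y, Z, hY, hZ, ho, hI⟩
    have hF := hF.mono (V' := [4, 5, 6, 7, 8, 9]) (A' := [15, 16, 19]) (M' := []) (by decide)
      (by decide) (by decide)
    have sτ : Setup G I τ := s3.fr hF (by decide)
    refine wp_seq (P := fun υ => υ.v 5 = if t < n then t else t - n) ?_ ?_
    · refine ⟨trivial, trivial, fun hlt => ⟨trivial, ?_⟩, fun hlt => ⟨by simp [Ex.ok], ?_⟩⟩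
      · simp only [Ex.eval, hτ] at hlt
        simp [Ex.eval, hτ, hlt]
      · simp only [Ex.eval, hτ] at hlt
        simp [Ex.eval, hτ, hlt]
    intro υ hFυ h5
    have hFυ := hFυ.mono (V' := [5]) (A' := []) (M' := []) (by decide) (by decide) (by decide)
    have sυ : Setup G I υ := sτ.fr hFυ (by decide)
    have ea : υ.a = τ.a := funext fun j => hFυ.a j (by simp)
    have e4 : υ.v 4 = t := by rw [hFυ.v 4 (by decide), hτ]
    have hlt : (if t < n then t else t - n) < n := by split <;> omega
    set a : Fin n := ⟨_, hlt⟩ with ha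
    have h5 : υ.v 5 = a := h5
    have va := a.2
    have e20 := (sυ.order a a.2).1
    have hpos := pos_lt (G := G) va
    -- the only vertex that can be processed at time `t` is `a`
    have huniq : ∀ c : Fin n, pos G c = t → c = a := fun c hc => by
      apply Fin.ext
      have := c.2
      have := deg_pos h c
      have hav : (a : ℕ) = if t < n then t else t - n := rfl
      rw [hav]
      rcases Nat.lt_or_ge (deg n (adjMat G) c) 2 with h1 | h1
      · rw [pos_of_leaf (by omega)] at hc; rw [if_pos (by omega)]; exact hc
      · rw [pos_of_two_le h1] at hc; rw [if_neg (by omega)]; omega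
    have hY' : Holds υ 15 Y := by rw [Holds, ea]; exact hY
    have hZ' : Holds υ 16 Z := by rw [Holds, ea]; exact hZ
    have ho' : ∀ v : Fin n, υ.a 19 v = out G Y v := by rw [ea]; exact ho
    refine wp_guard ?_ ?_ ?_
    · simp [Ex.ok, Ex.eval, h5, e4, e20]; omega
    · intro hg
      have hat : pos G a = t := by
        simp [Ex.eval, h5, e4, e20] at hg; omega
      refine wp_seq (progFind_spec hE hα sυ hY' ho' h5) ?_
      intro ν hFν hν
      have hFν := hFν.mono (V' := [6, 7]) (A' := []) (M' := []) (by decide) (by decide) (by decide)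
      have sν : Setup G I ν := sυ.fr hFν (by decide)
      have ea' : ν.a = υ.a := funext fun j => hFν.a j (by simp)
      have hY'' : Holds ν 15 Y := by rw [Holds, ea']; exact hY'
      have hZ'' : Holds ν 16 Z := by rw [Holds, ea']; exact hZ'
      have ho'' : ∀ v : Fin n, ν.a 19 v = out G Y v := by rw [ea']; exact ho'
      refine wp_guard (by simp [Ex.ok]) ?_ ?_
      · intro hg'
        have hg' : ν.v 6 < n := by simpa [Ex.eval] using hg'
        rcases hν with ⟨h1, -⟩ | ⟨b, h1, h2, h3⟩
        · omega
        refine Cmd.wp_mono _ (progMove_spec hE hα sν hY'' hZ'' ho''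
          (by rw [hFν.v 5 (by decide)]; exact h5) h1
          (hH.p2 a b (h3.mono hI.sub) h2) h3.2.2) ?_
        rintro μ ⟨w, h4, h5, h6, h7, h8⟩
        refine ⟨_, _, h6, h7, h8, ?_⟩
        have hI' := hI
        rw [← hat] at hI' ⊢
        exact hI'.step (keyFn h) hH h3 h2 h4 h5
      · intro hg'
        have hg' : ¬ ν.v 6 < n := by simpa [Ex.eval] using hg'
        rcases hν with ⟨-, h2⟩ | ⟨b, h1, -⟩
        · refine ⟨Y, Z, hY'', hZ'', ho'', hI.skip fun c b hc => ?_⟩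
          rw [huniq c hc]
          exact h2 b
        · have := b.2; omega
    · intro hg
      refine ⟨Y, Z, hY', hZ', ho', hI.skip fun c b hc => ?_⟩
      rw [huniq c hc] at hc
      exact absurd (by simp [Ex.eval, h5, e4, e20]; omega) hg
  · rintro τ - - ⟨Y, Z, h1, h2, -, h3⟩
    exact ⟨Y, Z, h1, h2, h3⟩

/-! ### Classes of twins -/

/-- `T` is the set of vertices without twins, and `S` contains one vertex of every other class of
twins; `D` bounds the size of the classes. -/
structure TwinData (G : SimpleGraph (Fin n)) (D : ℕ) (T S : Finset (Fin n)) : Prop where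
  triv : ∀ v, v ∈ T ↔ ∀ b, Twin G v b → v = b
  dup : ∀ a ∈ S, ∃ b, b ∉ S ∧ Twin G a b
  inj : ∀ a ∈ S, ∀ b ∈ S, Twin G a b → a = b
  count : n ≤ D * S.card + T.card

theorem cls_fin (R : ℕ → ℕ) (c : ℕ) :
    cls n R c = (univ.filter fun v : Fin n => R v = c).card := by
  rw [cls, Finset.card_filter, Finset.sum_range, Finset.card_filter]

theorem Labels.twin_iff (hα : TriFree n (adjMat G)) {R : ℕ → ℕ} (hR : Labels n (adjMat G) n R)
    (u v : Fin n) : R u = R v ↔ Twin G u v := by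
  have h : Twin G u v ↔ ∀ w : Fin n, adjMat G w u = adjMat G w v := by
    refine forall_congr' fun w => ?_
    rw [hα.symm w u, hα.symm w v, ← adjMat_pos, ← adjMat_pos]
    have := hα.le_one u w
    have := hα.le_one v w
    omega
  rw [h]
  constructor
  · intro he w
    rw [← hR.agree u u.2 w w.2, ← hR.agree v v.2 w w.2, he]
  · intro he
    exact hR.eq u u.2 v v.2 fun w hw => he ⟨w, hw⟩

/-- The representatives with a class of one vertex are the vertices without twins. A class has at
most `D` vertices, because all of them are neighbours of one vertex. -/
theorem Labels.twinData (h : Host G) {R : ℕ → ℕ} (hR : Labels n (adjMat G) n R) {D : ℕ}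
    (hD : ∀ v : Fin n, deg n (adjMat G) v ≤ D) :
    TwinData G D (univ.filter fun v : Fin n => cls n R v = 1)
      (univ.filter fun v : Fin n => 2 ≤ cls n R v) := by
  have hα := adjMat_triFree h.tri
  have ht := hR.twin_iff hα
  have hmem : ∀ c : Fin n, 1 ≤ cls n R c → R c = c := by
    intro c hc
    rw [cls_fin] at hc
    obtain ⟨v, hv⟩ := Finset.card_pos.1 hc
    have hv : R v = c := by simpa using hv
    have : R (⟨R v, hR.lt v v.2⟩ : Fin n) = R v := by
      refine hR.eq _ (hR.lt v v.2) v v.2 fun w hw => ?_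
      exact hR.agree v v.2 w hw
    simpa [hv] using this
  have hrep : ∀ c : Fin n, ∃ r : Fin n, R c = r ∧ Twin G c r := fun c => by
    refine ⟨⟨R c, hR.lt c c.2⟩, rfl, (ht _ _).1 ?_⟩
    exact (hR.eq _ (hR.lt c c.2) c c.2 fun w hw => hR.agree c c.2 w hw).symm
  refine ⟨fun v => ?_, fun a ha => ?_, fun a ha b hb hab => ?_, ?_⟩
  · rw [Finset.mem_filter, cls_fin, Finset.card_eq_one]
    constructor
    · rintro ⟨-, c, hc⟩ b hb
      have hv := hmem v (by rw [cls_fin, hc, Finset.card_singleton])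
      have h1 : v ∈ univ.filter fun u : Fin n => R u = v := by simp [hv]
      have h2 : b ∈ univ.filter fun u : Fin n => R u = v := by
        simp [← (ht v b).2 hb, hv]
      rw [hc, Finset.mem_singleton] at h1 h2
      rw [h1, h2]
    · intro hv
      obtain ⟨r, h1, h2⟩ := hrep v
      obtain rfl := hv r h2
      refine ⟨Finset.mem_univ _, v, ?_⟩
      ext b
      simp only [Finset.mem_filter, Finset.mem_univ, true_and, Finset.mem_singleton]
      constructor
      · intro hb
        exact (hv b ((ht v b).1 (h1.trans hb.symm))).symm
      · rintro rfl; exact h1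
  · have ha : 2 ≤ cls n R a := by simpa using ha
    have hRa := hmem a (by omega)
    rw [cls_fin] at ha
    obtain ⟨b, hb, hba⟩ := Finset.exists_mem_ne ha a
    have hb : R b = a := by simpa using hb
    refine ⟨b, fun hbS => hba ?_, (ht a b).1 (hRa.trans hb.symm)⟩
    have hbS : 2 ≤ cls n R b := by simpa using hbS
    exact Fin.ext ((hmem b (by omega)).symm.trans hb)
  · have ha : 2 ≤ cls n R a := by simpa using ha
    have hb : 2 ≤ cls n R b := by simpa using hb
    exact Fin.ext ((hmem a (by omega)).symm.trans (((ht a b).2 hab).trans (hmem b (by omega))))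
  · -- a class of twins lies in the neighbourhood of one vertex
    have hcls : ∀ c : Fin n, cls n R c ≤ D := fun c => by
      obtain ⟨z, hz⟩ := h.exists_adj c
      refine le_trans ?_ (hD z)
      rw [cls_fin, Finset.card_filter, deg, Finset.sum_range]
      refine Finset.sum_le_sum fun v _ => ?_
      split
      · next hv =>
        rcases Nat.eq_zero_or_pos (cls n R c) with h0 | h0
        · rw [cls_fin, Finset.card_eq_zero] at h0
          exact absurd hv (by simpa using Finset.eq_empty_iff_forall_notMem.1 h0 v)
        · have h1 : Twin G c v := (ht c v).1 ((hmem c h0).trans hv.symm)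
          rw [adjMat_eq_one ((h1 z).1 hz).symm]
      · exact Nat.zero_le _
    have hsum : ∑ c : Fin n, cls n R c = n := by
      have := Finset.card_eq_sum_card_fiberwise (s := (univ : Finset (Fin n)))
        (t := (univ : Finset (Fin n))) (f := fun v => ⟨R v, hR.lt v v.2⟩) (fun _ _ => by simp)
      rw [Finset.card_univ, Fintype.card_fin] at this
      refine Eq.trans ?_ this.symm
      refine Finset.sum_congr rfl fun c _ => ?_
      rw [cls_fin]
      simp [Fin.ext_iff]
    calc n = ∑ c : Fin n, cls n R c := hsum.symm
      _ ≤ ∑ c : Fin n, ((D * if 2 ≤ cls n R c then 1 else 0) + if cls n R c = 1 then 1 else 0) := by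
        refine Finset.sum_le_sum fun c _ => ?_
        have := hcls c
        split_ifs <;> omega
      _ = _ := by
        rw [Finset.sum_add_distrib, ← Finset.mul_sum, Finset.card_filter, Finset.card_filter]

/-- Preparations: adjacency lists, maximum degree, tables, and classes of twins. -/
def progPrep : Cmd :=
  seq progLists (seq progMax (seq progTable (seq progRefine progClasses)))

theorem progPrep_spec (hE : Env n B ρ) (h : Host G) {D : ℕ}
    (hD : ∀ v < n, deg n (adjMat G) v ≤ D)
    (hD' : ∀ m, (∀ v < n, deg n (adjMat G) v ≤ m) → D ≤ m) {σ : St} (h0 : σ.m 0 = adjMat G) :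
    progPrep.wp n B ρ (fun τ => Ready n (adjMat G) τ ∧ τ.v 10 = D ∧ ∃ T S, TwinData G D T S ∧
      Holds τ 4 T ∧ τ.v 12 = T.card ∧ Holds τ 23 S) σ := by
  have hα := adjMat_triFree h.tri
  refine wp_seq (progLists_spec hE hα h0) fun σ1 hF1 hL1 => ?_
  refine wp_seq (progMax_spec hE hL1) fun σ2 hF2 hm => ?_
  have hL2 := hL1.fr (V := [0, 10]) (A := [])
    (hF2.mono (by decide) (by decide) (by decide)) (by decide)
  refine wp_seq (progTable_spec hE) fun σ3 hF3 ht => ?_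
  have hL3 := hL2.fr (V := [0, 11]) (A := [5, 6])
    (hF3.mono (by decide) (by decide) (by decide)) (by decide)
  have r3 : Ready n (adjMat G) σ3 :=
    ⟨hL3, ht.1, fun d hd => (ht.2 d hd).1, fun d hd => (ht.2 d hd).2⟩
  refine wp_seq (progRefine_spec hE hα hL3.adj) fun σ4 hF4 hR => ?_
  have r4 : Ready n (adjMat G) σ4 := r3.fr (V := [0, 1, 2]) (A := [1, 2])
    (hF4.mono (by decide) (by decide) (by decide)) (by decide) (by decide)
  refine Cmd.wp_of (progClasses_spec hE hR) ?_
  rintro τ hF5 ⟨h4, h23, h12⟩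
  have e10 : τ.v 10 = σ2.v 10 := by
    rw [hF5.v 10 (by decide), hF4.v 10 (by decide), hF3.v 10 (by decide)]
  have hcl : ∀ v : Fin n, 1 / cls n (σ4.a 1) v = if cls n (σ4.a 1) v = 1 then 1 else 0 := by
    intro v
    rcases Nat.lt_trichotomy (cls n (σ4.a 1) v) 1 with h1 | h1 | h1
    · simp [Nat.lt_one_iff.1 h1]
    · simp [h1]
    · rw [Nat.div_eq_of_lt h1, if_neg (by omega)]
  refine ⟨r4.fr (V := [0, 1, 12]) (A := [3, 4, 23])
    (hF5.mono (by decide) (by decide) (by decide)) (by decide) (by decide), ?_, _, _,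
    hR.twinData h fun v => hD v v.2, fun v => ?_, ?_, fun v => ?_⟩
  · rw [e10]
    exact le_antisymm (hm.2 D hD) (hD' _ hm.1)
  · rw [h4 v v.2, hcl]; simp
  · rw [h12, Finset.sum_range, Finset.sum_congr rfl fun v _ => hcl v, Finset.card_filter]
  · rw [h23 v v.2]
    simp only [Finset.mem_filter, Finset.mem_univ, true_and]
    rcases Nat.lt_trichotomy (cls n (σ4.a 1) v) 1 with h1 | h1 | h1
    · simp [Nat.lt_one_iff.1 h1]
    · simp [h1]
    · rw [Nat.div_eq_of_lt (by omega), if_pos (by omega)]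

/-- Choice of a large independent set of vertices without twins, and of the processing order. -/
def progBase : Cmd := seq progGreedy (seq progSwap progOrder)

theorem Holds.ind {σ : St} {j : ℕ} {X : Finset (Fin n)} (h : Holds σ j X) {v : ℕ} (hv : v < n) :
    σ.a j v = ind (X.map Fin.valEmbedding) v := by
  have := h ⟨v, hv⟩
  simp only at this
  rw [this, IdCode.ind]
  congr 1
  simp only [Finset.mem_map, Fin.valEmbedding_apply, eq_iff_iff]
  exact ⟨fun h => ⟨_, h, rfl⟩, fun ⟨u, h1, h2⟩ => by
    obtain rfl : u = ⟨v, hv⟩ := Fin.ext h2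
    exact h1⟩

theorem progBase_spec (hE : Env n B ρ) (h : Host G) {σ : St} (hr : Ready n (adjMat G) σ)
    (hρ : ∀ v < n, deg n (adjMat G) v ≤ ρ 1) {D : ℕ} (hD : ∀ v < n, deg n (adjMat G) v ≤ D)
    (hDn : D < n) (h10 : σ.v 10 = D) {T S : Finset (Fin n)} (hT : TwinData G D T S)
    (h4 : Holds σ 4 T) (h12 : σ.v 12 = T.card)
    (hρ2 : ∀ i, i * n ^ 8 < n * shF (n ^ 8) D → i < ρ 2) :
    progBase.wp n B ρ (fun τ => ∃ I, Setup G I τ ∧ Base G I ∧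
      T.card * shF (n ^ 8) D ≤ I.card * n ^ 8) σ := by
  have hα := adjMat_triFree h.tri
  have hsub : T.map Fin.valEmbedding ⊆ range n := fun i hi => by
    obtain ⟨v, -, rfl⟩ := Finset.mem_map.1 hi
    simp
  subst h10
  refine wp_seq (progGreedy_spec hE hα hr hρ hsub (fun v hv => h4.ind hv)
    (by rw [h12, Finset.card_map]) hD hDn hρ2) ?_
  rintro σ1 hF1 ⟨I', hI'T, hI', hind, hcard⟩
  rw [Finset.card_map] at hcard
  have hL1 := (hr.fr (V := [0, 1, 2, 3, 13]) (A := [7, 8, 9, 10, 11, 12, 13, 14])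
    (hF1.mono (by decide) (by decide) (by decide)) (by decide) (by decide)).lists
  have h41 : Holds σ1 4 T := h4.congr fun v => by rw [hF1.a 4 (by decide)]
  set I₀ : Finset (Fin n) := univ.filter fun v : Fin n => (v : ℕ) ∈ I' with hI₀
  have hI₀h : Holds σ1 14 I₀ := fun v => by rw [hI' v v.2, ind]; simp [hI₀]
  have hI₀c : I'.card = I₀.card := by
    rw [← Finset.card_map (s := I₀) Fin.valEmbedding]
    congr 1
    ext i
    simp only [hI₀, Finset.mem_map, Finset.mem_filter, Finset.mem_univ, true_and,
      Fin.valEmbedding_apply]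
    exact ⟨fun hi => ⟨⟨i, by simpa using hsub (hI'T hi)⟩, hi, rfl⟩,
      by rintro ⟨v, hv, rfl⟩; exact hv⟩
  refine wp_seq (progSwap_spec hE h hL1 h41 hI₀h) ?_
  rintro σ2 hF2 ⟨I, hI, hIiff⟩
  have hL2 := hL1.fr (V := [0, 1]) (A := [14])
    (hF2.mono (by decide) (by decide) (by decide)) (by decide)
  have hbase := Base.of_swap h (I₀ := I₀) (I := I)
    (fun a ha b hb hab => by
      have h1 : (a : ℕ) ∈ I' := by simpa [hI₀] using ha
      have h2 : (b : ℕ) ∈ I' := by simpa [hI₀] using hb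
      have := hind a h1 b h2
      rw [adjMat_eq_one hab] at this; omega)
    (fun a ha => by
      have h1 : (a : ℕ) ∈ I' := by simpa [hI₀] using ha
      obtain ⟨a', ha', he⟩ := Finset.mem_map.1 (hI'T h1)
      obtain rfl : a' = a := Fin.ext he
      exact (hT.triv _).1 ha')
    (fun v => (∃ u, LeafAt G v u) ∧ v ∈ T) (fun v => by rw [hT.triv]) hIiff
  refine Cmd.wp_of (progOrder_spec hE hα hL2 hρ) ?_
  intro τ hF3 h3
  refine ⟨I, ⟨hL2.fr (V := [0, 1, 2]) (A := [20, 21])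
    (hF3.mono (by decide) (by decide) (by decide)) (by decide),
    hI.congr fun v => by rw [hF3.a 14 (by decide)], h3⟩, hbase.1, hcard.trans ?_⟩
  rw [hI₀c]
  exact Nat.mul_le_mul_right _ hbase.2

/-! ### The best of several codes -/

/-- Array `22` holds a set of at least `m` vertices whose complement is an identifying code, and
variable `14` its size. -/
def Best (G : SimpleGraph (Fin n)) (m : ℕ) (σ : St) : Prop :=
  ∃ S : Finset (Fin n), Holds σ 22 S ∧ IsIdentifyingCode G {v | v ∉ S} ∧ σ.v 14 = S.card ∧
    m ≤ S.card

theorem Best.fr {m : ℕ} {V A M : List ℕ} {σ τ : St} (h : Best G m σ) (hF : Fr V A M σ τ)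
    (hV : 14 ∉ V) (hA : 22 ∉ A) : Best G m τ := by
  obtain ⟨S, h1, h2, h3, h4⟩ := h
  exact ⟨S, h1.congr fun v => by rw [hF.a 22 hA], h2, by rw [hF.v 14 hV, h3], h4⟩

/-- Replace the set in array `22` by the set in array `j` if the latter is larger. -/
def progConsider (j : ℕ) : Cmd :=
  seq (Cmd.sum 0 15 (arr j (var 0))) (guard [(var 14, var 15)]
    (seq (asg 14 (var 15)) (Cmd.map 0 22 (arr j (var 0)))))

theorem progConsider_spec (hE : Env n B ρ) {σ : St} {j m : ℕ} (hj : j < 32) (hj' : j ≠ 22)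
    {X : Finset (Fin n)} (hX : Holds σ j X) (hcode : IsIdentifyingCode G {v | v ∉ X})
    (hb : Best G m σ) :
    (progConsider j).wp n B ρ (Best G (max m X.card)) σ := by
  have hB := hE.lt
  have hn := hE.four
  have hXn : X.card ≤ n := by simpa using Finset.card_le_univ X
  have hsum : ∑ i ∈ range n, σ.a j i = X.card := by
    rw [Finset.sum_range, Finset.sum_congr rfl fun v _ => hX v]; simp
  obtain ⟨S, h1, h2, h3, h4⟩ := hb
  refine wp_seq (P := fun τ => τ.v 15 = X.card ∧ τ.v 14 = S.card ∧ τ.a = σ.a) ?_ ?_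
  · refine wp_sum hE (by norm_num) (fun i => σ.a j i) (fun i hi τ hF hτ => ?_) (by omega)
      fun τ hF h => ⟨h.trans hsum, ?_, funext fun k => hF.a k (by simp)⟩
    · exact ⟨⟨hj, trivial, by simpa [Ex.eval, hτ] using hi⟩, by simp [Ex.eval, hτ, hF.a j]⟩
    · rw [hF.v 14 (by decide), h3]
  rintro σ1 - ⟨h15, h14, ha⟩
  refine wp_guard (by simp [Ex.ok]) (fun hg => ?_) fun hg => ?_
  · have hg : S.card < X.card := by simpa [Ex.eval, h14, h15] using hg
    refine ⟨trivial, wp_map hE (by norm_num) (fun i => σ.a j i) (fun i hi τ hF hτ _ => ?_)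
      fun τ hF h => ?_⟩
    · exact ⟨⟨hj, trivial, by simpa [Ex.eval, hτ] using hi⟩,
        by simp [Ex.eval, hτ, hF.a j (by simpa using hj'), ha]⟩
    · refine ⟨X, fun v => by rw [h v v.2, hX v], hcode, ?_, by omega⟩
      rw [hF.v 14 (by decide)]; simp [Ex.eval, h15]
  · have hg : ¬ S.card < X.card := by simpa [Ex.eval, h14, h15] using hg
    exact ⟨S, fun v => by rw [ha, h1 v], h2, h14, by omega⟩

/-- Compare the three sets without bad edges obtained by repairing and repairing once more, and
the set of representatives of the classes of twins. -/
def progBest : Cmd :=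
  seq (Cmd.map 0 22 (lit 0)) (seq (asg 14 (lit 0)) (seq (Cmd.map 0 15 (arr 14 (var 0)))
    (seq progStage (seq (progConsider 15) (seq (Cmd.map 0 15 (arr 16 (var 0)))
    (seq progStage (seq (progConsider 15) (seq (progConsider 16) (progConsider 23)))))))))

/-- The three sets partition the cardinality of `I`, so that one of them contains a third of it. -/
theorem progBest_spec (hE : Env n B ρ) (h : Host G) (hid : Identifiable G) {σ : St}
    (hρ : ∀ v < n, deg n (adjMat G) v ≤ ρ 1) {I : Finset (Fin n)} (hs : Setup G I σ)
    (hI : Base G I) {D : ℕ} {T S : Finset (Fin n)} (hT : TwinData G D T S) (h23 : Holds σ 23 S) :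
    progBest.wp n B ρ (fun τ => ∃ X, Holds τ 22 X ∧ IsIdentifyingCode G {v | v ∉ X} ∧
      S.card ≤ X.card ∧ I.card ≤ 3 * X.card) σ := by
  have hK := keyFn h
  have copy : ∀ {j : ℕ} {X : Finset (Fin n)} {σ τ : St}, j < 32 → j ≠ 15 → Holds σ j X →
      ∀ i < n, Fr [0] [15] [] σ τ → τ.v 0 = i →
        (arr j (var 0)).ok n B τ ∧ (arr j (var 0)).eval n τ = σ.a j i :=
    fun hj hj' _ i hi hF hτ => ⟨⟨hj, trivial, by simpa [Ex.eval, hτ] using hi⟩,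
      by simp [Ex.eval, hτ, hF.a _ (by simpa using hj')]⟩
  refine wp_seq (P := fun τ => ∀ v < n, τ.a 22 v = 0)
    (wp_map hE (by norm_num) (fun _ => 0) (fun _ _ _ _ _ _ => ⟨by simp [Ex.ok], rfl⟩)
      fun τ _ h => h) ?_
  intro σ1 hF1 h22
  refine wp_seq (P := fun τ => τ.v 14 = 0) ⟨by simp [Ex.ok], by simp [Ex.eval]⟩ ?_
  intro σ2 hF2 h14
  have b2 : Best G 0 σ2 := by
    refine ⟨∅, fun v => by rw [hF2.a 22 (by decide), h22 v v.2]; simp, ?_, by simpa using h14,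
      Nat.zero_le _⟩
    obtain ⟨C, hC1, hC2⟩ := hid
    exact ⟨fun u => (hC1 u).imp fun x hx => ⟨by simp, hx.2⟩,
      fun u v huv => (hC2 u v huv).imp fun x hx => ⟨by simp, hx.2⟩⟩
  have s2 : Setup G I σ2 := (hs.fr (V := [0]) (A := [22])
    (hF1.mono (by decide) (by decide) (by decide)) (by decide)).fr (V := [14]) (A := [])
    (hF2.mono (by decide) (by decide) (by decide)) (by decide)
  have g2 : Holds σ2 23 S := h23.congr fun v => by rw [hF2.a 23 (by decide), hF1.a 23 (by decide)]
  refine wp_seq (P := fun τ => Holds τ 15 I)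
    (wp_map hE (by norm_num) (fun i => σ2.a 14 i) (fun i hi τ hF hτ _ =>
      copy (by norm_num) (by norm_num) s2.set i hi hF hτ)
      fun τ _ h v => by rw [h v v.2, s2.set v]) ?_
  intro σ3 hF3 x3
  have b3 := b2.fr hF3 (by decide) (by decide)
  have s3 : Setup G I σ3 := s2.fr (V := [0]) (A := [15])
    (hF3.mono (by decide) (by decide) (by decide)) (by decide)
  have g3 : Holds σ3 23 S := g2.congr fun v => by rw [hF3.a 23 (by decide)]
  refine wp_seq (progStage_spec hE h hρ s3 x3 (hI.stageHyp hK)) ?_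
  rintro σ4 hF4 ⟨I', E, x4, z4, inv⟩
  have hF4 := hF4.mono (V' := [0, 1, 2, 4, 5, 6, 7, 8, 9]) (A' := [15, 16, 19, 24]) (M' := [])
    (by decide) (by decide) (by decide)
  have b4 := b3.fr hF4 (by decide) (by decide)
  have s4 : Setup G I σ4 := s3.fr hF4 (by decide)
  have g4 : Holds σ4 23 S := g3.congr fun v => by rw [hF4.a 23 (by decide)]
  have hE' : Ends G I (fun a b : Fin n => key G a b) E := fun e he => by
    obtain ⟨a, -, h1, h2, -⟩ := inv.trace e he
    exact ⟨a, h1, h2⟩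
  have c1 := (hI.fit.mono inv.sub).isIdentifyingCode h
    (inv.not_bad (hI.stageHyp hK) fun a => pos_lt a.2)
  refine wp_seq (progConsider_spec hE (by norm_num) (by norm_num) x4 c1 b4) ?_
  intro σ5 hF5 b5
  have hF5 := hF5.mono (V' := [0, 14, 15]) (A' := [22]) (M' := []) (by decide) (by decide)
    (by decide)
  have s5 : Setup G I σ5 := s4.fr hF5 (by decide)
  have g5 : Holds σ5 23 S := g4.congr fun v => by rw [hF5.a 23 (by decide)]
  have z5 : Holds σ5 16 E := z4.congr fun v => by rw [hF5.a 16 (by decide)]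
  refine wp_seq (P := fun τ => Holds τ 15 E)
    (wp_map hE (by norm_num) (fun i => σ5.a 16 i) (fun i hi τ hF hτ _ =>
      copy (by norm_num) (by norm_num) z5 i hi hF hτ) fun τ _ h v => by rw [h v v.2, z5 v]) ?_
  intro σ6 hF6 x6
  have b6 := b5.fr hF6 (by decide) (by decide)
  have s6 : Setup G I σ6 := s5.fr (V := [0]) (A := [15])
    (hF6.mono (by decide) (by decide) (by decide)) (by decide)
  have g6 : Holds σ6 23 S := g5.congr fun v => by rw [hF6.a 23 (by decide)]
  have hS := hE'.stageHyp h hI hK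
  refine wp_seq (progStage_spec hE h hρ s6 x6 hS) ?_
  rintro σ7 hF7 ⟨E', D', x7, z7, inv'⟩
  have hF7 := hF7.mono (V' := [0, 1, 2, 4, 5, 6, 7, 8, 9]) (A' := [15, 16, 19, 24]) (M' := [])
    (by decide) (by decide) (by decide)
  have b7 := b6.fr hF7 (by decide) (by decide)
  have g7 : Holds σ7 23 S := g6.congr fun v => by rw [hF7.a 23 (by decide)]
  have c2 := (hE'.fit.mono inv'.sub).isIdentifyingCode h (inv'.not_bad hS fun a => pos_lt a.2)
  obtain ⟨fitD, badD⟩ := hE'.not_bad_record h hI hK inv'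
  have c3 := fitD.isIdentifyingCode h badD
  refine wp_seq (progConsider_spec hE (by norm_num) (by norm_num) x7 c2 b7) ?_
  intro σ8 hF8 b8
  have g8 : Holds σ8 23 S := g7.congr fun v => by rw [hF8.a 23 (by decide)]
  have z8 : Holds σ8 16 D' := z7.congr fun v => by rw [hF8.a 16 (by decide)]
  refine wp_seq (progConsider_spec hE (by norm_num) (by norm_num) z8 c3 b8) ?_
  intro σ9 hF9 b9
  have g9 : Holds σ9 23 S := g8.congr fun v => by rw [hF9.a 23 (by decide)]
  refine Cmd.wp_mono _ (progConsider_spec hE (by norm_num) (by norm_num) g9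
    (isIdentifyingCode_of_twins h hT.dup hT.inj) b9) ?_
  rintro τ ⟨X, h1, h2, -, h3⟩
  have := inv.card
  have := inv'.card
  exact ⟨X, h1, h2, by omega, by omega⟩

/-- The whole algorithm; the characteristic vector of the code goes to the first row of the
adjacency matrix. -/
def progMain : Cmd :=
  seq progPrep (seq progBase (seq progBest
    (forn 0 (putm 0 (lit 0) (var 0) (.sub (lit 1) (arr 22 (var 0)))))))

/-- Here `s` is the number of classes of at least two twins, `b` the number of vertices without
twins, and `i` the size of the independent set. -/
theorem progMain_spec (hE : Env n B ρ) (h : Host G) (hid : Identifiable G) {D : ℕ}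
    (hD : ∀ v < n, deg n (adjMat G) v ≤ D)
    (hD' : ∀ m, (∀ v < n, deg n (adjMat G) v ≤ m) → D ≤ m) (hDn : D < n) (hρ : D ≤ ρ 1)
    (hρ2 : ∀ i, i * n ^ 8 < n * shF (n ^ 8) D → i < ρ 2) {σ : St} (h0 : σ.m 0 = adjMat G) :
    progMain.wp n B ρ (fun τ => ∃ (X : Finset (Fin n)) (s b i : ℕ),
      (∀ v : Fin n, τ.m 0 0 v = if v ∈ X then 0 else 1) ∧ IsIdentifyingCode G {v | v ∉ X} ∧
      s ≤ X.card ∧ i ≤ 3 * X.card ∧ n ≤ D * s + b ∧ b * shF (n ^ 8) D ≤ i * n ^ 8) σ := by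
  have hρ1 : ∀ v < n, deg n (adjMat G) v ≤ ρ 1 := fun v hv => (hD v hv).trans hρ
  have hn := hE.four
  refine wp_seq (progPrep_spec hE h hD hD' h0) ?_
  rintro σ1 hF1 ⟨hr, h10, T, S, hT, h4, h12, h23⟩
  refine wp_seq (progBase_spec hE h hr hρ1 hD hDn h10 hT h4 h12 hρ2) ?_
  rintro σ2 hF2 ⟨I, hs, hI, hcard⟩
  have g2 : Holds σ2 23 S := h23.congr fun v => by rw [hF2.a 23 (by decide)]
  refine wp_seq (progBest_spec hE h hid hρ1 hs hI hT g2) ?_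
  rintro σ3 hF3 ⟨X, hX, hcode, hSX, hIX⟩
  refine wp_forn hE (by decide) (fun i τ => ∀ v : Fin n, (v : ℕ) < i →
    τ.m 0 0 v = if v ∈ X then 0 else 1) (fun v hv => by omega) ?_ ?_
  · intro i hi τ hτ hF hI'
    have ea : τ.a 22 = σ3.a 22 := hF.a 22 (by decide)
    have hXi : σ3.a 22 i = if (⟨i, hi⟩ : Fin n) ∈ X then 1 else 0 := hX ⟨i, hi⟩
    refine ⟨by norm_num, by simp [Ex.ok], trivial, ⟨by simp [Ex.ok], by norm_num, trivial,
      by simpa [Ex.eval, hτ] using hi⟩, by simp [Ex.eval]; omega,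
      by simpa [Ex.eval, hτ] using hi, fun v hv => ?_⟩
    rcases Nat.lt_succ_iff_lt_or_eq.1 hv with h1 | h1
    · have : (v : ℕ) ≠ i := by omega
      simpa [Ex.eval, hτ, this] using hI' v h1
    · obtain rfl : v = ⟨i, hi⟩ := Fin.ext h1
      simp only [Ex.eval, hτ, ea, hXi, St.setv_m, St.setm_m, and_self, if_true]
      split <;> simp [*]
  · intro τ _ _ hI'
    exact ⟨X, S.card, T.card, I.card, fun v => hI' v v.2, hcode, hSX, hIX, hT.count, hcard⟩

/-! ### Running time -/

/-- Nestings of loops that occur in a command, as lists of the numbers of their bounds. -/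
def Cmd.nests : Cmd → List (List ℕ)
  | seq C D => C.nests ++ D.nests
  | ite _ _ C D => C.nests ++ D.nests
  | loop b _ _ C => [] :: [b] :: C.nests.map (b :: ·)
  | _ => [[]]

/-- The constant factor in the running time of a command. -/
def Cmd.factor : Cmd → ℕ
  | seq C D => C.factor + D.factor
  | ite e f C D => e.cost + f.cost + 1 + (C.factor + D.factor)
  | loop _ e f C => e.cost + f.cost + 1 + (1 + (e.cost + f.cost)) + C.factor
  | skip => 1
  | asg _ e => e.cost + 2
  | put _ e f => e.cost + (f.cost + 6)
  | putm _ e f g => e.cost + (f.cost + (g.cost + 6))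

theorem Cmd.nil_mem_or (C : Cmd) : ∃ l ∈ C.nests, l = [] := by
  induction C with
  | seq C D ih _ => obtain ⟨l, h1, h2⟩ := ih; exact ⟨l, by simp [nests, h1], h2⟩
  | ite e f C D ih _ => obtain ⟨l, h1, h2⟩ := ih; exact ⟨l, by simp [nests, h1], h2⟩
  | _ => exact ⟨[], by simp [nests], rfl⟩

/-- If the product of the bounds of every nesting of loops is at most `M`, the running time is at
most a constant multiple of `M`. -/
theorem Cmd.cost_le (ρ : ℕ → ℕ) (M : ℕ) (C : Cmd) : ∀ c : ℕ,
    (∀ l ∈ C.nests, c * (l.map ρ).prod ≤ M) → c * C.cost ρ ≤ C.factor * M := by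
  have flat : ∀ (C : Cmd) (k c : ℕ), (∀ l ∈ C.nests, c * (l.map ρ).prod ≤ M) → c * k ≤ k * M := by
    intro C k c h
    obtain ⟨l, h1, rfl⟩ := C.nil_mem_or
    have := h _ h1
    rw [mul_comm]
    exact Nat.mul_le_mul_left _ (by simpa using this)
  induction C with
  | skip => exact fun c h => flat _ _ c h
  | asg x e => exact fun c h => flat _ _ c h
  | put j e f => exact fun c h => flat _ _ c h
  | putm k e f g => exact fun c h => flat _ _ c h
  | seq C D ihC ihD =>
    intro c h
    have h1 := ihC c fun l hl => h l (by simp [nests, hl])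
    have h2 := ihD c fun l hl => h l (by simp [nests, hl])
    simp only [cost, factor]
    nlinarith
  | ite e f C D ihC ihD =>
    intro c h
    have h1 := ihC c fun l hl => h l (by simp [nests, hl])
    have h2 := ihD c fun l hl => h l (by simp [nests, hl])
    have h3 := flat _ (e.cost + f.cost + 1) c h
    have h4 : c * max (C.cost ρ) (D.cost ρ) ≤ c * (C.cost ρ + D.cost ρ) :=
      Nat.mul_le_mul_left _ (max_le (Nat.le_add_right _ _) (Nat.le_add_left _ _))
    simp only [cost, factor]
    calc c * (e.cost + (f.cost + (1 + max (C.cost ρ) (D.cost ρ))))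
        = c * (e.cost + f.cost + 1) + c * max (C.cost ρ) (D.cost ρ) := by ring
      _ ≤ (e.cost + f.cost + 1) * M + (C.factor * M + D.factor * M) :=
        Nat.add_le_add h3 (h4.trans (by rw [mul_add]; omega))
      _ = _ := by ring
  | loop b e f C ih =>
    intro c h
    have h1 := ih (c * ρ b) fun l hl => by
      have := h (b :: l) (by simp [nests, hl])
      rwa [List.map_cons, List.prod_cons, ← mul_assoc] at this
    have h2 : c * ρ b ≤ M := by simpa using h [b] (by simp [nests])
    have h3 : c ≤ M := by simpa using h [] (by simp [nests])
    simp only [cost, factor]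
    calc c * (e.cost + (f.cost + (ρ b * (1 + (C.cost ρ + (e.cost + f.cost))) + 1)))
        = c * (e.cost + f.cost + 1) + (c * ρ b) * (1 + (e.cost + f.cost))
          + c * ρ b * C.cost ρ := by ring
      _ ≤ M * (e.cost + f.cost + 1) + M * (1 + (e.cost + f.cost)) + C.factor * M := by gcongr
      _ = _ := by ring

/-- The loops of the algorithm are nested as follows: bound `0` stands for loops over all vertices,
`1` for loops over a neighbourhood, `2` for the rounds of the greedy algorithm, and `3` for the
loop over the processing order. -/
theorem progMain_nests : ∀ l ∈ progMain.nests,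
    l ∈ [[], [0], [1], [2], [3], [0, 0], [0, 1], [2, 0], [2, 0, 1], [3, 0]] := by
  decide +kernel

/-- The table of iteration bounds, for maximum degree `D` and at most `R` rounds of the greedy
algorithm. -/
def bounds (n D R : ℕ) (b : ℕ) : ℕ :=
  if b = 0 then n else if b = 1 then D else if b = 2 then R else n + n

theorem progMain_cost_le {D R : ℕ} (hn : 1 ≤ n) (hD : 1 ≤ D) (hDn : D ≤ n) :
    progMain.cost (bounds n D R) ≤ progMain.factor * (2 * (n * n) + R * (n * D)) := by
  have h := Cmd.cost_le (bounds n D R) (2 * (n * n) + R * (n * D)) progMain 1 ?_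
  · simpa using h
  have h1 : n * 1 ≤ n * n := Nat.mul_le_mul_left _ hn
  have h2 : R * 1 ≤ R * n := Nat.mul_le_mul_left _ hn
  have h3 : R * n * 1 ≤ R * n * D := Nat.mul_le_mul_left _ hD
  have h4 : n * D ≤ n * n := Nat.mul_le_mul_left _ hDn
  have h5 : R * (n * D) = R * n * D := by ring
  have h6 : (n + n) * n = 2 * (n * n) := by ring
  intro l hl
  have := progMain_nests l hl
  simp only [List.mem_cons, List.not_mem_nil, or_false] at this
  rcases this with rfl | rfl | rfl | rfl | rfl | rfl | rfl | rfl | rfl | rfl <;>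
    simp only [bounds, List.map_nil, List.map_cons, List.prod_nil, List.prod_cons, mul_one, one_mul,
      if_true, OfNat.ofNat_ne_zero, OfNat.ofNat_ne_one, one_ne_zero, if_false] <;>
    first | omega | norm_num; omega

/-! ### The input and the hypotheses on the graph -/

/-- In a connected graph, a nonempty set of vertices that is closed under adjacency is everything.
-/
theorem host_of_connected [DecidableRel G.Adj] (hc : G.Connected) (htri : G.CliqueFree 3)
    (hD : 3 ≤ G.maxDegree) : Host G where
  tri a b c h1 h2 h3 := htri {a, b, c} (SimpleGraph.is3Clique_triple_iff.2 ⟨h1, h3, h2⟩)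
  small S hS hcl := by
    obtain ⟨v₀, hv₀⟩ := hS
    have hmem : ∀ v, v ∈ S := fun v => by
      obtain ⟨p⟩ := hc.preconnected v₀ v
      induction p with
      | nil => exact hv₀
      | cons hadj _ ih =>
        refine ih ?_
        obtain ⟨p, hp, q, hq, hN⟩ := hcl _ hv₀
        rcases hN _ hadj with rfl | rfl
        · exact hp
        · exact hq
    have hle : G.maxDegree ≤ 2 := SimpleGraph.maxDegree_le_of_forall_degree_le G 2 fun v => by
      obtain ⟨p, -, q, -, hN⟩ := hcl v (hmem v)
      have : G.neighborFinset v ⊆ {p, q} := fun z hz => by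
        simpa using hN z (by simpa using hz)
      exact (Finset.card_le_card this).trans Finset.card_le_two
    omega

theorem deg_eq_degree [DecidableRel G.Adj] (v : Fin n) : deg n (adjMat G) v = G.degree v := by
  rw [deg, Finset.sum_range, ← SimpleGraph.card_neighborFinset_eq_degree,
    SimpleGraph.neighborFinset_eq_filter, Finset.card_filter]
  refine Finset.sum_congr rfl fun w _ => ?_
  split
  · next h => exact adjMat_eq_one h
  · next h => exact adjMat_eq_zero h

/-- The starting configuration of the machine represents a store that contains the adjacency matrix
and otherwise zeros. -/
theorem inputState_rel [DecidableRel G.Adj] {w : ℕ} (hw : Wide n w) :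
    Rel n w ⟨fun _ => 0, fun k => if k = 0 then adjMat G else fun _ _ => 0, fun _ _ => 0⟩
      (inputState G) where
  len := rfl
  var x := by simp [inputState]
  mat k hk r hr i hi := by
    have hz : k = 1 → ¬ ∃ u v : Fin n, (k * n + r) * n + i = (u : ℕ) * n + v ∧ G.Adj u v := by
      rintro rfl ⟨u, v, h1, -⟩
      have := (cell_inj hi v.2 h1).1
      have := u.2
      omega
    have hk : k = 0 ∨ k = 1 := by omega
    rcases hk with rfl | rfl
    · have hiff : (∃ u v : Fin n, (0 * n + r) * n + i = (u : ℕ) * n + v ∧ G.Adj u v) ↔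
          ∃ u v : Fin n, (u : ℕ) = r ∧ (v : ℕ) = i ∧ G.Adj u v := by
        refine exists_congr fun u => exists_congr fun v => ?_
        constructor
        · rintro ⟨h1, h2⟩
          obtain ⟨h3, h4⟩ := cell_inj hi v.2 h1
          exact ⟨by omega, by omega, h2⟩
        · rintro ⟨h1, h2, h3⟩
          exact ⟨by rw [h1, h2]; ring, h3⟩
      by_cases hx : ∃ u v : Fin n, (u : ℕ) = r ∧ (v : ℕ) = i ∧ G.Adj u v
      · exact (if_pos (hiff.2 hx)).trans (if_pos hx).symm
      · exact (if_neg fun h => hx (hiff.1 h)).trans (if_neg hx).symm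
    · simp only [inputState, if_neg (hz rfl), one_ne_zero, if_false]
  arr j hj i hi := by
    refine if_neg ?_
    rintro ⟨u, v, h1, -⟩
    have := (cell_inj hi v.2 h1).1
    have := u.2
    omega
  regB x := by
    have := hw.small
    simp only [inputState]
    split <;> omega
  memB x := by
    have := hw.small
    simp only [inputState]
    split <;> omega

/-! ### The numerical bounds -/

/-- Bound for the number of rounds of the greedy algorithm, times the maximum degree. -/
theorem rounds_le {D : ℕ} (hD : 1 ≤ D) (hDn : D ≤ n) (hn : 4 ≤ n) :
    (((n * shF (n ^ 8) D) / n ^ 8 + 1 : ℕ) : ℝ) * D ≤ 3 * (n * Real.log n) := by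
  have hn0 : (0 : ℝ) < n := by exact_mod_cast (by omega : 0 < n)
  have hD0 : (0 : ℝ) < D := by exact_mod_cast (by omega : 0 < D)
  have hlog : 1 ≤ Real.log n := by
    rw [Real.le_log_iff_exp_le hn0]
    have h4 : (4 : ℝ) ≤ n := by exact_mod_cast hn
    linarith [Real.exp_one_lt_d9]
  have h1 : (((n * shF (n ^ 8) D) / n ^ 8 : ℕ) : ℝ) * D ≤ n * (1 + Real.log D) := by
    have h2 : (((n * shF (n ^ 8) D) / n ^ 8 : ℕ) : ℝ) ≤ (n * shF (n ^ 8) D : ℕ) / (n ^ 8 : ℕ) :=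
      Nat.cast_div_le
    have h3 := mul_shF_le (n ^ 8) D hD
    have h8 : (0 : ℝ) < ((n ^ 8 : ℕ) : ℝ) := by positivity
    calc (((n * shF (n ^ 8) D) / n ^ 8 : ℕ) : ℝ) * D
        ≤ (n * shF (n ^ 8) D : ℕ) / (n ^ 8 : ℕ) * D := by gcongr
      _ = n * (D * shF (n ^ 8) D) / (n ^ 8 : ℕ) := by push_cast; ring
      _ ≤ n * ((n ^ 8 : ℕ) * (1 + Real.log D)) / (n ^ 8 : ℕ) := by
        refine div_le_div_of_nonneg_right ?_ h8.le
        exact mul_le_mul_of_nonneg_left h3 hn0.le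
      _ = n * (1 + Real.log D) := by field_simp
  have h2 : Real.log D ≤ Real.log n := Real.log_le_log hD0 (by exact_mod_cast hDn)
  have h3 : (D : ℝ) ≤ n := by exact_mod_cast hDn
  push_cast at h1 ⊢
  nlinarith

/-- Balancing the representatives of the classes of twins, which win if there are many classes,
against the three sets obtained by repairing. -/
theorem size_bound {D s b i x : ℕ} (hD : 3 ≤ D) (hDn : D ≤ n) (hn : 4 ≤ n) (hs : s ≤ x)
    (hi : i ≤ 3 * x) (hcount : n ≤ D * s + b) (hI : b * shF (n ^ 8) D ≤ i * n ^ 8) :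
    (n : ℝ) / (D + 3 * D / (Real.log D - 1)) ≤ x := by
  have hD0 : (3 : ℝ) ≤ D := by exact_mod_cast hD
  have hL : 0 < Real.log D - 1 := by
    rw [sub_pos, Real.lt_log_iff_exp_lt (by linarith)]
    linarith [Real.exp_one_lt_d9]
  set L := Real.log D - 1 with hLdef
  have h8 : (0 : ℝ) < ((n ^ 8 : ℕ) : ℝ) := by
    have : 0 < n ^ 8 := by positivity
    exact_mod_cast this
  have hF : ((n ^ 8 : ℕ) : ℝ) * L ≤ D * shF (n ^ 8) D := by
    refine le_trans ?_ (le_mul_shF_log (N := n ^ 8) (d := D) (by omega) ?_)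
    · refine mul_le_mul_of_nonneg_left ?_ h8.le
      have : 0 ≤ (Real.log D + 3 / 2) / (D : ℝ) := by
        have : 0 < Real.log D := by linarith
        positivity
      linarith
    · exact (Nat.mul_le_mul_left _ (Nat.pow_le_pow_left (by omega) 4)).trans (scale_ge hn)
  -- the independent set has at least `b L / D` vertices
  have hb : (b : ℝ) * L ≤ D * i := by
    have hI' : (b : ℝ) * shF (n ^ 8) D ≤ i * ((n ^ 8 : ℕ) : ℝ) := by exact_mod_cast hI
    have : ((n ^ 8 : ℕ) : ℝ) * (b * L) ≤ ((n ^ 8 : ℕ) : ℝ) * (D * i) := by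
      calc ((n ^ 8 : ℕ) : ℝ) * (b * L) = b * (((n ^ 8 : ℕ) : ℝ) * L) := by ring
        _ ≤ b * (D * shF (n ^ 8) D) := by gcongr
        _ = D * (b * shF (n ^ 8) D) := by ring
        _ ≤ D * (i * ((n ^ 8 : ℕ) : ℝ)) := by gcongr
        _ = _ := by ring
    exact le_of_mul_le_mul_left this h8
  have hs' : (s : ℝ) ≤ x := by exact_mod_cast hs
  have hi' : (i : ℝ) ≤ 3 * x := by exact_mod_cast hi
  have hc' : (n : ℝ) ≤ D * s + b := by exact_mod_cast hcount
  have hden : 0 < D + 3 * D / L := by positivity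
  rw [div_le_iff₀ hden]
  have key : (n : ℝ) * L ≤ x * (D * L + 3 * D) := by
    calc (n : ℝ) * L ≤ (D * s + b) * L := by gcongr
      _ = D * L * s + b * L := by ring
      _ ≤ D * L * x + D * (3 * x) := by
        have h1 : (D : ℝ) * i ≤ D * (3 * x) := by gcongr
        have h2 : D * L * s ≤ D * L * (x : ℝ) := by gcongr
        linarith
      _ = _ := by ring
  have e : (x : ℝ) * (D + 3 * D / L) = x * (D * L + 3 * D) / L := by field_simp
  rw [e, le_div_iff₀ hL]
  exact key

end IdCode

theorem mainTheorem5 :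
    ∃ (p : IdCode.Prog) (k : ℕ) (K : ℝ),
      ∀ (n : ℕ) (G : SimpleGraph (Fin n)) [DecidableRel G.Adj],
        G.Connected → IdCode.Identifiable G → G.CliqueFree 3 → 3 ≤ G.maxDegree →
          ∃ (t : ℕ) (s : IdCode.State) (C : Finset (Fin n)),
            IdCode.Exec (k * Nat.clog 2 n) p (IdCode.inputState G) t s ∧
            (t : ℝ) ≤ K * ((n : ℝ) ^ 2 * Real.log n) ∧
            IdCode.Outputs s C ∧
            IdCode.IsIdentifyingCode G (C : Set (Fin n)) ∧
            (C.card : ℝ) ≤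
              n - n / (G.maxDegree + 3 * G.maxDegree / (Real.log G.maxDegree - 1)) := by
  open IdCode in
  refine ⟨progMain.comp, 12, progMain.factor * 5, fun n G _ hc hid htri hD => ?_⟩
  have hn0 : Nonempty (Fin n) := hc.nonempty
  have hDn : G.maxDegree < n := by simpa using G.maxDegree_lt_card_verts
  have hn : 4 ≤ n := by omega
  have h := host_of_connected hc htri hD
  set D := G.maxDegree with hDdef
  set R := (n * shF (n ^ 8) D) / n ^ 8 + 1 with hR
  have hw : Wide n (12 * Nat.clog 2 n) := by
    refine ⟨hn, ?_⟩
    rw [mul_comm, pow_mul]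
    exact Nat.pow_le_pow_left (Nat.le_pow_clog (by norm_num) n) 12
  have hE : Env n (2 ^ (12 * Nat.clog 2 n)) (bounds n D R) :=
    ⟨hn, hw.pow, le_rfl, le_rfl⟩
  have hdeg : ∀ v < n, deg n (adjMat G) v ≤ D := fun v hv => by
    have := deg_eq_degree (G := G) ⟨v, hv⟩
    simp only at this
    rw [this]
    exact G.degree_le_maxDegree _
  have hdeg' : ∀ m, (∀ v < n, deg n (adjMat G) v ≤ m) → D ≤ m := fun m hm =>
    SimpleGraph.maxDegree_le_of_forall_degree_le G m fun v => by
      rw [← deg_eq_degree]; exact hm v v.2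
  have hwp := progMain_spec hE h hid hdeg hdeg' hDn le_rfl
    (fun i hi => by
      have : i ≤ (n * shF (n ^ 8) D) / n ^ 8 :=
        (Nat.le_div_iff_mul_le (by positivity)).2 hi.le
      show i < R
      omega)
    (σ := ⟨fun _ => 0, fun k => if k = 0 then adjMat G else fun _ _ => 0, fun _ _ => 0⟩) rfl
  obtain ⟨t, s, hexec, ht, σ', hrel, X, a, b, i, hout, hcode, hs, hi, hcount, hI⟩ :=
    Cmd.sound hw progMain _ _ _ (inputState_rel hw) hwp
  refine ⟨t, s, Finset.univ.filter (· ∉ X), hexec, ?_, fun v => ?_, ?_, ?_⟩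
  · have h1 : (t : ℝ) ≤ progMain.factor * (2 * (n * n) + R * (n * D)) := by
      exact_mod_cast ht.trans (progMain_cost_le (by omega) (by omega) hDn.le)
    have h2 := rounds_le (n := n) (D := D) (by omega) hDn.le hn
    rw [← hR] at h2
    have hlog : 1 ≤ Real.log n := by
      rw [Real.le_log_iff_exp_le (by positivity)]
      have h4 : (4 : ℝ) ≤ n := by exact_mod_cast hn
      linarith [Real.exp_one_lt_d9]
    refine h1.trans ?_
    rw [mul_assoc]
    refine mul_le_mul_of_nonneg_left ?_ (Nat.cast_nonneg _)
    have h3 : (R : ℝ) * (n * D) ≤ n * (3 * (n * Real.log n)) := by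
      calc (R : ℝ) * (n * D) = n * (R * D) := by ring
        _ ≤ _ := by gcongr
    have h4 : (n : ℝ) * n * 1 ≤ n * n * Real.log n := by gcongr
    nlinarith
  · have h1 := hrel.mat 0 (by norm_num) 0 (by omega) v v.2
    simp only [zero_mul, zero_add] at h1
    rw [h1, hout v]
    by_cases hv : v ∈ X <;> simp [hv]
  · convert hcode using 1
    ext v; simp
  · have h1 := size_bound hD hDn.le hn hs hi hcount hI
    have h2 : (Finset.univ.filter (· ∉ X)).card + X.card = n := by
      have := Finset.card_filter_add_card_filter_not (s := (Finset.univ : Finset (Fin n))) (· ∈ X)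
      simp at this
      simpa [add_comm] using this
    have h3 : ((Finset.univ.filter (· ∉ X)).card : ℝ) + X.card = n := by exact_mod_cast h2
    linarith
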